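/- **Networks.** A network $\mathcal G$ has finitely many nodes and finitely many arrows, with an equivalence relation "same type" on nodes and another on arrows; each arrow $e$ has a head $\mathcal H(e)$ and a tail $\mathcal T(e)$ (multiple arrows and self-loops are allowed). It is *transitive* if any two nodes are joined by a directed path. The input set $I(c)$ is the set of arrows with head $c$; an *input isomorphism* $\beta:I(c)\to I(d)$ is an arrow-type preserving bijection, where $c,d$ must have the same node type; $B(c,d)$ is the set of these. *State equivalence* is the equivalence relation on nodes generated by $c\sim d$ and $\mathcal T(e)\sim\mathcal T(\beta(e))$ for all $\beta\in B(c,d)$, $e\in I(c)$. Node spaces are $P_c=\mathbb R^{k_c}$ with $k_c\ge 1$ and $P_c=P_d$ for state equivalent $c,d$; $P=\prod_c P_c$ has the norm $\max_c\|x_c\|$. A map $f:P\to P$ is *admissible* if $f_c(x)=\hat f_c(x_c,(x_{\mathcal T(e)})_{e\in I(c)})$ with functions satisfying $\hat f_d(w,(z_e)_{e\in I(d)})=\hat f_c(w,(z_{\beta(e)})_{e\in I(c)})$ for all $\beta\in B(c,d)$ and all $w,z$. A colouring (equivalence relation on nodes) $\bowtie$ is *balanced* if $c\bowtie d$ implies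 that some $\beta\in B(c,d)$ satisfies $\mathcal T(e)\bowtie\mathcal T(\beta(e))$ for all $e\in I(c)$. The *quotient network* $\mathcal G/{\bowtie}$ has the colours as nodes; the arrows into a colour are the input arrows of one chosen node of that colour, with tails replaced by their colours, and types are inherited. A *symmetry* of a network is a pair of permutations of its nodes and arrows that is compatible with heads and tails and preserves all types. **Periodic orbits.** Let $f$ be admissible and $C^\infty$, and let $x$ be a periodic orbit of $\dot x=f(x)$ with least period $T>0$ (so $x$ is not constant). It is *hyperbolic* if exactly one Floquet multiplier, counted with multiplicity, lies on the unit circle, namely $1$. Nodes $c,d$ are *phase-related* by $\theta\in\mathbb R$ if they are state equivalent and $x_c(t)=x_d(t+\theta T)$ for all $t$; they are *synchronous* if this holds with $\theta=0$. The phase relation is *rigid* if, for every $C^1$-bounded $C^\infty$ admissible map $p$ and all sufficiently small $\varepsilon>0$ (depending on $p$), the periodic orbit $x^\varepsilon$ of $\dot x=f(x)+\varepsilon p(x)$ near $x$, with period $T^\varepsilon$ near $T$, satisfies $x^\varepsilon_c(t)=x^\varepsilon_d(t+\theta T^\varepsilon)$ for all $t$. The *phase pattern* of $x$ is the set of all its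 phase relations (synchronies included); it is rigid if all of them are rigid. For a colouring $\bowtie$ whose colour classes consist of state equivalent nodes, and a set $\mathcal R$ of representatives, let $[c]\in\mathcal R$ denote the representative of $c$. The *induced ODE* on $\prod_{r\in\mathcal R}P_r$ is $\dot x_r=\hat f_r(x_r,(x_{[\mathcal T(e)]})_{e\in I(r)})$, and the *induced orbit* is $x^{\mathcal R}=(x_r)_{r\in\mathcal R}$. The orbit $x$ is *strongly hyperbolic* if it is hyperbolic and, for every colouring $\bowtie$ such that $c\bowtie d$ implies that $c,d$ are synchronous on $x$, there is a set of representatives $\mathcal R$ such that, if necessary after an arbitrarily $C^1$-small smooth admissible perturbation of $f$ and passage to the nearby perturbed hyperbolic periodic orbit, the induced orbit is a hyperbolic periodic orbit of the induced ODE. **Corollary 13.2.** Let $\mathcal G$ be a transitive network, and let $x$ be a strongly hyperbolic periodic orbit, of least period $T$, of a $C^\infty$ admissible ODE for $\mathcal G$. Suppose that the phase pattern of $x$ is rigid. Then there are a balanced colouring $\bowtie$ of $\mathcal G$, an integer $k\ge1$ and a symmetry $\gamma$ of the quotient network $\mathcal G/{\bowtie}$ of order $k$, generating a cyclic group $\Gamma\cong\mathbb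 Z_k$, such that, with $\bar c$ the node of $\mathcal G/{\bowtie}$ given by the colour of $c$: (a) $c$ and $d$ are synchronous on $x$ if and only if $c\bowtie d$. (b) If nodes $c,d$ are rigidly phase-related by $\theta$, then $\theta=m/k$ for some integer $m$, and $\gamma^m\bar c=\bar d$. Moreover these phase shifts are realised by $\gamma$: if $\gamma\bar c=\bar d$ then $x_c(t)=x_d(t+T/k)$ for all $t$. -/

import Mathlib

open scoped ContDiff

universe u v

/-! ## Networks -/

/-- A network with node set `C` and arrow set `A` (both are taken finite where it matters). Node types
and arrow types are recorded as equivalence relations. Multiple arrows and self-loops are allowed. -/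
structure Network (C : Type u) (A : Type v) where
  /-- `nodeType c d`: the nodes `c` and `d` have the same node type -/
  nodeType : Setoid C
  /-- `arrowType a b`: the arrows `a` and `b` have the same arrow type -/
  arrowType : Setoid A
  head : A → C
  tail : A → C

namespace Network

variable {C : Type u} {A : Type v} (G : Network C A)

/-- The input set `I(c)`: all arrows with head `c`. -/
abbrev InputSet (c : C) : Type v := {a : A // G.head a = c}

/-- Input isomorphisms `β : I(c) → I(d)`: arrow-type preserving bijections, where `c` and `d` are
also required to have the same node type. This is the set `B(c,d)`. -/
structure InputIso (c d : C) where
  nodeType_eq : G.nodeType c d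
  toEquiv : G.InputSet c ≃ G.InputSet d
  arrowType_eq : ∀ e : G.InputSet c, G.arrowType e.1 (toEquiv e).1

/-- The equalities of node spaces that are directly forced by some input isomorphism. -/
def StateForced (i j : C) : Prop :=
  ∃ (c d : C) (β : G.InputIso c d),
    (i = c ∧ j = d) ∨ ∃ e : G.InputSet c, i = G.tail e.1 ∧ j = G.tail (β.toEquiv e).1

/-- State equivalence: the equivalence relation generated by the forced equalities. -/
def StateEquiv (i j : C) : Prop := Relation.EqvGen G.StateForced i j

variable {G}

theorem StateEquiv.symm {i j : C} (h : G.StateEquiv i j) : G.StateEquiv j i :=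
  Relation.EqvGen.symm _ _ h

theorem InputIso.stateEquiv {c d : C} (β : G.InputIso c d) : G.StateEquiv c d :=
  Relation.EqvGen.rel _ _ ⟨c, d, β, Or.inl ⟨rfl, rfl⟩⟩

theorem InputIso.tail_stateEquiv {c d : C} (β : G.InputIso c d) (e : G.InputSet c) :
    G.StateEquiv (G.tail e.1) (G.tail (β.toEquiv e).1) :=
  Relation.EqvGen.rel _ _ ⟨c, d, β, Or.inr ⟨e, rfl, rfl⟩⟩

variable (G)

/-- A network is transitive if any two nodes are joined by a directed path. -/
def IsTransitive : Prop :=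
  ∀ c d : C, Relation.ReflTransGen (fun i j => ∃ a : A, G.tail a = i ∧ G.head a = j) c d

/-- A colouring (an equivalence relation on nodes) is balanced if any two nodes of the same colour
are related by a colour-preserving input isomorphism. -/
def IsBalanced (s : Setoid C) : Prop :=
  ∀ c d : C, s c d → ∃ β : G.InputIso c d, ∀ e : G.InputSet c, s (G.tail e.1) (G.tail (β.toEquiv e).1)

/-- The quotient network of a colouring (used for balanced colourings): the nodes are the colours;
the arrows into a colour are the input arrows of one chosen node of that colour, and their tails are
replaced by the colours of their tails. For a balanced colouring, other choices of the nodes give an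
isomorphic network. -/
noncomputable def quotient (s : Setoid C) :
    Network (Quotient s) {a : A // (Quotient.mk s (G.head a)).out = G.head a} where
  nodeType := G.nodeType.comap Quotient.out
  arrowType := G.arrowType.comap Subtype.val
  head a := Quotient.mk s (G.head a.1)
  tail a := Quotient.mk s (G.tail a.1)

/-- The symmetry group of a network: pairs of a permutation of the nodes and a permutation of the
arrows that are compatible with heads and tails and preserve all types. -/
def symmetryGroup : Subgroup (Equiv.Perm C × Equiv.Perm A) where
  carrier := {g | (∀ a, G.head (g.2 a) = g.1 (G.head a)) ∧ (∀ a, G.tail (g.2 a) = g.1 (G.tail a)) ∧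
    (∀ c, G.nodeType (g.1 c) c) ∧ ∀ a, G.arrowType (g.2 a) a}
  one_mem' := ⟨fun _ => rfl, fun _ => rfl, fun _ => G.nodeType.refl _, fun _ => G.arrowType.refl _⟩
  mul_mem' := by
    rintro g h ⟨g1, g2, g3, g4⟩ ⟨h1, h2, h3, h4⟩
    exact ⟨fun a => by simp [g1, h1], fun a => by simp [g2, h2],
      fun c => G.nodeType.trans (g3 _) (h3 c), fun a => G.arrowType.trans (g4 _) (h4 a)⟩
  inv_mem' := by
    rintro g ⟨g1, g2, g3, g4⟩
    exact ⟨fun a => (Equiv.eq_symm_apply g.1).2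
        ((g1 _).symm.trans (congrArg G.head (g.2.apply_symm_apply a))),
      fun a => (Equiv.eq_symm_apply g.1).2
        ((g2 _).symm.trans (congrArg G.tail (g.2.apply_symm_apply a))),
      fun c => by
        have h := g3 (g.1.symm c)
        rw [g.1.apply_symm_apply] at h
        exact G.nodeType.symm h,
      fun a => by
        have h := g4 (g.2.symm a)
        rw [g.2.apply_symm_apply] at h
        exact G.arrowType.symm h⟩

/-- An assignment of node spaces `P_c = ℝ^{dim c}`, with `dim c ≥ 1`, such that state equivalent
nodes have the same node space. -/
structure NodeSpaces where
  dim : C → ℕ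
  dim_pos : ∀ c, 0 < dim c
  dim_eq : ∀ {c d : C}, G.StateEquiv c d → dim c = dim d

end Network

/-! ## Periodic orbits of a vector field -/

section PeriodicOrbits

variable {E : Type*} [NormedAddCommGroup E] [NormedSpace ℝ E]

/-- `x` solves `x' = F(x)` on the whole line, and `T > 0` is a period of `x`. -/
structure IsPeriodicSolution (F : E → E) (x : ℝ → E) (T : ℝ) : Prop where
  pos : 0 < T
  hasDerivAt : ∀ t, HasDerivAt x (F (x t)) t
  periodic : Function.Periodic x T

/-- `x` is a periodic orbit of `x' = F(x)` with least period `T`; in particular `x` is not constant. -/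
structure IsPeriodicOrbit (F : E → E) (x : ℝ → E) (T : ℝ) : Prop
    extends IsPeriodicSolution F x T where
  least : ∀ T', 0 < T' → T' < T → ¬ Function.Periodic x T'

/-- `Φ` is the evolution operator of the linearisation of `x' = F(x)` along `x`, started at time 0. -/
structure IsEvolutionOperator (F : E → E) (x : ℝ → E) (Φ : ℝ → E →ₗ[ℝ] E) : Prop where
  zero : Φ 0 = LinearMap.id
  hasDerivAt : ∀ (v : E) (t : ℝ), HasDerivAt (fun τ => Φ τ v) (fderiv ℝ F (x t) (Φ t v)) t

/-- A periodic orbit is hyperbolic if exactly one Floquet multiplier, counted with algebraic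
multiplicity, lies on the unit circle, and this one is equal to 1. The Floquet multipliers are the
complex eigenvalues of the evolution operator over one period. -/
structure IsHyperbolicPeriodicOrbit [FiniteDimensional ℝ E] (F : E → E) (x : ℝ → E) (T : ℝ) : Prop
    extends IsPeriodicOrbit F x T where
  floquet : ∃ Φ : ℝ → E →ₗ[ℝ] E, IsEvolutionOperator F x Φ ∧
    ∀ z : ℂ, ‖z‖ = 1 →
      (((Φ T).charpoly.map (algebraMap ℝ ℂ)).rootMultiplicity z = if z = 1 then 1 else 0)

/-- The periodic solution `(y, S)` is `δ`-close to `(x, T)`. -/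
def IsNearOrbit (x : ℝ → E) (T : ℝ) (y : ℝ → E) (S : ℝ) (δ : ℝ) : Prop :=
  |S - T| < δ ∧ ∀ t ∈ Set.Icc 0 T, dist (y t) (x t) < δ

/-- The `C¹` norm of `p` is at most `M`. -/
def C1BoundedBy (p : E → E) (M : ℝ) : Prop := ∀ x, ‖p x‖ ≤ M ∧ ‖fderiv ℝ p x‖ ≤ M

end PeriodicOrbits

/-! ## Admissible maps, rigidity, strong hyperbolicity -/

namespace Network.NodeSpaces

variable {C : Type u} {A : Type v} {G : Network C A} (S : G.NodeSpaces)

/-- The node space `P_c`, with its Euclidean norm. -/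
abbrev Space (c : C) : Type := EuclideanSpace ℝ (Fin (S.dim c))

/-- The state space `P = ∏ P_c`; its norm is the maximum of the Euclidean norms of the node
components. -/
abbrev State : Type u := ∀ c : C, S.Space c

/-- The identification `P_c = P_d` for state equivalent nodes. -/
noncomputable def ident {c d : C} (h : G.StateEquiv c d) : S.Space c ≃ₗᵢ[ℝ] S.Space d :=
  LinearIsometryEquiv.piLpCongrLeft 2 ℝ ℝ (finCongr (S.dim_eq h))

/-- Admissibility of a map `f : P → P`: the domain condition and the pullback condition. -/
def IsAdmissible (f : S.State → S.State) : Prop :=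
  ∃ fhat : ∀ c : C, S.Space c → (∀ e : G.InputSet c, S.Space (G.tail e.1)) → S.Space c,
    (∀ (x : S.State) (c : C), f x c = fhat c (x c) (fun e => x (G.tail e.1))) ∧
    ∀ (c d : C) (β : G.InputIso c d) (w : S.Space d)
      (z : ∀ e : G.InputSet d, S.Space (G.tail e.1)),
      S.ident β.stateEquiv (fhat c (S.ident β.stateEquiv.symm w)
        (fun e => S.ident (β.tail_stateEquiv e).symm (z (β.toEquiv e)))) = fhat d w z

/-- The nodes `c`, `d` are phase-related by the proportion `θ` of the period `T`:
`x_c(t) = x_d(t + θT)` for all `t`. Nodes are only compared when they are state equivalent. -/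
def PhaseRelated (x : ℝ → S.State) (T : ℝ) (c d : C) (θ : ℝ) : Prop :=
  ∃ h : G.StateEquiv c d, ∀ t, S.ident h (x t c) = x (t + θ * T) d

/-- The nodes `c`, `d` are synchronous: `x_c(t) = x_d(t)` for all `t`. -/
def Synchronous (x : ℝ → S.State) (c d : C) : Prop :=
  ∃ h : G.StateEquiv c d, ∀ t, S.ident h (x t c) = x t d

/-- The admissible `C^∞` vector fields. -/
structure IsSmoothAdmissible [Fintype C] (f : S.State → S.State) : Prop where
  admissible : S.IsAdmissible f
  smooth : ContDiff ℝ ∞ f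

/-- The phase relation `x_c(t) = x_d(t + θT)` is rigid: for every `C¹`-bounded smooth admissible map
`p` and all small `ε > 0`, it holds with the perturbed period for the perturbed periodic orbit, that
is, for the periodic orbit of `f + εp` near `x` whose period is near `T`. (For a hyperbolic periodic
orbit there is just one such orbit, up to time translation, if the neighbourhood is small.) -/
def RigidlyPhaseRelated [Fintype C] (f : S.State → S.State) (x : ℝ → S.State) (T : ℝ)
    (c d : C) (θ : ℝ) : Prop :=
  S.PhaseRelated x T c d θ ∧
  ∀ p : S.State → S.State, S.IsSmoothAdmissible p → (∃ M, C1BoundedBy p M) →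
    ∃ δ > 0, ∃ ε₀ > 0, ∀ ε : ℝ, 0 < ε → ε < ε₀ →
      ∀ (y : ℝ → S.State) (T' : ℝ), IsPeriodicSolution (fun z => f z + ε • p z) y T' →
        IsNearOrbit x T y T' δ → S.PhaseRelated y T' c d θ

/-- The phase pattern of `x` (the family of all its phase relations, synchronies included) is
rigid. -/
def HasRigidPhasePattern [Fintype C] (f : S.State → S.State) (x : ℝ → S.State) (T : ℝ) : Prop :=
  ∀ (c d : C) (θ : ℝ), S.PhaseRelated x T c d θ → S.RigidlyPhaseRelated f x T c d θ

section Induced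

variable {s : Setoid C} (hs : ∀ c d : C, s c d → G.StateEquiv c d)
  (r : Quotient s → C) (hr : ∀ q, Quotient.mk s (r q) = q)

/-- The state space `P^R` of the quasi-quotient, for the set of representatives `R` given by `r`. -/
abbrev InducedState (r : Quotient s → C) : Type u := ∀ q : Quotient s, S.Space (r q)

theorem rep_stateEquiv {s : Setoid C} (hs : ∀ c d : C, s c d → G.StateEquiv c d)
    (r : Quotient s → C) (hr : ∀ q, Quotient.mk s (r q) = q) (c : C) :
    G.StateEquiv (r (Quotient.mk s c)) c :=
  hs _ _ (Quotient.exact (hr (Quotient.mk s c)))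

/-- The point of the polydiagonal with given coordinates at the representatives: every `x_c` is
replaced by `x_{[c]}`. -/
noncomputable def lift (y : S.InducedState r) : S.State :=
  fun c => S.ident (rep_stateEquiv hs r hr c) (y (Quotient.mk s c))

/-- The induced vector field `f_r(x_r, x_{[T(r)]})`, `r ∈ R`. -/
noncomputable def inducedField (f : S.State → S.State) : S.InducedState r → S.InducedState r :=
  fun y q => f (S.lift hs r hr y) (r q)

/-- The induced orbit `x^R`. -/
def inducedOrbit (x : ℝ → S.State) : ℝ → S.InducedState r := fun t q => x t (r q)

end Induced

/-- Strong hyperbolicity for one colouring `s`: the orbit is hyperbolic and, for some set of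
representatives, there are arbitrarily small admissible perturbations (zero is allowed) for which
the induced orbit of the perturbed periodic orbit is a hyperbolic periodic orbit of the induced
ODE. -/
def IsStronglyHyperbolicFor [Fintype C] (f : S.State → S.State) (x : ℝ → S.State) (T : ℝ)
    (s : Setoid C) (hs : ∀ c d : C, s c d → G.StateEquiv c d) : Prop :=
  letI : Fintype (Quotient s) := Fintype.ofFinite _
  IsHyperbolicPeriodicOrbit f x T ∧
  ∃ (r : Quotient s → C) (hr : ∀ q, Quotient.mk s (r q) = q),
    ∀ δ > 0, ∃ p : S.State → S.State, S.IsSmoothAdmissible p ∧ C1BoundedBy p δ ∧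
      ∃ (y : ℝ → S.State) (T' : ℝ),
        IsHyperbolicPeriodicOrbit (fun z => f z + p z) y T' ∧ IsNearOrbit x T y T' δ ∧
        IsHyperbolicPeriodicOrbit (S.inducedField hs r hr (fun z => f z + p z))
          (S.inducedOrbit r y) T'

/-- Strong hyperbolicity: strong hyperbolicity for every colouring whose polydiagonal contains the
orbit. (For other colourings the projection of `x` is not an orbit of the induced ODE.) -/
def IsStronglyHyperbolic [Fintype C] (f : S.State → S.State) (x : ℝ → S.State) (T : ℝ) : Prop :=
  IsHyperbolicPeriodicOrbit f x T ∧
  ∀ (s : Setoid C) (hs : ∀ c d : C, s c d → S.Synchronous x c d),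
    S.IsStronglyHyperbolicFor f x T s (fun c d h => (hs c d h).1)

end Network.NodeSpaces

/-! The core is that a rigid phase relation passes to inputs: if `c` and `d` are rigidly related by
`θ`, then one input isomorphism `β` in `B(c,d)` relates every input of `c` to its partner by the
same `θ` (`RigidlyPhaseRelated.exists_inputIso`).

Given this, the rest is algebra (`IsPhaseRelation`). For `θ = 0` it says that synchrony is balanced.
By transitivity a shift that occurs at one node occurs at all, so the shifts form a subgroup of `ℝ`
that contains `1` and acts on the finitely many colours. A shift that fixes all colours is an
integer because `T` is the least period; hence the group is `(1/k)ℤ`. Its generator permutes the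
colours, preserves the numbers of arrows of each type between colours by the input isomorphisms, and
so lifts to a symmetry of order `k`.

The core rests on a comparison of norms. By hyperbolicity the periodic boundary value problem is
nondegenerate, so the orbit persists, and the perturbed orbits depend on the perturbation in a
Lipschitz way that is measured only by an `L¹` norm along the orbit (`hyperbolic_persistence`). A
narrow bump of height one around an input state that is taken on a null set of times hardly moves
the orbit, but changes the velocity by an amount of order one at the moment when this state is
taken. So an identity between velocities that holds for all nearby perturbations cannot survive if a
bump acts on one side only (`response_bound`, `false_of_velocity_relation`).

Such an open set of perturbations is supplied by Baire's theorem: rigidity gives a threshold for `ε`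
in each direction, and the directions run through the `ℓ¹` combinations of a countable family of
admissible bump fields (`exists_ball`). On a smaller open set of perturbations and times the pattern
of agreements between nodes at the phases `0` and `θ` is constant. Transitivity shows that every
node moves there, and bumps show that the pattern is balanced as a colouring of two copies of the
network (`exists_inputIso_agrees`). Its polydiagonal is flow-invariant, so the agreements extend to
all times. As `B(c,d)` is finite, one `β` works for perturbations tending to zero, hence for `x`. -/

section LinearPeriodicProblem

/-! ### The periodic boundary value problem for linear equations -/

open Set MeasureTheory intervalIntegral unitInterval

theorem continuous_IccExtend_unit {E : Type*} [NormedAddCommGroup E] (w : C(I, E)) :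
    Continuous (IccExtend (zero_le_one' ℝ) w) :=
  w.continuous.Icc_extend'

theorem norm_IccExtend_unit_le {E : Type*} [NormedAddCommGroup E] (w : C(I, E)) (r : ℝ) :
    ‖IccExtend (zero_le_one' ℝ) w r‖ ≤ ‖w‖ :=
  w.norm_coe_le_norm _

variable {E : Type*} [NormedAddCommGroup E] [NormedSpace ℝ E]

/-- The primitive `s ↦ ∫₀ˢ w` of a continuous function on the unit interval. -/
noncomputable def unitPrimitive : C(I, E) →L[ℝ] C(I, E) :=
  LinearMap.mkContinuous
    { toFun := fun w => ⟨fun s => ∫ r in (0 : ℝ)..s, IccExtend (zero_le_one' ℝ) w r,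
        (intervalIntegral.continuous_primitive
          (fun a b => (continuous_IccExtend_unit w).intervalIntegrable a b) 0).comp
          continuous_subtype_val⟩
      map_add' := fun w z => by
        ext s
        exact intervalIntegral.integral_add
          ((continuous_IccExtend_unit w).intervalIntegrable _ _)
          ((continuous_IccExtend_unit z).intervalIntegrable _ _)
      map_smul' := fun c w => by
        ext s
        exact intervalIntegral.integral_smul c _ }
    1 (fun w => by
      rw [one_mul, ContinuousMap.norm_le _ (norm_nonneg w)]
      intro s
      refine (intervalIntegral.norm_integral_le_of_norm_le_const
        (fun r _ => norm_IccExtend_unit_le w r)).trans ?_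
      rw [sub_zero, abs_of_nonneg s.2.1]
      exact mul_le_of_le_one_right (norm_nonneg w) s.2.2)

theorem unitPrimitive_apply (w : C(I, E)) (s : I) :
    unitPrimitive w s = ∫ r in (0 : ℝ)..s, IccExtend (zero_le_one' ℝ) w r := rfl

theorem norm_unitPrimitive_le (w : C(I, E)) : ‖unitPrimitive w‖ ≤ ‖w‖ := by
  have := (unitPrimitive (E := E)).le_of_opNorm_le
    (LinearMap.mkContinuous_norm_le _ zero_le_one _) w
  rwa [one_mul] at this

/-- This bound by the `L¹` norm, rather than the sup norm, is what makes the effect of a narrow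
perturbation on an orbit small. -/
theorem norm_unitPrimitive_le_integral (w : C(I, E)) :
    ‖unitPrimitive w‖ ≤ ∫ r in (0 : ℝ)..1, ‖IccExtend (zero_le_one' ℝ) w r‖ := by
  rw [ContinuousMap.norm_le _ (intervalIntegral.integral_nonneg zero_le_one
    fun _ _ => norm_nonneg _)]
  intro s
  refine (intervalIntegral.norm_integral_le_integral_norm s.2.1).trans ?_
  refine intervalIntegral.integral_mono_interval le_rfl s.2.1 s.2.2
    (Filter.Eventually.of_forall fun _ => norm_nonneg _) ?_
  exact (continuous_IccExtend_unit w).norm.intervalIntegrable _ _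

/-- Pointwise application of a continuous family of operators. -/
noncomputable def unitMul (B : C(I, E →L[ℝ] E)) : C(I, E) →L[ℝ] C(I, E) :=
  LinearMap.mkContinuous
    { toFun := fun w => ⟨fun s => B s (w s), B.continuous.clm_apply w.continuous⟩
      map_add' := fun w z => by ext s; simp
      map_smul' := fun c w => by ext s; simp }
    ‖B‖ (fun w => by
      rw [ContinuousMap.norm_le _ (by positivity)]
      intro s
      exact ((B s).le_opNorm _).trans
        (mul_le_mul (B.norm_coe_le_norm s) (w.norm_coe_le_norm s) (norm_nonneg (w s))
          (norm_nonneg B)))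

@[simp] theorem unitMul_apply (B : C(I, E →L[ℝ] E)) (w : C(I, E)) (s : I) :
    unitMul B w s = B s (w s) := rfl

/-- The constant function with the value of `w` at the right endpoint. -/
noncomputable def unitEndpoint : C(I, E) →L[ℝ] C(I, E) :=
  LinearMap.mkContinuous
    { toFun := fun w => ContinuousMap.const I (w 1)
      map_add' := fun w z => by ext s; simp
      map_smul' := fun c w => by ext s; simp }
    1 (fun w => by
      rw [one_mul, ContinuousMap.norm_le _ (norm_nonneg w)]
      exact fun s => w.norm_coe_le_norm _)

@[simp] theorem unitEndpoint_apply (w : C(I, E)) (s : I) : unitEndpoint w s = w 1 := rfl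

/-- The linear operator `(v, κ) ↦ (v - v(1) - ∫₀ˢ (B v + κ k), ℓ (v 0))`, whose kernel consists of the
solutions of the periodic boundary value problem `v' = B v + κ k`, `v(0) = v(1)`, `ℓ (v 0) = 0`. -/
noncomputable def periodicOperator (B : C(I, E →L[ℝ] E)) (k : C(I, E)) (l : E →L[ℝ] ℝ) :
    (C(I, E) × ℝ) →L[ℝ] (C(I, E) × ℝ) :=
  ContinuousLinearMap.prod
    ((ContinuousLinearMap.id ℝ _ - unitEndpoint - unitPrimitive.comp (unitMul B)).comp
        (ContinuousLinearMap.fst ℝ _ _) -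
      (ContinuousLinearMap.snd ℝ _ _).smulRight (unitPrimitive k))
    ((l.comp (ContinuousMap.evalCLM ℝ (0 : I))).comp (ContinuousLinearMap.fst ℝ _ _))

theorem periodicOperator_fst (B : C(I, E →L[ℝ] E)) (k : C(I, E)) (l : E →L[ℝ] ℝ)
    (v : C(I, E)) (κ : ℝ) :
    (periodicOperator B k l (v, κ)).1 =
      v - unitEndpoint v - unitPrimitive (unitMul B v + κ • k) := by
  simp [periodicOperator, sub_sub, add_assoc]

theorem periodicOperator_snd (B : C(I, E →L[ℝ] E)) (k : C(I, E)) (l : E →L[ℝ] ℝ)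
    (v : C(I, E)) (κ : ℝ) :
    (periodicOperator B k l (v, κ)).2 = l (v 0) := rfl

/-- Solutions of a linear equation with zero initial value vanish. -/
theorem eq_zero_of_hasDerivAt_linear {B : ℝ → E →L[ℝ] E} (hB : Continuous B) {d : ℝ → E} {a b : ℝ}
    (hc : ContinuousOn d (Icc a b))
    (hd : ∀ t ∈ Ico a b, HasDerivWithinAt d (B t (d t)) (Ici t) t) (ha : d a = 0) :
    ∀ t ∈ Icc a b, d t = 0 := by
  obtain ⟨K, hK⟩ := isCompact_Icc.exists_bound_of_continuousOn (hB.continuousOn (s := Icc a b))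
  refine eq_zero_of_abs_deriv_le_mul_abs_self_of_eq_zero_right (K := K) hc hd ha fun t ht => ?_
  exact ((B t).le_opNorm _).trans
    (mul_le_mul_of_nonneg_right (hK t (Ico_subset_Icc_self ht)) (norm_nonneg _))

/-- The evolution operators of a linear equation are invertible. -/
theorem evolution_injective {B : ℝ → E →L[ℝ] E} (hB : Continuous B) {Φ : ℝ → E →L[ℝ] E}
    (h0 : Φ 0 = ContinuousLinearMap.id ℝ E)
    (hΦ : ∀ v t, HasDerivAt (fun τ => Φ τ v) (B t (Φ t v)) t) {s : ℝ} (hs : 0 ≤ s) :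
    Function.Injective (Φ s) := by
  rw [injective_iff_map_eq_zero]
  intro v hv
  -- Time reversal: the solution run backwards from time `s` starts at zero, and it ends at `v`.
  have hd : ∀ t, HasDerivAt (fun t => Φ (s - t) v) ((-(B (s - t))) (Φ (s - t) v)) t := by
    intro t
    have := (hΦ v (s - t)).scomp t ((hasDerivAt_id t).const_sub s)
    simpa [Function.comp_def] using this
  have := eq_zero_of_hasDerivAt_linear (B := fun t => -(B (s - t))) (a := 0) (b := s)
    (by fun_prop) (fun t _ => (hd t).continuousAt.continuousWithinAt)
    (fun t _ => (hd t).hasDerivWithinAt) (by simpa using hv) s ⟨hs, le_rfl⟩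
  simpa [h0] using this

/-- Variation of constants. -/
theorem exists_solution_inhomogeneous [FiniteDimensional ℝ E] {B : ℝ → E →L[ℝ] E} (hB : Continuous B)
    {Φ : ℝ → E →L[ℝ] E} (h0 : Φ 0 = ContinuousLinearMap.id ℝ E)
    (hΦ : ∀ v t, HasDerivAt (fun τ => Φ τ v) (B t (Φ t v)) t) (b : C(I, E)) :
    ∃ r : ℝ → E, r 0 = 0 ∧ ContinuousOn r (Icc 0 1) ∧
      ∀ t ∈ Icc (0 : ℝ) 1, HasDerivAt r (B t (r t) + IccExtend (zero_le_one' ℝ) b t) t := by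
  have : CompleteSpace E := FiniteDimensional.complete ℝ E
  have hΦc : Continuous Φ := continuous_clm_apply.2 fun v =>
    continuous_iff_continuousAt.2 fun t => (hΦ v t).continuousAt
  have hinj : ∀ s : I, Function.Injective (Φ s) := fun s =>
    evolution_injective hB h0 hΦ s.2.1
  have hunit : ∀ s : I, IsUnit (Φ s) := fun s =>
    (ContinuousLinearMap.isUnit_iff_bijective).2
      ⟨hinj s, (LinearMap.injective_iff_surjective (f := (Φ s : E →ₗ[ℝ] E))).1 (hinj s)⟩
  -- The integrand `Φ⁻¹ b` of the variation of constants formula.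
  let c : C(I, E) := ⟨fun s => Ring.inverse (Φ s) (b s), by
    refine Continuous.clm_apply ?_ b.continuous
    refine continuous_iff_continuousAt.2 fun s => ?_
    obtain ⟨u, hu⟩ := hunit s
    have h1 : ContinuousAt Ring.inverse (Φ s) := hu ▸ NormedRing.inverse_continuousAt u
    exact h1.comp (f := fun s : I => Φ s) (hΦc.comp continuous_subtype_val).continuousAt⟩
  have hc : ∀ s : I, Φ s (c s) = b s := fun s => by
    have := Ring.mul_inverse_cancel _ (hunit s)
    exact DFunLike.congr_fun this (b s)
  let bas := Module.finBasis ℝ E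
  let C : ℝ → E := fun t => ∫ r in (0 : ℝ)..t, IccExtend (zero_le_one' ℝ) c r
  have hC : ∀ t, HasDerivAt C (IccExtend (zero_le_one' ℝ) c t) t := fun t =>
    intervalIntegral.integral_hasDerivAt_right
      ((continuous_IccExtend_unit c).intervalIntegrable _ _)
      ((continuous_IccExtend_unit c).stronglyMeasurableAtFilter _ _)
      (continuous_IccExtend_unit c).continuousAt
  -- Differentiability of `Φ` is given on fixed vectors only, so the product rule is applied to
  -- coordinates in a basis.
  have hexp : ∀ (t : ℝ) (z : E), Φ t z = ∑ i, bas.repr z i • Φ t (bas i) := fun t z => by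
    have h := congrArg (Φ t) (bas.sum_repr z)
    rw [map_sum] at h
    simpa only [map_smul] using h.symm
  have hder : ∀ t, HasDerivAt (fun t => Φ t (C t))
      (B t (Φ t (C t)) + Φ t (IccExtend (zero_le_one' ℝ) c t)) t := by
    intro t
    have h1 : ∀ i, HasDerivAt (fun t => bas.repr (C t) i • Φ t (bas i))
        (bas.repr (C t) i • B t (Φ t (bas i)) +
          bas.repr (IccExtend (zero_le_one' ℝ) c t) i • Φ t (bas i)) t := fun i => by
      have h2 : HasDerivAt (fun t => bas.repr (C t) i)
          (bas.repr (IccExtend (zero_le_one' ℝ) c t) i) t :=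
        (LinearMap.toContinuousLinearMap (bas.coord i)).hasFDerivAt.comp_hasDerivAt t (hC t)
      exact h2.smul (hΦ (bas i) t)
    have h3 := HasDerivAt.fun_sum (u := Finset.univ) fun i _ => h1 i
    have h4 : (fun t => Φ t (C t)) = fun t => ∑ i, bas.repr (C t) i • Φ t (bas i) := by
      funext t
      exact hexp t _
    rw [h4]
    convert h3 using 1
    rw [Finset.sum_add_distrib, ← hexp t (IccExtend (zero_le_one' ℝ) c t)]
    rw [hexp t (C t), map_sum]
    simp only [map_smul]
  refine ⟨fun t => Φ t (C t), by simp [C], fun t _ => (hder t).continuousAt.continuousWithinAt,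
    fun t ht => ?_⟩
  have h5 := hder t
  rw [IccExtend_of_mem _ _ ht] at h5 ⊢
  rwa [hc ⟨t, ht⟩] at h5

end LinearPeriodicProblem

section LinearPeriodicProblem

open Set MeasureTheory intervalIntegral unitInterval

variable {E : Type*} [NormedAddCommGroup E] [NormedSpace ℝ E]

theorem hasDerivAt_integral_IccExtend [CompleteSpace E] (w : C(I, E)) (t : ℝ) :
    HasDerivAt (fun t => ∫ r in (0 : ℝ)..t, IccExtend (zero_le_one' ℝ) w r)
      (IccExtend (zero_le_one' ℝ) w t) t :=
  intervalIntegral.integral_hasDerivAt_right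
    ((continuous_IccExtend_unit w).intervalIntegrable _ _)
    ((continuous_IccExtend_unit w).stronglyMeasurableAtFilter _ _)
    (continuous_IccExtend_unit w).continuousAt

/-- The flow reduces the problem to the initial value `r` and the scalar `κ`. Since `t • k t` solves
`v' = B v + k`, a solution with zero right hand side closes up after one period exactly if `r - Φ 1
r = κ • k 0`. Under `hker` and `hl` the finite-dimensional map `(r, κ) ↦ (r - Φ 1 r - κ • k 0, l r)`
is injective, hence bijective. -/
theorem periodicOperator_bijective [FiniteDimensional ℝ E] {B : ℝ → E →L[ℝ] E}
    (hB : Continuous B) {Φ : ℝ → E →L[ℝ] E} (h0 : Φ 0 = ContinuousLinearMap.id ℝ E)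
    (hΦ : ∀ v t, HasDerivAt (fun τ => Φ τ v) (B t (Φ t v)) t)
    {k : ℝ → E} (hk : ∀ t, HasDerivAt k (B t (k t)) t) (hk1 : k 1 = k 0)
    (l : E →L[ℝ] ℝ) (hl : l (k 0) ≠ 0)
    (hker : ∀ (r : E) (κ : ℝ), r - Φ 1 r = κ • k 0 → κ = 0 ∧ ∃ c : ℝ, r = c • k 0)
    (Bc : C(I, E →L[ℝ] E)) (hBc : ∀ s : I, Bc s = B s) (kc : C(I, E)) (hkc : ∀ s : I, kc s = k s) :
    Function.Bijective (periodicOperator Bc kc l) := by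
  have : CompleteSpace E := FiniteDimensional.complete ℝ E
  have hext : ∀ (v : C(I, E)) (κ : ℝ), ∀ t (ht : t ∈ Icc (0 : ℝ) 1),
      IccExtend (zero_le_one' ℝ) (unitMul Bc v + κ • kc) t = B t (v ⟨t, ht⟩) + κ • k t := by
    intro v κ t ht
    rw [IccExtend_of_mem _ _ ht]
    simp [hBc, hkc]
  have hker' : ∀ (r : E) (κ : ℝ), r - Φ 1 r = κ • k 0 → l r = 0 → r = 0 ∧ κ = 0 := by
    intro r κ hr hlr
    obtain ⟨hκ, c, rfl⟩ := hker r κ hr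
    refine ⟨?_, hκ⟩
    rw [map_smul, smul_eq_mul, mul_eq_zero] at hlr
    rw [hlr.resolve_right hl, zero_smul]
  constructor
  · rw [injective_iff_map_eq_zero]
    rintro ⟨v, κ⟩ hv
    have hv1 : v - unitEndpoint v - unitPrimitive (unitMul Bc v + κ • kc) = 0 := by
      rw [← periodicOperator_fst Bc kc l, hv]; rfl
    have hv2 : l (v 0) = 0 := by
      rw [← periodicOperator_snd Bc kc l v κ, hv]; rfl
    set W := unitMul Bc v + κ • kc with hW
    let V : ℝ → E := fun t => v 1 + ∫ r in (0 : ℝ)..t, IccExtend (zero_le_one' ℝ) W r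
    have hV : ∀ t, HasDerivAt V (IccExtend (zero_le_one' ℝ) W t) t := fun t =>
      (hasDerivAt_integral_IccExtend W t).const_add _
    have hVv : ∀ t (ht : t ∈ Icc (0 : ℝ) 1), V t = v ⟨t, ht⟩ := by
      intro t ht
      have h1 := congrArg (fun w : C(I, E) => w ⟨t, ht⟩) hv1
      simp only [ContinuousMap.sub_apply, unitEndpoint_apply, unitPrimitive_apply,
        ContinuousMap.zero_apply] at h1
      simp only [V]
      rw [sub_sub, sub_eq_zero] at h1
      exact h1.symm
    -- A kernel element has to be `Φ t (V 0) + κ • t • k t`: the difference solves the homogeneous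
    -- equation and starts at zero.
    have hd : ∀ t ∈ Icc (0 : ℝ) 1, HasDerivAt (fun t => V t - κ • t • k t - Φ t (V 0))
        (B t (V t - κ • t • k t - Φ t (V 0))) t := by
      intro t ht
      have h1 := ((hV t).sub (((hasDerivAt_id t).smul (hk t)).const_smul κ)).sub (hΦ (V 0) t)
      refine HasDerivAt.congr_deriv (f := fun t => V t - κ • t • k t - Φ t (V 0)) h1 ?_
      rw [hext v κ t ht, ← hVv t ht]
      simp only [map_sub, map_smul, id_eq, one_smul, smul_add]
      abel
    have hz := eq_zero_of_hasDerivAt_linear hB (a := 0) (b := 1)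
      (fun t ht => (hd t ht).continuousAt.continuousWithinAt)
      (fun t ht => (hd t (Ico_subset_Icc_self ht)).hasDerivWithinAt) (by simp [h0])
    have hV0 : V 0 = v 1 := by simp [V]
    have hV1 : V 1 = v 1 := hVv 1 ⟨zero_le_one, le_rfl⟩
    have h1 := hz 1 ⟨zero_le_one, le_rfl⟩
    rw [hV0, hV1, one_smul, hk1] at h1
    obtain ⟨hv10, hκ⟩ := hker' (v 1) κ (by rw [sub_right_comm, sub_eq_zero] at h1; exact h1)
      (by rw [← hV0, hVv 0 ⟨le_rfl, zero_le_one⟩]; exact hv2)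
    refine Prod.ext ?_ hκ
    ext s
    have h2 := hz s s.2
    rw [hV0, hv10, hκ, hVv s s.2] at h2
    simpa using h2
  · rintro ⟨w, lam⟩
    obtain ⟨ρ, hρ0, -, hρ⟩ := exists_solution_inhomogeneous hB h0 hΦ (unitMul Bc w)
    -- The solution is sought as `v = w + r`, so that `w` need not be differentiable: `r` must solve
    -- `r' = B (w + r) + κ k` with `r 0 = w 1 + r 1`. `M` collects the closing condition and the
    -- phase condition.
    let M : (E × ℝ) →ₗ[ℝ] (E × ℝ) :=
      { toFun := fun z => (z.1 - Φ 1 z.1 - z.2 • k 0, l z.1)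
        map_add' := fun z z' => by
          ext
          · simp only [Prod.fst_add, Prod.snd_add, map_add, add_smul]; abel
          · simp
        map_smul' := fun c z => by
          ext
          · simp [smul_sub, mul_smul]
          · simp }
    have hM : Function.Injective M := by
      rw [injective_iff_map_eq_zero]
      rintro ⟨r, κ⟩ h
      obtain ⟨h1, h2⟩ := Prod.ext_iff.1 h
      obtain ⟨h3, h4⟩ := hker' r κ (sub_eq_zero.1 h1) h2
      rw [h3, h4]; rfl
    obtain ⟨⟨r0, κ⟩, hr⟩ := LinearMap.injective_iff_surjective.1 hM (w 1 + ρ 1, lam - l (w 0))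
    obtain ⟨hr1, hr2⟩ := Prod.ext_iff.1 hr
    change r0 - Φ 1 r0 - κ • k 0 = w 1 + ρ 1 at hr1
    change l r0 = lam - l (w 0) at hr2
    let r : ℝ → E := fun t => ρ t + κ • t • k t + Φ t r0
    have hrd : ∀ t (ht : t ∈ Icc (0 : ℝ) 1),
        HasDerivAt r (B t (w ⟨t, ht⟩ + r t) + κ • k t) t := by
      intro t ht
      have h1 := ((hρ t ht).add (((hasDerivAt_id t).smul (hk t)).const_smul κ)).add (hΦ r0 t)
      refine HasDerivAt.congr_deriv (f := r) h1 ?_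
      rw [IccExtend_of_mem _ _ ht]
      simp only [r, map_add, map_smul, id_eq, one_smul, smul_add, unitMul_apply, hBc]
      abel
    have hrc : Continuous fun s : I => r s := continuous_iff_continuousAt.2 fun s =>
      ((hrd s s.2).continuousAt).comp (f := fun s : I => (s : ℝ))
        continuous_subtype_val.continuousAt
    have hr0 : r 0 = r0 := by simp [r, hρ0, h0]
    have hr1' : r 0 = w 1 + r 1 := by
      rw [hr0]
      simp only [r, one_smul, hk1]
      rw [sub_sub, sub_eq_iff_eq_add] at hr1
      refine hr1.trans ?_
      abel
    let v : C(I, E) := w + ⟨fun s => r s, hrc⟩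
    have hv : ∀ s : I, v s = w s + r s := fun s => rfl
    refine ⟨(v, κ), Prod.ext ?_ ?_⟩
    · rw [periodicOperator_fst]
      ext s
      have hint : ∫ t in (0 : ℝ)..s, IccExtend (zero_le_one' ℝ) (unitMul Bc v + κ • kc) t =
          r s - r 0 := by
        refine intervalIntegral.integral_eq_sub_of_hasDerivAt (fun t ht => ?_)
          ((continuous_IccExtend_unit _).intervalIntegrable _ _)
        rw [uIcc_of_le s.2.1] at ht
        have ht' : t ∈ Icc (0 : ℝ) 1 := ⟨ht.1, ht.2.trans s.2.2⟩
        rw [hext v κ t ht', hv]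
        exact hrd t ht'
      simp only [ContinuousMap.sub_apply, unitEndpoint_apply, unitPrimitive_apply, hint, hv]
      rw [hr1']
      change w s + r s - (w 1 + r 1) - (r s - (w 1 + r 1)) = w s
      abel
    · rw [periodicOperator_snd, hv]
      change l (w 0 + r 0) = lam
      rw [hr0, map_add, hr2]
      abel

/-- A simple eigenvalue `1` with eigenvector `k`. -/
theorem eq_smul_of_rootMultiplicity_one [FiniteDimensional ℝ E] {M : E →ₗ[ℝ] E} {k : E}
    (hk : k ≠ 0) (hMk : M k = k)
    (hM : (M.charpoly.map (algebraMap ℝ ℂ)).rootMultiplicity 1 = 1) (r : E) (κ : ℝ)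
    (h : r - M r = κ • k) : κ = 0 ∧ ∃ c : ℝ, r = c • k := by
  have h1 : M.charpoly.rootMultiplicity 1 = 1 := by
    rw [← hM, Polynomial.eq_rootMultiplicity_map (algebraMap ℝ ℂ).injective 1, map_one]
  rw [← LinearMap.finrank_maxGenEigenspace_eq] at h1
  have hkm : k ∈ Module.End.maxGenEigenspace M 1 :=
    Module.End.mem_maxGenEigenspace M 1 k |>.2 ⟨1, by simp [hMk]⟩
  -- `M - 1` maps `r` to `-κ k` and kills `k`, so its square kills `r`. Algebraic, not just
  -- geometric, simplicity of the eigenvalue then puts `r` on the line of `k`.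
  have hrm : r ∈ Module.End.maxGenEigenspace M 1 :=
    Module.End.mem_maxGenEigenspace M 1 r |>.2 ⟨2, by
      have h2 : (M - (1 : ℝ) • (1 : Module.End ℝ E)) r = -(κ • k) := by
        rw [← h]; simp
      rw [pow_two, Module.End.mul_apply, h2]
      simp [hMk]⟩
  obtain ⟨c, hc⟩ := (finrank_eq_one_iff_of_nonzero' (⟨k, hkm⟩ : Module.End.maxGenEigenspace M 1)
    (by simpa [Subtype.ext_iff] using hk)).1 h1 ⟨r, hrm⟩
  have hc' : r = c • k := (congrArg Subtype.val hc).symm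
  refine ⟨?_, c, hc'⟩
  rw [hc', map_smul, hMk, sub_self] at h
  exact (smul_eq_zero.1 h.symm).resolve_right hk

end LinearPeriodicProblem

/-! ### The nonlinear periodic boundary value problem -/

section NonlinearPeriodicProblem

open Set MeasureTheory intervalIntegral unitInterval Metric
open scoped Topology

variable {E : Type*} [NormedAddCommGroup E] [NormedSpace ℝ E]

/-- The zeros `(u, τ)` of this map are the solutions of the periodic boundary value problem
`u' = τ g(u)`, `u(0) = u(1)`, `l (u 0) = l x₀`. -/
noncomputable def periodicMap (g : C(E, E)) (l : E →L[ℝ] ℝ) (x₀ : E) (z : C(I, E) × ℝ) :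
    C(I, E) × ℝ :=
  -- At `s = 0` the first component reads `u 0 - u 1`, so it encodes periodicity together with the
  -- differential equation.
  (z.1 - unitEndpoint z.1 - unitPrimitive (z.2 • g.comp z.1), l (z.1 0 - x₀))

/-- A first order expansion of `(τ, e) ↦ τ f(e)` that is uniform near a compact set. -/
theorem exists_uniform_linear_approx {f : E → E} (hf : ContDiff ℝ 1 f) {k : Set E}
    (hk : IsCompact k) (T : ℝ) {c : ℝ} (hc : 0 < c) :
    ∃ r > 0, ∀ a ∈ k, ∀ e ∈ closedBall a r, ∀ e' ∈ closedBall a r, ∀ t t' : ℝ,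
      |t - T| ≤ r → |t' - T| ≤ r →
      ‖t • f e - t' • f e' - (T • fderiv ℝ f a (e - e') + (t - t') • f a)‖ ≤
        c * (‖e - e'‖ + |t - t'|) := by
  have hdc : Continuous (fderiv ℝ f) := hf.continuous_fderiv one_ne_zero
  obtain ⟨M, hM⟩ := hk.exists_bound_of_continuousOn hdc.continuousOn
  have hM0 : 0 < |M| + 1 := by positivity
  have hT0 : 0 < |T| + 1 := by positivity
  have h1 := hk.uniformContinuousAt_of_continuousAt (fderiv ℝ f)
    (fun a _ => hdc.continuousAt) (dist_mem_uniformity (ε := c / (2 * (|T| + 1))) (by positivity))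
  have h2 := hk.uniformContinuousAt_of_continuousAt f
    (fun a _ => hf.continuous.continuousAt) (dist_mem_uniformity hc)
  obtain ⟨r1, hr1, H1⟩ := mem_uniformity_dist.1 h1
  obtain ⟨r2, hr2, H2⟩ := mem_uniformity_dist.1 h2
  -- Halving `r1` and `r2` gives the strict inequalities needed for `H1` and `H2`. The last radius
  -- lets `|t - T|` absorb the size of the derivative: two terms of the decomposition below get `c /
  -- 2` each in front of `‖e - e'‖`, and the third gets `c` in front of `|t - t'|`.
  refine ⟨min (min (r1 / 2) (r2 / 2)) (min 1 (c / (2 * (|M| + 1)))), by positivity, ?_⟩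
  intro a ha e he e' he' t t' ht ht'
  rw [mem_closedBall] at he he'
  simp only [le_min_iff] at he he' ht ht'
  obtain ⟨⟨he1, he2⟩, -⟩ := he
  obtain ⟨⟨he1', he2'⟩, -⟩ := he'
  have hA : ‖f e - f e' - fderiv ℝ f a (e - e')‖ ≤ c / (2 * (|T| + 1)) * ‖e - e'‖ := by
    refine (convex_ball a r1).norm_image_sub_le_of_norm_fderiv_le' (𝕜 := ℝ)
      (fun y _ => (hf.differentiable one_ne_zero) y) (fun y hy => ?_) ?_ ?_
    · have := H1 (a := a) (b := y) (by rwa [dist_comm]) ha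
      rw [mem_ofPred_eq, dist_comm, dist_eq_norm] at this
      exact this.le
    · rw [mem_ball]; linarith
    · rw [mem_ball]; linarith
  have hB : ‖f e' - f a‖ ≤ c := by
    have := H2 (a := a) (b := e') (by rw [dist_comm]; linarith) ha
    rw [mem_ofPred_eq, dist_comm, dist_eq_norm] at this
    exact this.le
  have hC : ‖fderiv ℝ f a (e - e')‖ ≤ (|M| + 1) * ‖e - e'‖ :=
    ((fderiv ℝ f a).le_opNorm _).trans (mul_le_mul_of_nonneg_right
      ((hM a ha).trans ((le_abs_self M).trans (by linarith))) (norm_nonneg _))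
  have hdec : t • f e - t' • f e' - (T • fderiv ℝ f a (e - e') + (t - t') • f a) =
      t • (f e - f e' - fderiv ℝ f a (e - e')) + (t - T) • fderiv ℝ f a (e - e') +
        (t - t') • (f e' - f a) := by
    simp only [smul_sub, sub_smul]; abel
  have ht1 : |t| ≤ |T| + 1 := by
    have := abs_add_le (t - T) T
    rw [sub_add_cancel] at this
    linarith [ht.2.1]
  rw [hdec]
  refine (norm_add₃_le).trans ?_
  rw [norm_smul, norm_smul, norm_smul, Real.norm_eq_abs, Real.norm_eq_abs, Real.norm_eq_abs]
  have e1 : |t| * ‖f e - f e' - fderiv ℝ f a (e - e')‖ ≤ c / 2 * ‖e - e'‖ :=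
    calc _ ≤ (|T| + 1) * (c / (2 * (|T| + 1)) * ‖e - e'‖) := by gcongr
      _ = _ := by field_simp
  have e2 : |t - T| * ‖fderiv ℝ f a (e - e')‖ ≤ c / 2 * ‖e - e'‖ :=
    calc _ ≤ (c / (2 * (|M| + 1))) * ((|M| + 1) * ‖e - e'‖) := by
          gcongr
          exact ht.2.2
      _ = _ := by field_simp
  have e3 : |t - t'| * ‖f e' - f a‖ ≤ |t - t'| * c := by gcongr
  linarith

theorem C1BoundedBy.dist_le {q : E → E} {M : ℝ} (h : C1BoundedBy q M) (hq : Differentiable ℝ q)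
    (a b : E) : ‖q a - q b‖ ≤ M * ‖a - b‖ :=
  Convex.norm_image_sub_le_of_norm_fderiv_le (fun x _ => hq x) (fun x _ => (h x).2) convex_univ
    (mem_univ _) (mem_univ _)

theorem smul_perturbation_sub_le {q : E → E} {M T r : ℝ} (h : C1BoundedBy q M) (hM : 0 ≤ M)
    (hq : Differentiable ℝ q) (hr : r ≤ 1) {t t' : ℝ} (ht : |t - T| ≤ r) (e e' : E) :
    ‖t • q e - t' • q e'‖ ≤ (|T| + 1) * M * (‖e - e'‖ + |t - t'|) := by
  have ht1 : |t| ≤ |T| + 1 := by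
    have := abs_add_le (t - T) T
    rw [sub_add_cancel] at this
    linarith
  have hdec : t • q e - t' • q e' = t • (q e - q e') + (t - t') • q e' := by
    simp only [smul_sub, sub_smul]; abel
  rw [hdec]
  refine (norm_add_le _ _).trans ?_
  rw [norm_smul, norm_smul, Real.norm_eq_abs, Real.norm_eq_abs]
  have e1 : |t| * ‖q e - q e'‖ ≤ (|T| + 1) * (M * ‖e - e'‖) := by
    gcongr
    exact h.dist_le hq e e'
  have e2 : |t - t'| * ‖q e'‖ ≤ |t - t'| * M := by
    gcongr
    exact (h e').1
  have e3 : |t - t'| * M ≤ (|T| + 1) * (M * |t - t'|) := by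
    have : 0 ≤ |T| * (M * |t - t'|) := by positivity
    linarith
  linarith

/-- Zeros of `periodicMap` extend to `1`-periodic solutions. -/
theorem periodicMap_zero_extends [CompleteSpace E] {g : C(E, E)} {l : E →L[ℝ] ℝ} {x₀ : E}
    {z : C(I, E) × ℝ} (hz : periodicMap g l x₀ z = 0) :
    let y : ℝ → E := fun s => IccExtend (zero_le_one' ℝ) z.1 (Int.fract s)
    Function.Periodic y 1 ∧ ∀ s, HasDerivAt y (z.2 • g (y s)) s := by
  intro y
  obtain ⟨u, t⟩ := z
  have hu : ∀ s : I, u s = u 1 + ∫ r in (0 : ℝ)..s, IccExtend (zero_le_one' ℝ) (t • g.comp u) r := by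
    intro s
    have h1 := congrArg (fun w : C(I, E) × ℝ => w.1 s) hz
    simp only [periodicMap, ContinuousMap.sub_apply, unitEndpoint_apply, unitPrimitive_apply,
      Prod.fst_zero, ContinuousMap.zero_apply] at h1
    rw [sub_sub, sub_eq_zero] at h1
    exact h1
  have h01 : u 0 = u 1 := by simpa using hu 0
  have hyc : Continuous y := by
    refine ContinuousOn.comp_fract'' (continuous_IccExtend_unit u).continuousOn ?_
    rw [IccExtend_of_mem _ _ ⟨le_rfl, zero_le_one⟩, IccExtend_of_mem _ _ ⟨zero_le_one, le_rfl⟩]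
    exact h01
  have hyp : Function.Periodic y 1 := fun s => by simp [y]
  let h : ℝ → E := fun s => t • g (y s)
  have hhc : Continuous h := by fun_prop
  have hhp : Function.Periodic h 1 := fun s => by simp only [h, hyp s]
  have hyI : ∀ s : I, y s = u s := by
    intro s
    rcases eq_or_lt_of_le s.2.2 with h | h
    · have : s = 1 := Subtype.ext h
      subst this
      simp only [y, Icc.coe_one, Int.fract_one]
      rw [IccExtend_of_mem _ _ ⟨le_rfl, zero_le_one⟩]
      exact h01
    · simp only [y]
      rw [Int.fract_eq_self.2 ⟨s.2.1, h⟩, IccExtend_of_mem _ _ s.2]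
  -- A primitive is differentiable everywhere, so `Y = y` spares the gluing of derivatives at the
  -- integers. `Y` is periodic because `Y 1 = u 1` forces the integral of `h` over a period to
  -- vanish.
  let Y : ℝ → E := fun s => u 1 + ∫ r in (0 : ℝ)..s, h r
  have hYI : ∀ s : I, Y s = u s := by
    intro s
    rw [hu s]
    simp only [Y]
    congr 1
    refine intervalIntegral.integral_congr fun r hr => ?_
    rw [uIcc_of_le s.2.1] at hr
    have hr' : r ∈ Icc (0 : ℝ) 1 := ⟨hr.1, hr.2.trans s.2.2⟩
    change h r = _
    rw [IccExtend_of_mem _ _ hr']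
    simp only [h]
    rw [hyI ⟨r, hr'⟩]
    rfl
  have hYp : Function.Periodic Y 1 := by
    intro s
    have h1 := hhp.intervalIntegral_add_eq s 0
    have h2 : ∫ r in (0 : ℝ)..0 + 1, h r = 0 := by
      have := hYI 1
      simpa [Y] using this
    have h3 := intervalIntegral.integral_add_adjacent_intervals (μ := volume)
      (hhc.intervalIntegrable 0 s) (hhc.intervalIntegrable s (s + 1))
    simp only [Y]
    rw [← h3, h1, h2, add_zero]
  have hYy : Y = y := by
    funext s
    have h1 : Y (Int.fract s) = Y s := by
      have := hYp.sub_int_mul_eq (x := s) ⌊s⌋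
      rwa [mul_one] at this
    rw [← h1]
    have hm : Int.fract s ∈ Icc (0 : ℝ) 1 := ⟨Int.fract_nonneg s, (Int.fract_lt_one s).le⟩
    rw [hYI ⟨_, hm⟩]
    simp only [y]
    rw [IccExtend_of_mem _ _ hm]
  refine ⟨hyp, fun s => ?_⟩
  rw [← hYy]
  have hd : HasDerivAt (fun s => ∫ r in (0 : ℝ)..s, h r) (h s) s :=
    intervalIntegral.integral_hasDerivAt_right (hhc.intervalIntegrable _ _)
      (hhc.stronglyMeasurableAtFilter _ _) hhc.continuousAt
  have := hd.const_add (u 1)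
  refine this.congr_deriv ?_
  simp only [h, hYy]

end NonlinearPeriodicProblem

/-! ### Persistence of hyperbolic periodic orbits -/

section Persistence

open Set MeasureTheory intervalIntegral unitInterval Metric
open scoped Topology NNReal

variable {E : Type*} [NormedAddCommGroup E] [NormedSpace ℝ E]

/-- The vector field `f + q` as a continuous map. -/
def perturbedField {f q : E → E} (hf : Continuous f) (hq : Continuous q) : C(E, E) :=
  ⟨fun e => f e + q e, hf.add hq⟩

theorem periodicMap_sub_periodicMap (g g' : C(E, E)) (l : E →L[ℝ] ℝ) (x₀ : E) (z : C(I, E) × ℝ) :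
    periodicMap g' l x₀ z - periodicMap g l x₀ z =
      (unitPrimitive (z.2 • (g.comp z.1 - g'.comp z.1)), 0) := by
  ext1
  · simp only [periodicMap, Prod.fst_sub, smul_sub, map_sub]
    abel
  · simp [periodicMap]

/-- One linear operator, built from `f` alone, serves all `C¹`-small perturbations at once, on a
ball that does not depend on the perturbation. -/
theorem periodicMap_approximatesLinearOn {f : E → E} (hf : ContDiff ℝ 1 f) (X : C(I, E)) (T : ℝ)
    (l : E →L[ℝ] ℝ) (Bc : C(I, E →L[ℝ] E)) (hBc : ∀ s, Bc s = T • fderiv ℝ f (X s))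
    (kc : C(I, E)) (hkc : ∀ s, kc s = f (X s)) {c : ℝ≥0} (hc : 0 < c) :
    ∃ r > 0, r ≤ 1 ∧ ∃ δ > 0, ∀ (q : E → E) (hq : Differentiable ℝ q), C1BoundedBy q δ →
      ApproximatesLinearOn (periodicMap (perturbedField hf.continuous hq.continuous) l (X 0))
        (periodicOperator Bc kc l) (closedBall (X, T) r) c := by
  have hc' : (0 : ℝ) < c := hc
  obtain ⟨r, hr, H⟩ := exists_uniform_linear_approx hf (isCompact_range X.continuous) T
    (c := (c : ℝ) / 4) (by positivity)
  -- `f` and `q` each contribute `c / 4` times `‖u s - u' s‖ + |t - t'|`, a sum of two terms bounded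
  -- by the norm of the difference. The factor `|T| + 1` bounds `|t|`.
  refine ⟨min r 1, by positivity, min_le_right _ _, c / (4 * (|T| + 1)), by positivity, ?_⟩
  intro q hq hqb
  rintro ⟨u, t⟩ hz ⟨u', t'⟩ hz'
  rw [mem_closedBall, Prod.dist_eq, max_le_iff] at hz hz'
  simp only at hz hz'
  have hsecond : (periodicMap (perturbedField hf.continuous hq.continuous) l (X 0) (u, t) -
      periodicMap (perturbedField hf.continuous hq.continuous) l (X 0) (u', t') -
      periodicOperator Bc kc l ((u, t) - (u', t'))).2 = 0 := by
    simp only [Prod.mk_sub_mk, Prod.snd_sub, periodicOperator_snd, periodicMap,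
      ContinuousMap.sub_apply, map_sub]
    ring
  have hfirst : (periodicMap (perturbedField hf.continuous hq.continuous) l (X 0) (u, t) -
      periodicMap (perturbedField hf.continuous hq.continuous) l (X 0) (u', t') -
      periodicOperator Bc kc l ((u, t) - (u', t'))).1 =
      -unitPrimitive (t • (perturbedField hf.continuous hq.continuous).comp u -
        t' • (perturbedField hf.continuous hq.continuous).comp u' -
        (unitMul Bc (u - u') + (t - t') • kc)) := by
    simp only [Prod.mk_sub_mk, Prod.fst_sub, periodicOperator_fst, periodicMap, map_sub]
    abel
  rw [Prod.norm_def, hsecond, hfirst, norm_zero, norm_neg, max_eq_left (norm_nonneg _)]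
  refine (norm_unitPrimitive_le _).trans ?_
  rw [ContinuousMap.norm_le _ (by positivity)]
  intro s
  have hn : ‖u s - u' s‖ ≤ ‖(u, t) - (u', t')‖ :=
    ((u - u').norm_coe_le_norm s).trans (norm_fst_le ((u, t) - (u', t')))
  have hn' : |t - t'| ≤ ‖(u, t) - (u', t')‖ := norm_snd_le ((u, t) - (u', t'))
  have hu : ∀ w : C(I, E), dist w X ≤ min r 1 → w s ∈ closedBall (X s) r := fun w hw =>
    (ContinuousMap.dist_apply_le_dist s).trans (hw.trans (min_le_left _ _))
  have h1 := H (X s) (mem_range_self s) (u s) (hu u hz.1) (u' s) (hu u' hz'.1) t t'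
    (hz.2.trans (min_le_left _ _)) (hz'.2.trans (min_le_left _ _))
  have h2 := smul_perturbation_sub_le hqb (by positivity) hq (min_le_right r 1) (t' := t')
    hz.2 (u s) (u' s)
  have h3 : (|T| + 1) * (c / (4 * (|T| + 1))) = (c : ℝ) / 4 := by field_simp
  rw [h3] at h2
  have hval : (t • (perturbedField hf.continuous hq.continuous).comp u -
        t' • (perturbedField hf.continuous hq.continuous).comp u' -
        (unitMul Bc (u - u') + (t - t') • kc)) s =
      (t • f (u s) - t' • f (u' s) -
        (T • fderiv ℝ f (X s) (u s - u' s) + (t - t') • f (X s))) +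
      (t • q (u s) - t' • q (u' s)) := by
    simp only [ContinuousMap.sub_apply, ContinuousMap.smul_apply, ContinuousMap.comp_apply,
      ContinuousMap.add_apply, unitMul_apply, hBc, hkc, perturbedField, ContinuousMap.coe_mk,
      smul_add, _root_.smul_apply]
    abel
  rw [hval]
  refine (norm_add_le _ _).trans ?_
  nlinarith

/-- Zeros of the perturbed boundary value problems near a nondegenerate zero exist, and they depend
on the perturbation in a Lipschitz way, with respect to an `L¹` norm along the solution. -/
theorem periodicMap_zeros {f : E → E} (hf : ContDiff ℝ 1 f) [CompleteSpace E] (X : C(I, E)) {T : ℝ}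
    (hT : 0 < T) (l : E →L[ℝ] ℝ) (Bc : C(I, E →L[ℝ] E)) (hBc : ∀ s, Bc s = T • fderiv ℝ f (X s))
    (kc : C(I, E)) (hkc : ∀ s, kc s = f (X s))
    (hbij : Function.Bijective (periodicOperator Bc kc l))
    (hX : periodicMap ⟨f, hf.continuous⟩ l (X 0) (X, T) = 0) :
    ∃ r > 0, r < T ∧ ∃ δ > 0, ∃ K > 0,
      (∀ (q : E → E) (hq : Differentiable ℝ q), C1BoundedBy q δ → ∃ z ∈ closedBall (X, T) r,
        periodicMap (perturbedField hf.continuous hq.continuous) l (X 0) z = 0) ∧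
      ∀ (q q' : E → E) (hq : Differentiable ℝ q) (hq' : Differentiable ℝ q'), C1BoundedBy q δ →
        C1BoundedBy q' δ → ∀ z ∈ closedBall (X, T) r, ∀ z' ∈ closedBall (X, T) r,
        periodicMap (perturbedField hf.continuous hq.continuous) l (X 0) z = 0 →
        periodicMap (perturbedField hf.continuous hq'.continuous) l (X 0) z' = 0 →
        ‖z - z'‖ ≤ K * ∫ s in (0 : ℝ)..1,
          ‖q (IccExtend (zero_le_one' ℝ) z.1 s) - q' (IccExtend (zero_le_one' ℝ) z.1 s)‖ := by
  let L : (C(I, E) × ℝ) ≃L[ℝ] (C(I, E) × ℝ) := ContinuousLinearEquiv.ofBijective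
    (periodicOperator Bc kc l) (LinearMap.ker_eq_bot.2 hbij.1) (LinearMap.range_eq_top.2 hbij.2)
  have hL : (L : (C(I, E) × ℝ) →L[ℝ] (C(I, E) × ℝ)) = periodicOperator Bc kc l :=
    ContinuousLinearEquiv.coe_ofBijective _ _ _
  let N : ℝ≥0 := ‖(L.symm : (C(I, E) × ℝ) →L[ℝ] (C(I, E) × ℝ))‖₊ + 1
  have hN : (0 : ℝ) < N := by positivity
  have hLN : ∀ z, ‖z‖ ≤ N * ‖periodicOperator Bc kc l z‖ := by
    intro z
    have h1 := (L.symm : (C(I, E) × ℝ) →L[ℝ] (C(I, E) × ℝ)).le_opNorm (L z)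
    have h2 : (L.symm : (C(I, E) × ℝ) →L[ℝ] (C(I, E) × ℝ)) (L z) = z := L.symm_apply_apply z
    have h3 : L z = periodicOperator Bc kc l z := by rw [← hL]; rfl
    rw [h2, h3] at h1
    refine h1.trans (mul_le_mul_of_nonneg_right ?_ (norm_nonneg _))
    simp [N]
  let R : ContinuousLinearMap.NonlinearRightInverse (periodicOperator Bc kc l) :=
    { toFun := L.symm
      nnnorm := N
      bound' := fun z => by
        have h1 := hLN (L.symm z)
        rwa [← hL, ContinuousLinearEquiv.coe_coe, L.apply_symm_apply] at h1
      right_inv' := fun z => by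
        rw [← hL]; exact L.apply_symm_apply z }
  -- With the error constant `(2N)⁻¹`, half of the lower bound `N⁻¹` for the linear operator
  -- survives.
  obtain ⟨r0, hr0, hr01, δ0, hδ0, H⟩ := periodicMap_approximatesLinearOn hf X T l Bc hBc kc hkc
    (c := (2 * N)⁻¹) (by positivity)
  have hNc : (N : ℝ)⁻¹ - ((2 * N)⁻¹ : ℝ≥0) = (2 * N : ℝ)⁻¹ := by
    push_cast
    field_simp
    norm_num
  let r : ℝ := min r0 (T / 2)
  have hr : 0 < r := by positivity
  have hrr0 : closedBall (X, T) r ⊆ closedBall (X, T) r0 := closedBall_subset_closedBall (min_le_left _ _)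
  -- `r ≤ T / 2` keeps the periods positive. The old solution leaves a residual of at most `T ‖q‖ ≤
  -- r / (2N)`, which is the radius of the ball covered by the image. In `2N(T + 1)`, `N` comes from
  -- the inverse operator, `T + 1` bounds the period, and `2` comes from absorbing half of `‖z -
  -- z'‖`.
  refine ⟨r, hr, (min_le_right _ _).trans_lt (by linarith), min δ0 ((2 * N : ℝ)⁻¹ * r / T), by positivity,
    2 * N * (T + 1), by positivity, ?_, ?_⟩
  · intro q hq hqb
    have hqb0 : C1BoundedBy q δ0 := fun x =>
      ⟨(hqb x).1.trans (min_le_left _ _), (hqb x).2.trans (min_le_left _ _)⟩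
    have hsurj := ((H q hq hqb0).mono_set hrr0).surjOn_closedBall_of_nonlinearRightInverse R hr.le
      Subset.rfl
    have h0 : (0 : C(I, E) × ℝ) ∈ closedBall
        (periodicMap (perturbedField hf.continuous hq.continuous) l (X 0) (X, T))
        (((R.nnnorm : ℝ)⁻¹ - ((2 * N)⁻¹ : ℝ≥0)) * r) := by
      change _ ∈ closedBall _ (((N : ℝ)⁻¹ - ((2 * N)⁻¹ : ℝ≥0)) * r)
      rw [hNc, mem_closedBall, dist_comm, dist_zero_right]
      have h1 := periodicMap_sub_periodicMap ⟨f, hf.continuous⟩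
        (perturbedField hf.continuous hq.continuous) l (X 0) (X, T)
      rw [hX, sub_zero] at h1
      rw [h1, Prod.norm_def, norm_zero, max_eq_left (norm_nonneg _)]
      refine (norm_unitPrimitive_le _).trans ?_
      rw [ContinuousMap.norm_le _ (by positivity)]
      intro s
      have h2 : (T • ((⟨f, hf.continuous⟩ : C(E, E)).comp X -
          (perturbedField hf.continuous hq.continuous).comp X)) s = -(T • q (X s)) := by
        simp [perturbedField]
      rw [h2, norm_neg, norm_smul, Real.norm_of_nonneg hT.le]
      calc T * ‖q (X s)‖ ≤ T * ((2 * N : ℝ)⁻¹ * r / T) := by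
            gcongr
            exact ((hqb _).1).trans (min_le_right _ _)
        _ = _ := by field_simp
    obtain ⟨z, hz, hz0⟩ := hsurj h0
    exact ⟨z, hz, hz0⟩
  · intro q q' hq hq' hqb hqb' z hz z' hz' hz0 hz0'
    have hqb0 : C1BoundedBy q' δ0 := fun x =>
      ⟨(hqb' x).1.trans (min_le_left _ _), (hqb' x).2.trans (min_le_left _ _)⟩
    -- Comparing both zeros by means of the map for `q'` leaves only its value at `z`. As `z` is a
    -- zero for `q`, this value is a primitive of `q - q'` along `z` alone.
    have h1 := H q' hq' hqb0 z (hrr0 hz) z' (hrr0 hz')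
    rw [hz0', sub_zero] at h1
    have h2 := periodicMap_sub_periodicMap (perturbedField hf.continuous hq.continuous)
      (perturbedField hf.continuous hq'.continuous) l (X 0) z
    rw [hz0, sub_zero] at h2
    rw [h2] at h1
    have hz2 : |z.2| ≤ T + 1 := by
      have h3 : dist z.2 T ≤ r := (le_max_right _ _).trans hz
      rw [Real.dist_eq] at h3
      have h4 := abs_add_le (z.2 - T) T
      rw [sub_add_cancel, abs_of_pos hT] at h4
      have h5 : r ≤ 1 := (min_le_left _ _).trans hr01
      linarith
    set J := ∫ s in (0 : ℝ)..1,
          ‖q (IccExtend (zero_le_one' ℝ) z.1 s) - q' (IccExtend (zero_le_one' ℝ) z.1 s)‖ with hJ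
    have hV : ‖(unitPrimitive (z.2 • ((perturbedField hf.continuous hq.continuous).comp z.1 -
        (perturbedField hf.continuous hq'.continuous).comp z.1)), (0 : ℝ))‖ ≤ (T + 1) * J := by
      rw [Prod.norm_def, norm_zero, max_eq_left (norm_nonneg _), map_smul, norm_smul,
        Real.norm_eq_abs]
      refine mul_le_mul hz2 ((norm_unitPrimitive_le_integral _).trans (le_of_eq ?_))
        (norm_nonneg _) (by positivity)
      rw [hJ]
      refine intervalIntegral.integral_congr fun s _ => ?_
      simp [IccExtend, perturbedField]
    have h3 := hLN (z - z')
    have h4 : ‖periodicOperator Bc kc l (z - z')‖ ≤ (2 * N : ℝ)⁻¹ * ‖z - z'‖ + (T + 1) * J := by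
      have h5 := norm_sub_norm_le (periodicOperator Bc kc l (z - z'))
        (unitPrimitive (z.2 • ((perturbedField hf.continuous hq.continuous).comp z.1 -
        (perturbedField hf.continuous hq'.continuous).comp z.1)), (0 : ℝ))
      rw [norm_sub_rev] at h5
      push_cast at h1
      linarith
    have h6 : (N : ℝ) * ((2 * N : ℝ)⁻¹ * ‖z - z'‖ + (T + 1) * J) =
        ‖z - z'‖ / 2 + N * (T + 1) * J := by
      field_simp
    have h7 := h3.trans (mul_le_mul_of_nonneg_left h4 hN.le)
    rw [h6] at h7
    linarith

end Persistence

section Persistence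

open Set MeasureTheory intervalIntegral unitInterval Metric
open scoped Topology NNReal

variable {E : Type*} [NormedAddCommGroup E] [NormedSpace ℝ E]

/-- A `1`-periodic function whose derivative is bounded by a multiple of the function vanishes
identically if it vanishes somewhere. -/
theorem eq_zero_of_periodic_of_norm_deriv_le {d d' : ℝ → E} {K t₀ : ℝ}
    (hd : ∀ t, HasDerivAt d (d' t) t) (hK : ∀ t, ‖d' t‖ ≤ K * ‖d t‖) {T : ℝ} (hT : 0 < T)
    (hper : Function.Periodic d T) (h0 : d t₀ = 0) (t : ℝ) : d t = 0 := by
  -- Uniqueness is used forwards in time only; periodicity moves `t` beyond `t₀`.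
  obtain ⟨n, hn⟩ := exists_nat_ge ((t₀ - t) / T)
  rw [div_le_iff₀ hT] at hn
  have h1 : d (t + n * T) = d t := hper.nat_mul n t
  rw [← h1]
  exact eq_zero_of_abs_deriv_le_mul_abs_self_of_eq_zero_right (a := t₀) (b := t + n * T) (K := K)
    (fun s _ => (hd s).continuousAt.continuousWithinAt) (fun s _ => (hd s).hasDerivWithinAt) h0
    (fun s _ => hK s) _ ⟨by linarith, le_rfl⟩

/-- A continuously differentiable map is Lipschitz on bounded sets. -/
theorem exists_lipschitz_on_periodic {F : Type*} [NormedAddCommGroup F] [NormedSpace ℝ F]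
    [FiniteDimensional ℝ E] {f : E → F} (hf : ContDiff ℝ 1 f)
    (R : ℝ) : ∃ K : ℝ≥0, ∀ a b : E, ‖a‖ ≤ R → ‖b‖ ≤ R → ‖f a - f b‖ ≤ K * ‖a - b‖ := by
  have : ProperSpace E := FiniteDimensional.proper ℝ E
  obtain ⟨M, hM⟩ := (isCompact_closedBall (0 : E) R).exists_bound_of_continuousOn
    (hf.continuous_fderiv one_ne_zero).continuousOn
  refine ⟨M.toNNReal, fun a b ha hb => ?_⟩
  refine (convex_closedBall (0 : E) R).norm_image_sub_le_of_norm_fderiv_le (𝕜 := ℝ)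
    (fun x _ => (hf.differentiable one_ne_zero) x) (fun x hx => (hM x hx).trans ?_)
    (by simpa using hb) (by simpa using ha)
  exact Real.le_coe_toNNReal M

omit [NormedSpace ℝ E] in
theorem Function.Periodic.exists_norm_le {u : ℝ → E} {T : ℝ} (hT : 0 < T)
    (hu : Function.Periodic u T) (hc : Continuous u) : ∃ R, ∀ t, ‖u t‖ ≤ R := by
  obtain ⟨R, hR⟩ := (hu.compact_of_continuous hT.ne' hc).isBounded.exists_norm_le
  exact ⟨R, fun t => hR _ ⟨t, rfl⟩⟩

/-- A periodic solution through an equilibrium is constant. -/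
theorem eq_of_periodic_of_equilibrium [FiniteDimensional ℝ E] {f : E → E} (hf : ContDiff ℝ 1 f)
    {u : ℝ → E} {T : ℝ} (hT : 0 < T) (hu : ∀ t, HasDerivAt u (f (u t)) t)
    (hper : Function.Periodic u T) {t₀ : ℝ} (h0 : f (u t₀) = 0) (t : ℝ) : u t = u t₀ := by
  have hc : Continuous u := continuous_iff_continuousAt.2 fun t => (hu t).continuousAt
  obtain ⟨R, hR⟩ := hper.exists_norm_le hT hc
  obtain ⟨K, hK⟩ := exists_lipschitz_on_periodic hf R
  have := eq_zero_of_periodic_of_norm_deriv_le (d := fun t => u t - u t₀) (K := K) (t₀ := t₀)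
    (fun t => (hu t).sub_const _)
    (fun t => by
      have := hK (u t) (u t₀) (hR t) (hR t₀)
      rwa [h0, sub_zero] at this) hT
    (fun t => by simp only [hper t]) (sub_self _) t
  exact sub_eq_zero.1 this

theorem IsPeriodicOrbit.exists_ne {f : E → E} {x : ℝ → E} {T : ℝ}
    (hx : IsPeriodicOrbit f x T) (t₀ : ℝ) : ∃ t, x t ≠ x t₀ := by
  by_contra! h
  exact hx.least (T / 2) (half_pos hx.pos) (half_lt_self hx.pos) fun t => by
    rw [h (t + T / 2), h t]

theorem IsPeriodicOrbit.apply_ne_zero [FiniteDimensional ℝ E] {f : E → E} (hf : ContDiff ℝ 1 f)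
    {x : ℝ → E} {T : ℝ} (hx : IsPeriodicOrbit f x T) (t₀ : ℝ) : f (x t₀) ≠ 0 := by
  intro h0
  obtain ⟨t, ht⟩ := hx.exists_ne t₀
  exact ht (eq_of_periodic_of_equilibrium hf hx.pos hx.hasDerivAt hx.periodic h0 t)

/-- The velocity along the orbit solves the linearised equation, so it is an eigenvector of the
monodromy operator for `1`; hyperbolicity makes this eigenvalue algebraically simple. -/
theorem periodicOperator_bijective_of_hyperbolic [FiniteDimensional ℝ E] {f : E → E}
    (hf : ContDiff ℝ 1 f) {x : ℝ → E} {T : ℝ} (hx : IsHyperbolicPeriodicOrbit f x T)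
    (l : E →L[ℝ] ℝ) (hl : l (f (x 0)) ≠ 0)
    (Bc : C(I, E →L[ℝ] E)) (hBc : ∀ s : I, Bc s = T • fderiv ℝ f (x (T * s)))
    (kc : C(I, E)) (hkc : ∀ s : I, kc s = f (x (T * s))) :
    Function.Bijective (periodicOperator Bc kc l) := by
  obtain ⟨Φ, hΦ, hmult⟩ := hx.floquet
  have hxc : Continuous x := continuous_iff_continuousAt.2 fun t => (hx.hasDerivAt t).continuousAt
  have hdc : Continuous (fderiv ℝ f) := hf.continuous_fderiv one_ne_zero
  let B : ℝ → E →L[ℝ] E := fun t => T • fderiv ℝ f (x (T * t))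
  have hB : Continuous B := by fun_prop
  let Ψ : ℝ → E →L[ℝ] E := fun t => LinearMap.toContinuousLinearMap (Φ (T * t))
  have hΨ0 : Ψ 0 = ContinuousLinearMap.id ℝ E := by
    ext v
    simp [Ψ, hΦ.zero]
  have hmul : ∀ t : ℝ, HasDerivAt (fun s => T * s) T t := fun t => by
    simpa using (hasDerivAt_id t).const_mul T
  have hΨ : ∀ v t, HasDerivAt (fun τ => Ψ τ v) (B t (Ψ t v)) t := fun v t =>
    (hΦ.hasDerivAt v (T * t)).scomp t (hmul t)
  have hk : ∀ t, HasDerivAt (fun s => f (x (T * s))) (B t (f (x (T * t)))) t := by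
    intro t
    have h1 : HasDerivAt (fun s => x (T * s)) (T • f (x (T * t))) t :=
      (hx.hasDerivAt (T * t)).scomp t (hmul t)
    have h2 := ((hf.differentiable one_ne_zero) (x (T * t))).hasFDerivAt.comp_hasDerivAt t h1
    refine h2.congr_deriv ?_
    simp [B]
  have hk1 : f (x (T * 1)) = f (x (T * 0)) := by
    have := hx.periodic 0
    rw [zero_add] at this
    rw [mul_one, mul_zero, this]
  have hMk : (Φ T) (f (x 0)) = f (x 0) := by
    have h1 := eq_zero_of_hasDerivAt_linear hB (a := 0) (b := 1)
      (d := fun t => Ψ t (f (x 0)) - f (x (T * t)))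
      (fun t _ => ((hΨ _ t).sub (hk t)).continuousAt.continuousWithinAt)
      (fun t _ => by
        rw [map_sub]
        exact ((hΨ _ t).sub (hk t)).hasDerivWithinAt)
      (by simp [hΨ0]) 1 ⟨zero_le_one, le_rfl⟩
    rw [hk1, mul_zero] at h1
    have h2 := sub_eq_zero.1 h1
    simpa [Ψ] using h2
  have hk0 : f (x 0) ≠ 0 := fun h => hl (by rw [h, map_zero])
  refine periodicOperator_bijective hB hΨ0 hΨ hk hk1 l (by simpa using hl) ?_ Bc hBc kc hkc
  intro r κ h
  simp only [mul_zero] at h ⊢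
  refine eq_smul_of_rootMultiplicity_one hk0 hMk ?_ r κ (by simpa [Ψ] using h)
  simpa using hmult 1 (by simp)

/-- Persistence of hyperbolic periodic orbits. The orbits of the perturbed equations are parametrized
with period one; `τ q` is the true period. The dependence on the perturbation is controlled by an
`L¹` norm along the perturbed orbit. -/
theorem hyperbolic_persistence [FiniteDimensional ℝ E] {f : E → E} (hf : ContDiff ℝ 1 f)
    {x : ℝ → E} {T : ℝ} (hx : IsHyperbolicPeriodicOrbit f x T) :
    ∃ δ > 0, ∃ K > 0, ∃ (U : (E → E) → ℝ → E) (τ : (E → E) → ℝ),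
      (∀ s, U 0 s = x (T * s)) ∧ τ 0 = T ∧
      ∀ q : E → E, Differentiable ℝ q → C1BoundedBy q δ →
        0 < τ q ∧ Function.Periodic (U q) 1 ∧
        (∀ s, HasDerivAt (U q) (τ q • (f (U q s) + q (U q s))) s) ∧
        ∀ q' : E → E, Differentiable ℝ q' → C1BoundedBy q' δ →
          (∀ s, ‖U q s - U q' s‖ ≤ K * ∫ r in (0 : ℝ)..1, ‖q (U q r) - q' (U q r)‖) ∧
          |τ q - τ q'| ≤ K * ∫ r in (0 : ℝ)..1, ‖q (U q r) - q' (U q r)‖ := by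
  have : CompleteSpace E := FiniteDimensional.complete ℝ E
  have hxc : Continuous x := continuous_iff_continuousAt.2 fun t => (hx.hasDerivAt t).continuousAt
  have hdc : Continuous (fderiv ℝ f) := hf.continuous_fderiv one_ne_zero
  have hfc : Continuous f := hf.continuous
  -- The level of `l` through `x 0` is transverse to the orbit; requiring that orbits start on it
  -- removes the freedom of time translation.
  obtain ⟨l, hl⟩ := SeparatingDual.exists_ne_zero (R := ℝ) (hx.toIsPeriodicOrbit.apply_ne_zero hf 0)
  let X : C(I, E) := ⟨fun s => x (T * s), by fun_prop⟩
  let Bc : C(I, E →L[ℝ] E) := ⟨fun s => T • fderiv ℝ f (x (T * s)), by fun_prop⟩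
  let kc : C(I, E) := ⟨fun s => f (x (T * s)), by fun_prop⟩
  have hbij := periodicOperator_bijective_of_hyperbolic hf hx l hl Bc (fun _ => rfl) kc fun _ => rfl
  have hmul : ∀ t : ℝ, HasDerivAt (fun s => T * s) T t := fun t => by
    simpa using (hasDerivAt_id t).const_mul T
  have hX : periodicMap ⟨f, hf.continuous⟩ l (X 0) (X, T) = 0 := by
    ext1
    · ext s
      have h1 : ∫ r in (0 : ℝ)..s, IccExtend (zero_le_one' ℝ)
          (T • (⟨f, hf.continuous⟩ : C(E, E)).comp X) r = x (T * s) - x (T * 0) := by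
        refine intervalIntegral.integral_eq_sub_of_hasDerivAt (f := fun s => x (T * s))
          (fun t ht => ?_) ((continuous_IccExtend_unit _).intervalIntegrable _ _)
        rw [uIcc_of_le s.2.1] at ht
        rw [IccExtend_of_mem _ _ ⟨ht.1, ht.2.trans s.2.2⟩]
        exact (hx.hasDerivAt (T * t)).scomp t (hmul t)
      have h2 : x (T * 1) = x (T * 0) := by
        have := hx.periodic 0
        rw [zero_add] at this
        rw [mul_one, mul_zero, this]
      change x (T * s) - x (T * (1 : ℝ)) - ∫ r in (0 : ℝ)..s, IccExtend (zero_le_one' ℝ)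
          (T • (⟨f, hf.continuous⟩ : C(E, E)).comp X) r = 0
      rw [h1, h2, sub_self]
    · simp [periodicMap]
  obtain ⟨r, hr, hrT, δ, hδ, K, hK, hex, hest⟩ := periodicMap_zeros hf X hx.pos l Bc (fun _ => rfl)
    kc (fun _ => rfl) hbij hX
  classical
  let Z : (E → E) → C(I, E) × ℝ := fun q =>
    if h : Differentiable ℝ q ∧ C1BoundedBy q δ then (hex q h.1 h.2).choose else (X, T)
  have hZ : ∀ q (hq : Differentiable ℝ q), C1BoundedBy q δ → Z q ∈ closedBall (X, T) r ∧
      periodicMap (perturbedField hf.continuous hq.continuous) l (X 0) (Z q) = 0 := by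
    intro q hq hqb
    have h1 : Z q = (hex q hq hqb).choose := dif_pos ⟨hq, hqb⟩
    rw [h1]
    exact (hex q hq hqb).choose_spec
  have h0d : Differentiable ℝ (0 : E → E) := differentiable_const (0 : E)
  have h0b : C1BoundedBy (0 : E → E) δ := fun x => by
    simp [hδ.le]
  -- For `q = q' = 0` the estimate is a uniqueness statement, so the chosen zero is the given orbit.
  have hZ0 : Z 0 = (X, T) := by
    have h1 := hest 0 0 h0d h0d h0b h0b (Z 0) (hZ 0 h0d h0b).1 (X, T)
      (mem_closedBall_self hr.le) (hZ 0 h0d h0b).2 (by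
        rw [← hX]
        congr 1
        ext e
        simp [perturbedField])
    simp only [sub_self, norm_zero, intervalIntegral.integral_zero, mul_zero] at h1
    exact sub_eq_zero.1 (norm_le_zero_iff.1 h1)
  refine ⟨δ, hδ, K, hK, fun q s => IccExtend (zero_le_one' ℝ) (Z q).1 (Int.fract s), fun q => (Z q).2,
    fun s => ?_, by simp [hZ0], ?_⟩
  · simp only [hZ0]
    rw [IccExtend_of_mem _ _ ⟨Int.fract_nonneg s, (Int.fract_lt_one s).le⟩]
    change x (T * Int.fract s) = x (T * s)
    have := hx.periodic.sub_int_mul_eq (x := T * s) ⌊s⌋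
    rw [← this, Int.fract]
    congr 1
    ring
  · intro q hq hqb
    obtain ⟨hm, hz⟩ := hZ q hq hqb
    obtain ⟨hper, hder⟩ := periodicMap_zero_extends hz
    refine ⟨?_, hper, hder, ?_⟩
    · have h1 : dist (Z q).2 T ≤ r := (le_max_right _ _).trans hm
      rw [Real.dist_eq] at h1
      have := (abs_le.1 h1).1
      linarith
    · intro q' hq' hqb'
      obtain ⟨hm', hz'⟩ := hZ q' hq' hqb'
      have h1 := hest q q' hq hq' hqb hqb' (Z q) hm (Z q') hm' hz hz'
      -- `Int.fract` differs from the identity on the unit interval at the endpoint `1` only.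
      have h2 : ∫ s in (0 : ℝ)..1, ‖q (IccExtend (zero_le_one' ℝ) (Z q).1 s) -
            q' (IccExtend (zero_le_one' ℝ) (Z q).1 s)‖ =
          ∫ s in (0 : ℝ)..1, ‖q (IccExtend (zero_le_one' ℝ) (Z q).1 (Int.fract s)) -
            q' (IccExtend (zero_le_one' ℝ) (Z q).1 (Int.fract s))‖ := by
        rw [intervalIntegral.integral_of_le zero_le_one, intervalIntegral.integral_of_le zero_le_one,
          ← integral_Ico_eq_integral_Ioc, ← integral_Ico_eq_integral_Ioc]
        refine setIntegral_congr_fun measurableSet_Ico fun s hs => ?_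
        rw [Int.fract_eq_self.2 hs]
      rw [h2] at h1
      refine ⟨fun s => ?_, (norm_snd_le (Z q - Z q')).trans h1⟩
      exact (((Z q - Z q').1).norm_coe_le_norm _).trans ((norm_fst_le (Z q - Z q')).trans h1)

end Persistence

/-! ### An `ℓ¹` space of smooth perturbations -/

section SeriesOfPerturbations

open Set Filter
open scoped Topology ENNReal

variable {E F D : Type*} [NormedAddCommGroup E] [NormedSpace ℝ E] [NormedAddCommGroup F]
  [NormedSpace ℝ F] [NormedAddCommGroup D] [NormedSpace ℝ D]

/-- Smooth maps all of whose derivatives, including the one of order zero, are bounded. -/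
structure HasBoundedDerivs (g : E → F) : Prop where
  smooth : ContDiff ℝ ∞ g
  bounded : ∀ k : ℕ, ∃ M : ℝ, ∀ x, ‖iteratedFDeriv ℝ k g x‖ ≤ M

theorem ContDiff.hasBoundedDerivs_of_hasCompactSupport {g : E → F} (hg : ContDiff ℝ ∞ g)
    (hs : HasCompactSupport g) : HasBoundedDerivs g :=
  ⟨hg, fun k => (hg.continuous_iteratedFDeriv (by exact_mod_cast le_top)).bounded_above_of_compact_support
    (hs.iteratedFDeriv k)⟩

theorem HasBoundedDerivs.comp_clm {g : E → F} (hg : HasBoundedDerivs g) (L : D →L[ℝ] E) :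
    HasBoundedDerivs (g ∘ L) := by
  refine ⟨hg.smooth.comp L.contDiff, fun k => ?_⟩
  obtain ⟨M, hM⟩ := hg.bounded k
  refine ⟨M * ∏ _i : Fin k, ‖L‖, fun x => ?_⟩
  rw [L.iteratedFDeriv_comp_right hg.smooth x (by exact_mod_cast le_top)]
  refine (ContinuousMultilinearMap.norm_compContinuousLinearMap_le _ _).trans ?_
  exact mul_le_mul_of_nonneg_right (hM _) (Finset.prod_nonneg fun _ _ => norm_nonneg _)

theorem HasBoundedDerivs.clm_comp {g : E → F} (hg : HasBoundedDerivs g) (L : F →L[ℝ] D) :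
    HasBoundedDerivs (L ∘ g) := by
  refine ⟨L.contDiff.comp hg.smooth, fun k => ?_⟩
  obtain ⟨M, hM⟩ := hg.bounded k
  refine ⟨‖L‖ * M, fun x => ?_⟩
  refine (L.norm_iteratedFDeriv_comp_left (N := ∞) hg.smooth.contDiffAt
    (by exact_mod_cast le_top)).trans ?_
  exact mul_le_mul_of_nonneg_left (hM _) (norm_nonneg _)

theorem HasBoundedDerivs.sum {ι : Type*} {s : Finset ι} {g : ι → E → F}
    (hg : ∀ i ∈ s, HasBoundedDerivs (g i)) : HasBoundedDerivs fun x => ∑ i ∈ s, g i x := by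
  refine ⟨ContDiff.sum fun i hi => (hg i hi).smooth, fun k => ?_⟩
  choose! M hM using fun i (hi : i ∈ s) => (hg i hi).bounded k
  refine ⟨∑ i ∈ s, M i, fun x => ?_⟩
  rw [iteratedFDeriv_fun_sum_apply fun i hi => ((hg i hi).smooth.of_le
    (by exact_mod_cast le_top)).contDiffAt]
  exact norm_sum_le_of_le _ fun i hi => hM i hi x

/-- Sequences of smooth maps for which all absolutely summable combinations are smooth. -/
structure IsPerturbationFamily (H : ℕ → E → E) : Prop where
  smooth : ∀ n, ContDiff ℝ ∞ (H n)
  bound : ∀ n k : ℕ, k ≤ n + 1 → ∀ x, ‖iteratedFDeriv ℝ k (H n) x‖ ≤ 1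

/-- A diagonal choice: `h n` is divided by a bound for its derivatives up to order `n + 1`. Each
fixed order is then controlled for all but finitely many `n`, and the orders zero and one are
controlled for every `n`, which the `C¹` estimates need. -/
theorem exists_smul_isPerturbationFamily {h : ℕ → E → E} (hh : ∀ n, HasBoundedDerivs (h n)) :
    ∃ c : ℕ → ℝ, (∀ n, 0 < c n) ∧ IsPerturbationFamily fun n x => c n • h n x := by
  choose M hM using fun n k => (hh n).bounded k
  have hM0 : ∀ n k, 0 ≤ M n k := fun n k => (norm_nonneg _).trans (hM n k 0)
  let S : ℕ → ℝ := fun n => 1 + ∑ k ∈ Finset.range (n + 2), M n k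
  have hS : ∀ n, 0 < S n := fun n => by
    have : 0 ≤ ∑ k ∈ Finset.range (n + 2), M n k := Finset.sum_nonneg fun k _ => hM0 n k
    positivity
  refine ⟨fun n => (S n)⁻¹, fun n => inv_pos.2 (hS n),
    fun n => (hh n).smooth.const_smul (S n)⁻¹, fun n k hk x => ?_⟩
  have h1 : ContDiffAt ℝ k (h n) x := ((hh n).smooth.of_le (by exact_mod_cast le_top)).contDiffAt
  have h2 : iteratedFDeriv ℝ k (fun x => (S n)⁻¹ • h n x) x = (S n)⁻¹ • iteratedFDeriv ℝ k (h n) x :=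
    iteratedFDeriv_const_smul_apply h1
  rw [h2, norm_smul, Real.norm_of_nonneg (inv_pos.2 (hS n)).le, inv_mul_le_iff₀ (hS n), mul_one]
  refine (hM n k x).trans ?_
  have := Finset.single_le_sum (f := fun k => M n k) (fun k _ => hM0 n k)
    (Finset.mem_range.2 (Nat.lt_succ_of_le hk))
  simp only [S]
  linarith

/-- The Banach space of absolutely summable coefficient sequences. -/
abbrev SummableSeq : Type := lp (fun _ : ℕ => ℝ) 1

theorem SummableSeq.summable_norm (a : SummableSeq) : Summable fun n => ‖a n‖ := by
  have := (memℓp_gen_iff (p := 1) (by simp)).1 (lp.memℓp a)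
  simpa using this

theorem SummableSeq.norm_eq (a : SummableSeq) : ‖a‖ = ∑' n, ‖a n‖ := by
  have := lp.norm_eq_tsum_rpow (p := 1) (by simp) a
  simpa using this

/-- The combination of the maps `H n` with coefficients `a n`. -/
noncomputable def seriesField (H : ℕ → E → E) (a : SummableSeq) : E → E :=
  fun x => ∑' n, a n • H n x

namespace IsPerturbationFamily

variable {H : ℕ → E → E} (hH : IsPerturbationFamily H)
include hH

theorem norm_le (n : ℕ) (x : E) : ‖H n x‖ ≤ 1 := by
  simpa using hH.bound n 0 (Nat.zero_le _) x

theorem norm_sub_le (n : ℕ) (x y : E) : ‖H n x - H n y‖ ≤ ‖x - y‖ := by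
  have := Convex.norm_image_sub_le_of_norm_fderiv_le (𝕜 := ℝ) (C := 1) (f := H n) (s := univ)
    (x := y) (y := x)
    (fun x _ => ((hH.smooth n).differentiable (by simp)) x)
    (fun x _ => by
      rw [← norm_iteratedFDeriv_one]
      exact hH.bound n 1 (Nat.le_add_left 1 n) x) convex_univ (mem_univ _) (mem_univ _)
  rwa [one_mul] at this

variable [CompleteSpace E]

theorem summable (a : SummableSeq) (x : E) : Summable fun n => a n • H n x :=
  Summable.of_norm_bounded a.summable_norm fun n => by
    rw [norm_smul]
    exact mul_le_of_le_one_right (norm_nonneg _) (hH.norm_le n x)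

theorem seriesField_add (a b : SummableSeq) :
    seriesField H (a + b) = seriesField H a + seriesField H b := by
  funext x
  simp only [seriesField, Pi.add_apply, lp.coeFn_add, add_smul]
  exact (hH.summable a x).tsum_add (hH.summable b x)

omit hH [CompleteSpace E] in
theorem seriesField_smul (c : ℝ) (a : SummableSeq) :
    seriesField H (c • a) = c • seriesField H a := by
  funext x
  simp only [seriesField, Pi.smul_apply, lp.coeFn_smul, smul_eq_mul, mul_smul]
  exact tsum_const_smul'' c

theorem seriesField_sub (a b : SummableSeq) :
    seriesField H (a - b) = seriesField H a - seriesField H b := by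
  rw [sub_eq_add_neg, hH.seriesField_add, sub_eq_add_neg, ← neg_one_smul ℝ b, seriesField_smul,
    neg_one_smul]

omit hH [CompleteSpace E] in
theorem seriesField_single (n : ℕ) (c : ℝ) :
    seriesField H (lp.single 1 n c) = c • H n := by
  funext x
  simp only [seriesField, Pi.smul_apply]
  rw [tsum_eq_single n fun m hm => by rw [lp.single_apply_ne _ _ _ hm, zero_smul],
    lp.single_apply_self]

omit [CompleteSpace E] in
theorem norm_seriesField_le (a : SummableSeq) (x : E) : ‖seriesField H a x‖ ≤ ‖a‖ := by
  rw [a.norm_eq]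
  refine tsum_of_norm_bounded a.summable_norm.hasSum fun n => ?_
  rw [norm_smul]
  exact mul_le_of_le_one_right (norm_nonneg _) (hH.norm_le n x)

theorem norm_seriesField_sub_le (a : SummableSeq) (x y : E) :
    ‖seriesField H a x - seriesField H a y‖ ≤ ‖a‖ * ‖x - y‖ := by
  rw [a.norm_eq, ← tsum_mul_right]
  simp only [seriesField]
  rw [← (hH.summable a x).tsum_sub (hH.summable a y)]
  refine tsum_of_norm_bounded (a.summable_norm.mul_right _).hasSum fun n => ?_
  rw [← smul_sub, norm_smul]
  exact mul_le_mul_of_nonneg_left (hH.norm_sub_le n x y) (norm_nonneg _)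

/-- In order `k` only the terms with `n ≥ k` need the summable bound `‖a n‖`; the finitely many
others are smooth anyway. -/
theorem contDiff_seriesField (a : SummableSeq) : ContDiff ℝ ∞ (seriesField H a) := by
  refine contDiff_tsum_of_eventually (N := ⊤) (v := fun _ n => ‖a n‖)
    (fun n => (hH.smooth n).const_smul (a n)) (fun _ _ => a.summable_norm) fun k _ => ?_
  rw [Nat.cofinite_eq_atTop]
  filter_upwards [eventually_ge_atTop k] with n hn x
  have h1 : ContDiffAt ℝ k (H n) x := ((hH.smooth n).of_le (by exact_mod_cast le_top)).contDiffAt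
  have h2 : iteratedFDeriv ℝ k (fun x => a n • H n x) x = a n • iteratedFDeriv ℝ k (H n) x :=
    iteratedFDeriv_const_smul_apply h1
  rw [h2, norm_smul]
  exact mul_le_of_le_one_right (norm_nonneg _) (hH.bound n k (hn.trans (Nat.le_succ n)) x)

theorem differentiable_seriesField (a : SummableSeq) : Differentiable ℝ (seriesField H a) :=
  (hH.contDiff_seriesField a).differentiable (by simp)

theorem c1BoundedBy_seriesField {a : SummableSeq} {M : ℝ} (ha : ‖a‖ ≤ M) :
    C1BoundedBy (seriesField H a) M := fun x =>
  ⟨(hH.norm_seriesField_le a x).trans ha, by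
    refine (norm_fderiv_le_of_lip' ℝ (norm_nonneg a)
      (Eventually.of_forall fun y => hH.norm_seriesField_sub_le a y x)).trans ha⟩

end IsPerturbationFamily

end SeriesOfPerturbations

/-! ### Admissible bump fields -/

namespace Network

variable {C : Type u} {A : Type v} {G : Network C A}

namespace InputIso

/-- The inverse of an input isomorphism. -/
def symm {c d : C} (β : G.InputIso c d) : G.InputIso d c where
  nodeType_eq := G.nodeType.symm β.nodeType_eq
  toEquiv := β.toEquiv.symm
  arrowType_eq e := by
    have := β.arrowType_eq (β.toEquiv.symm e)
    rw [Equiv.apply_symm_apply] at this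
    exact G.arrowType.symm this

/-- The composite of two input isomorphisms. -/
def trans {c d i : C} (β : G.InputIso c d) (β' : G.InputIso d i) : G.InputIso c i where
  nodeType_eq := G.nodeType.trans β.nodeType_eq β'.nodeType_eq
  toEquiv := β.toEquiv.trans β'.toEquiv
  arrowType_eq e := G.arrowType.trans (β.arrowType_eq e) (β'.arrowType_eq _)

variable (G) in
/-- The identical input isomorphism. -/
def refl (c : C) : G.InputIso c c where
  nodeType_eq := G.nodeType.refl c
  toEquiv := Equiv.refl _
  arrowType_eq _ := G.arrowType.refl _

theorem ext_toEquiv {c d : C} {β β' : G.InputIso c d} (h : β.toEquiv = β'.toEquiv) : β = β' := by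
  cases β; cases β'; cases h; rfl

instance [Finite A] (c d : C) : Finite (G.InputIso c d) :=
  Finite.of_injective (fun β : G.InputIso c d => β.toEquiv) fun _ _ h => ext_toEquiv h

noncomputable instance [Finite A] (c d : C) : Fintype (G.InputIso c d) := Fintype.ofFinite _

/-- Composition with an input isomorphism permutes the input isomorphisms from a fixed node. -/
def transEquiv {c d : C} (i : C) (β : G.InputIso c d) : G.InputIso i c ≃ G.InputIso i d where
  toFun α := α.trans β
  invFun α := α.trans β.symm
  left_inv α := ext_toEquiv (by ext e; simp [trans, symm])
  right_inv α := ext_toEquiv (by ext e; simp [trans, symm])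

end InputIso

theorem StateEquiv.refl (c : C) : G.StateEquiv c c := Relation.EqvGen.refl c

theorem StateEquiv.trans {c d i : C} (h : G.StateEquiv c d) (h' : G.StateEquiv d i) :
    G.StateEquiv c i := Relation.EqvGen.trans _ _ _ h h'

noncomputable instance [Finite A] (c : C) : Fintype (G.InputSet c) := Fintype.ofFinite _

namespace NodeSpaces

variable (S : G.NodeSpaces)

theorem ident_apply {c d : C} (h : G.StateEquiv c d) (v : S.Space c) (i : Fin (S.dim d)) :
    S.ident h v i = v (Fin.cast (S.dim_eq h).symm i) := rfl

@[simp] theorem ident_refl {c : C} (h : G.StateEquiv c c) (v : S.Space c) : S.ident h v = v := by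
  ext i
  rw [ident_apply]
  rfl

@[simp] theorem ident_ident {c d i : C} (h : G.StateEquiv c d) (h' : G.StateEquiv d i)
    (v : S.Space c) : S.ident h' (S.ident h v) = S.ident (h.trans h') v := by
  ext j
  simp only [ident_apply]
  rfl

theorem ident_eq_iff {c d : C} (h : G.StateEquiv c d) (v : S.Space c) (w : S.Space d) :
    S.ident h v = w ↔ v = S.ident h.symm w := by
  constructor
  · rintro rfl; simp
  · rintro rfl; simp

/-- Admissible maps respect pointwise synchrony of a node and its inputs. -/
theorem IsAdmissible.ident_apply_eq {S : G.NodeSpaces} {f : S.State → S.State}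
    (hf : S.IsAdmissible f) {c d : C} (β : G.InputIso c d) {x y : S.State}
    (h0 : S.ident β.stateEquiv (x c) = y d)
    (h1 : ∀ e, S.ident (β.tail_stateEquiv e) (x (G.tail e.1)) = y (G.tail (β.toEquiv e).1)) :
    S.ident β.stateEquiv (f x c) = f y d := by
  obtain ⟨fhat, hfx, hfp⟩ := hf
  rw [hfx, hfx, ← hfp c d β (y d) fun e => y (G.tail e.1), ← h0]
  congr 2
  funext e
  rw [← h1]
  simp

theorem isAdmissible_tsum {ι : Type*} {H : ι → S.State → S.State} (hH : ∀ n, S.IsAdmissible (H n))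
    (a : ι → ℝ) (hs : ∀ x, Summable fun n => a n • H n x) :
    S.IsAdmissible fun x => ∑' n, a n • H n x := by
  choose Hhat hHx hHp using hH
  refine ⟨fun c w z => ∑' n, a n • Hhat n c w z, fun x c => ?_, fun c d β w z => ?_⟩
  · refine (tsum_apply (hs x)).trans ?_
    simp only [Pi.smul_apply, hHx]
  · have h1 := (S.ident β.stateEquiv).toContinuousLinearEquiv.map_tsum
      (L := SummationFilter.unconditional ι) (f := fun n => a n • Hhat n c (S.ident β.stateEquiv.symm w)
        fun e => S.ident (β.tail_stateEquiv e).symm (z (β.toEquiv e)))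
    simp only [LinearIsometryEquiv.coe_toContinuousLinearEquiv, map_smul, hHp] at h1
    exact h1

theorem IsAdmissible.const_smul {S : G.NodeSpaces} {f : S.State → S.State}
    (hf : S.IsAdmissible f) (a : ℝ) : S.IsAdmissible fun x => a • f x := by
  obtain ⟨fhat, hfx, hfp⟩ := hf
  refine ⟨fun c w z => a • fhat c w z, fun x c => ?_, fun c d β w z => ?_⟩
  · exact congrArg (a • ·) (hfx x c)
  · rw [map_smul, hfp]

variable [Finite A]

/-- The states of a node and of its inputs. -/
abbrev InputState (c : C) : Type v := S.Space c × ∀ e : G.InputSet c, S.Space (G.tail e.1)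

/-- The states of a node and its inputs, pulled back along an input isomorphism. -/
noncomputable def pullState {i c : C} (β : G.InputIso i c) (w : S.Space c)
    (z : ∀ e : G.InputSet c, S.Space (G.tail e.1)) : S.InputState i :=
  (S.ident β.stateEquiv.symm w, fun e => S.ident (β.tail_stateEquiv e).symm (z (β.toEquiv e)))

/-- The states of a node and its inputs, as a part of the state of the network, pulled back along an
input isomorphism. -/
noncomputable def readInput {i c : C} (β : G.InputIso i c) (x : S.State) : S.InputState i :=
  S.pullState β (x c) fun e => x (G.tail e.1)

/-- The admissible map that has, on a node `c`, the value obtained from `φ` and a fixed vector by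
summation over all input isomorphisms to `c` from the given node. -/
noncomputable def symmetrizedField (i : C) (φ : S.InputState i → ℝ) (v : S.Space i) :
    S.State → S.State :=
  fun x c => ∑ β : G.InputIso i c, φ (S.readInput β x) • S.ident β.stateEquiv v

/-- Composition with `β` is a bijection between the index sets `B(i,c)` and `B(i,d)` of the two
sums, which is exactly the pullback condition. -/
theorem symmetrizedField_admissible (i : C) (φ : S.InputState i → ℝ) (v : S.Space i) :
    S.IsAdmissible (S.symmetrizedField i φ v) := by
  refine ⟨fun c w z => ∑ β : G.InputIso i c, φ (S.pullState β w z) • S.ident β.stateEquiv v,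
    fun x c => rfl, fun c d β w z => ?_⟩
  rw [map_sum]
  refine Fintype.sum_equiv (InputIso.transEquiv i β) _ _ fun α => ?_
  rw [map_smul, ident_ident]
  rfl

variable [Fintype C]

/-- `readInput` as a continuous linear map. -/
noncomputable def readInputL {i c : C} (β : G.InputIso i c) : S.State →L[ℝ] S.InputState i :=
  ContinuousLinearMap.prod
    ((S.ident β.stateEquiv.symm : S.Space c →L[ℝ] S.Space i).comp (ContinuousLinearMap.proj c))
    (ContinuousLinearMap.pi fun e =>
      (S.ident (β.tail_stateEquiv e).symm :
        S.Space (G.tail (β.toEquiv e).1) →L[ℝ] S.Space (G.tail e.1)).comp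
        (ContinuousLinearMap.proj (G.tail (β.toEquiv e).1)))

omit [Finite A] [Fintype C] in
theorem readInputL_apply {i c : C} (β : G.InputIso i c) (x : S.State) :
    S.readInputL β x = S.readInput β x := rfl

theorem symmetrizedField_hasBoundedDerivs (i : C) {φ : S.InputState i → ℝ}
    (hφ : HasBoundedDerivs φ) (v : S.Space i) :
    HasBoundedDerivs (S.symmetrizedField i φ v) := by
  classical
  have h1 : S.symmetrizedField i φ v = fun x => ∑ p : (Σ c, G.InputIso i c),
      ((ContinuousLinearMap.toSpanSingleton ℝ
        (Pi.single p.1 (S.ident p.2.stateEquiv v) : S.State)) ∘ (φ ∘ S.readInputL p.2)) x := by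
    funext x c
    rw [Finset.sum_apply, Fintype.sum_sigma, Finset.sum_eq_single c]
    · simp only [Function.comp_apply, ContinuousLinearMap.toSpanSingleton_apply, Pi.smul_apply,
        Pi.single_eq_same, readInputL_apply]
      rfl
    · intro d _ hd
      refine Finset.sum_eq_zero fun β _ => ?_
      simp [Pi.single_eq_of_ne hd.symm]
    · intro h
      exact absurd (Finset.mem_univ c) h
  rw [h1]
  exact HasBoundedDerivs.sum fun p _ => (hφ.comp_clm _).clm_comp _

/-- The bump fields: a countable family of admissible maps that are concentrated near arbitrary
prescribed states of a node and its inputs. -/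
theorem exists_bumpFields [Nonempty C] : ∃ h : ℕ → S.State → S.State,
    (∀ n, HasBoundedDerivs (h n)) ∧ (∀ n, S.IsAdmissible (h n)) ∧
    ∀ (i : C) (P : S.InputState i) (ρ : ℝ), 0 < ρ → ∃ (n : ℕ) (φ : S.InputState i → ℝ)
      (v : S.Space i), h n = S.symmetrizedField i φ v ∧ ‖v‖ = 1 ∧ φ P = 1 ∧
      (∀ z, 0 ≤ φ z ∧ φ z ≤ 1) ∧ ∀ z, ρ ≤ dist z P → φ z = 0 := by
  have hv : ∀ i : C, ∃ v : S.Space i, ‖v‖ = 1 := fun i =>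
    ⟨EuclideanSpace.single ⟨0, S.dim_pos i⟩ 1, by simp⟩
  choose v hv using hv
  have : ∀ i : C, Nonempty (S.InputState i) := fun i => ⟨0⟩
  -- The inner radius is `1/(m+1)`, the outer one `2/(m+1)`. A centre from the dense sequence closer
  -- than `1/(m+1)` to `P` gives the value one at `P`, and zero at distance `3/(m+1)` from `P` and
  -- beyond.
  let bump : ∀ p : C × ℕ × ℕ, ContDiffBump (TopologicalSpace.denseSeq (S.InputState p.1) p.2.1) :=
    fun p => ⟨1 / (p.2.2 + 1), 2 / (p.2.2 + 1), by positivity, by gcongr; norm_num⟩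
  obtain ⟨g, hg⟩ := exists_surjective_nat (C × ℕ × ℕ)
  let fld : C × ℕ × ℕ → S.State → S.State := fun p => S.symmetrizedField p.1 (bump p) (v p.1)
  refine ⟨fun n => fld (g n), fun n => ?_, fun n => ?_, ?_⟩
  · exact S.symmetrizedField_hasBoundedDerivs _
      ((bump (g n)).contDiff.hasBoundedDerivs_of_hasCompactSupport (bump (g n)).hasCompactSupport) _
  · exact S.symmetrizedField_admissible _ _ _
  · intro i P ρ hρ
    obtain ⟨m, hm⟩ := exists_nat_gt (3 / ρ)
    have hm' : 3 / ((m : ℝ) + 1) < ρ := by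
      rw [div_lt_iff₀ hρ] at hm
      rw [div_lt_iff₀ (by positivity)]
      nlinarith
    obtain ⟨j, hj⟩ := (TopologicalSpace.denseRange_denseSeq (S.InputState i)).exists_dist_lt
      P (ε := 1 / ((m : ℝ) + 1)) (by positivity)
    obtain ⟨n, hn⟩ := hg (i, j, m)
    refine ⟨n, bump (i, j, m), v i, congrArg fld hn, hv i, ?_, fun z => ⟨?_, ?_⟩, fun z hz => ?_⟩
    · exact ContDiffBump.one_of_mem_closedBall _ (Metric.mem_closedBall.2 hj.le)
    · exact ContDiffBump.nonneg _
    · exact ContDiffBump.le_one _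
    · refine ContDiffBump.zero_of_le_dist _ ?_
      change 2 / ((m : ℝ) + 1) ≤ _
      have h1 := dist_triangle z (TopologicalSpace.denseSeq (S.InputState i) j) P
      rw [dist_comm] at hj
      have h2 : 3 / ((m : ℝ) + 1) = 2 / (m + 1) + 1 / (m + 1) := by ring
      linarith

end NodeSpaces

end Network

/-! ### Generic perturbations, times and values -/

section Generic

open Set Filter MeasureTheory
open scoped Topology

/-- Finitely many relatively closed conditions are decided, uniformly, on some smaller open set. -/
theorem exists_open_decided {X ι : Type*} [TopologicalSpace X] [Finite ι] {O : Set X} (hO : IsOpen O)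
    (hne : O.Nonempty) (Z : ι → Set X) (hZ : ∀ i, IsOpen (O \ Z i)) :
    ∃ O' ⊆ O, IsOpen O' ∧ O'.Nonempty ∧ ∀ i, O' ⊆ Z i ∨ Disjoint O' (Z i) := by
  classical
  have key : ∀ s : Finset ι, ∃ O' ⊆ O, IsOpen O' ∧ O'.Nonempty ∧
      ∀ i ∈ s, O' ⊆ Z i ∨ Disjoint O' (Z i) := by
    intro s
    induction s using Finset.induction_on with
    | empty => exact ⟨O, Subset.rfl, hO, hne, by simp⟩
    | insert i s _ ih =>
      obtain ⟨O', hO', hopen, hn, h⟩ := ih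
      by_cases hi : O' ⊆ Z i
      · refine ⟨O', hO', hopen, hn, fun j hj => ?_⟩
        rcases Finset.mem_insert.1 hj with rfl | hj
        · exact Or.inl hi
        · exact h j hj
      · have h1 : O' ∩ (O \ Z i) = O' \ Z i := by
          ext x
          simp only [mem_inter_iff, Set.mem_sdiff]
          exact ⟨fun hx => ⟨hx.1, hx.2.2⟩, fun hx => ⟨hx.1, hO' hx.1, hx.2⟩⟩
        refine ⟨O' \ Z i, sdiff_subset.trans hO', h1 ▸ hopen.inter (hZ i), ?_, fun j hj => ?_⟩
        · obtain ⟨x, hx, hx'⟩ := not_subset.1 hi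
          exact ⟨x, hx, hx'⟩
        · rcases Finset.mem_insert.1 hj with rfl | hj
          · exact Or.inr disjoint_sdiff_left
          · exact (h j hj).imp (fun h => sdiff_subset.trans h) fun h => h.mono_left sdiff_subset
  have := Fintype.ofFinite ι
  obtain ⟨O', h1, h2, h3, h4⟩ := key Finset.univ
  exact ⟨O', h1, h2, h3, fun i => h4 i (Finset.mem_univ i)⟩

/-- A curve with nonzero velocity takes values that are attained by given curves on null sets
only. -/
theorem exists_value_attained_on_null_sets {F κ : Type*} [NormedAddCommGroup F] [NormedSpace ℝ F]
    [MeasurableSpace F] [BorelSpace F] [Countable κ] {y : ℝ → F} (hy : Continuous y) {s₀ : ℝ} {y' : F}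
    (hd : HasDerivAt y y' s₀) (hy' : y' ≠ 0) {J : Set ℝ} (hJ : IsOpen J) (hs₀ : s₀ ∈ J)
    {g : κ → ℝ → F} (hg : ∀ k, Continuous (g k)) :
    ∃ s ∈ J, ∀ k, ∀ᵐ r, g k r ≠ y s := by
  -- A measurable curve has at most countably many level sets of positive measure.
  have hB : (⋃ k, {t : F | 0 < volume {r | g k r = t}}).Countable :=
    countable_iUnion fun k => Measure.countable_meas_level_set_pos (hg k).measurable
  obtain ⟨ε, hε, hball⟩ := Metric.isOpen_iff.1 hJ s₀ hs₀
  by_contra! hcon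
  have hsub : y '' Metric.ball s₀ ε ⊆ ⋃ k, {t : F | 0 < volume {r | g k r = t}} := by
    rintro _ ⟨s, hs, rfl⟩
    obtain ⟨k, hk⟩ := hcon s (hball hs)
    refine mem_iUnion.2 ⟨k, ?_⟩
    rw [mem_ofPred_eq, pos_iff_ne_zero]
    refine fun h => hk ?_
    rw [ae_iff]
    simpa using h
  -- If every value near `s₀` were exceptional, this connected image would lie in a countable set,
  -- hence be a point, and the velocity would vanish.
  have hpre : IsPreconnected (y '' Metric.ball s₀ ε) :=
    (convex_ball s₀ ε).isPreconnected.image y hy.continuousOn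
  have hss := hB.isTotallyDisconnected _ hsub hpre
  have hev : y =ᶠ[𝓝 s₀] fun _ => y s₀ := by
    filter_upwards [Metric.ball_mem_nhds s₀ hε] with s hs
    exact hss ⟨s, hs, rfl⟩ ⟨s₀, Metric.mem_ball_self hε, rfl⟩
  exact hy' (hd.unique ((hasDerivAt_const s₀ (y s₀)).congr_of_eventuallyEq hev))

end Generic

/-! ### Response of periodic orbits to perturbations -/

section Response

open Set Filter MeasureTheory intervalIntegral
open scoped Topology

variable {E : Type*} [NormedAddCommGroup E] [NormedSpace ℝ E]

theorem continuous_seriesField_uncurry [CompleteSpace E] {H : ℕ → E → E}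
    (hH : IsPerturbationFamily H) :
    Continuous fun p : SummableSeq × E => seriesField H p.1 p.2 := by
  rw [continuous_iff_continuousAt]
  rintro ⟨a, x⟩
  have h1 : ContinuousAt (fun p : SummableSeq × E => seriesField H (p.1 - a) p.2) (a, x) := by
    have h2 : seriesField H (a - a) x = 0 := by simp [seriesField]
    rw [ContinuousAt, h2]
    refine squeeze_zero_norm (fun p => hH.norm_seriesField_le _ _) ?_
    have : Continuous fun p : SummableSeq × E => ‖p.1 - a‖ := by fun_prop
    simpa using this.tendsto (a, x)
  have h3 : ContinuousAt (fun p : SummableSeq × E => seriesField H a p.2) (a, x) :=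
    ((hH.contDiff_seriesField a).continuous.comp continuous_snd).continuousAt
  refine (h1.add h3).congr (Eventually.of_forall fun p => ?_)
  change seriesField H (p.1 - a) p.2 + seriesField H a p.2 = _
  rw [← Pi.add_apply, ← hH.seriesField_add, sub_add_cancel]

/-- A family of periodic orbits of the perturbations `f + ∑ aₙ Hₙ`, normalized to have period one, that
depends in a Lipschitz way on the perturbation. -/
structure IsOrbitFamily (f : E → E) (H : ℕ → E → E) (δ K : ℝ) (u : SummableSeq → ℝ → E)
    (τ : SummableSeq → ℝ) : Prop where
  nonneg : 0 ≤ K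
  period_pos : ∀ a, ‖a‖ < δ → 0 < τ a
  periodic : ∀ a, ‖a‖ < δ → Function.Periodic (u a) 1
  hasDerivAt : ∀ a, ‖a‖ < δ → ∀ s,
    HasDerivAt (u a) (τ a • (f (u a s) + seriesField H a (u a s))) s
  dist_le : ∀ a b, ‖a‖ < δ → ‖b‖ < δ → ∀ s,
    ‖u a s - u b s‖ ≤ K * ∫ r in (0 : ℝ)..1, ‖seriesField H a (u a r) - seriesField H b (u a r)‖
  period_dist_le : ∀ a b, ‖a‖ < δ → ‖b‖ < δ →
    |τ a - τ b| ≤ K * ∫ r in (0 : ℝ)..1, ‖seriesField H a (u a r) - seriesField H b (u a r)‖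

namespace IsOrbitFamily

variable {f : E → E} {H : ℕ → E → E} {δ K : ℝ} {u : SummableSeq → ℝ → E} {τ : SummableSeq → ℝ}
  (hu : IsOrbitFamily f H δ K u τ)
include hu

theorem continuous {a : SummableSeq} (ha : ‖a‖ < δ) : Continuous (u a) :=
  continuous_iff_continuousAt.2 fun s => (hu.hasDerivAt a ha s).continuousAt

variable [CompleteSpace E] (hH : IsPerturbationFamily H)
include hH

omit hu in
theorem integral_le {a b : SummableSeq} :
    ∫ r in (0 : ℝ)..1, ‖seriesField H a (u a r) - seriesField H b (u a r)‖ ≤ ‖a - b‖ := by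
  have h1 : ∀ r, ‖seriesField H a (u a r) - seriesField H b (u a r)‖ ≤ ‖a - b‖ := fun r => by
    rw [← Pi.sub_apply, ← hH.seriesField_sub]
    exact hH.norm_seriesField_le _ _
  have h2 := intervalIntegral.norm_integral_le_of_norm_le_const (a := (0 : ℝ)) (b := 1)
    (f := fun r => ‖seriesField H a (u a r) - seriesField H b (u a r)‖) (C := ‖a - b‖)
    (fun r _ => by rw [norm_norm]; exact h1 r)
  simp only [sub_zero, abs_one, mul_one] at h2
  exact (le_abs_self _).trans h2

theorem dist_le_norm {a b : SummableSeq} (ha : ‖a‖ < δ) (hb : ‖b‖ < δ) (s : ℝ) :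
    ‖u a s - u b s‖ ≤ K * ‖a - b‖ :=
  (hu.dist_le a b ha hb s).trans (mul_le_mul_of_nonneg_left (integral_le hH) hu.nonneg)

theorem period_dist_le_norm {a b : SummableSeq} (ha : ‖a‖ < δ) (hb : ‖b‖ < δ) :
    |τ a - τ b| ≤ K * ‖a - b‖ :=
  (hu.period_dist_le a b ha hb).trans (mul_le_mul_of_nonneg_left (integral_le hH) hu.nonneg)

theorem continuousOn : ContinuousOn (fun p : SummableSeq × ℝ => u p.1 p.2)
    {p | ‖p.1‖ < δ} := by
  rintro ⟨a, s⟩ ha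
  have ha' : ‖a‖ < δ := ha
  have h1 : Tendsto (fun p : SummableSeq × ℝ => u p.1 p.2 - u a p.2) (𝓝[{p | ‖p.1‖ < δ}] (a, s))
      (𝓝 0) := by
    refine squeeze_zero_norm' (a := fun p : SummableSeq × ℝ => K * ‖p.1 - a‖) ?_ ?_
    · filter_upwards [self_mem_nhdsWithin] with p hp
      exact hu.dist_le_norm hH hp ha' p.2
    · have : Continuous fun p : SummableSeq × ℝ => K * ‖p.1 - a‖ := by fun_prop
      have h2 := (this.tendsto (a, s)).mono_left (nhdsWithin_le_nhds (s := {p | ‖p.1‖ < δ}))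
      simpa using h2
  have h3 : Tendsto (fun p : SummableSeq × ℝ => u a p.2) (𝓝[{p | ‖p.1‖ < δ}] (a, s))
      (𝓝 (u a s)) :=
    (((hu.continuous ha').comp continuous_snd).tendsto (a, s)).mono_left nhdsWithin_le_nhds
  have h4 := h1.add h3
  rw [zero_add] at h4
  exact h4.congr fun p => sub_add_cancel _ _

/-- If a linear functional vanishes on the velocities at two fixed phases for all nearby
perturbations, then its values on the perturbing maps are controlled by the `L¹` norm of these maps
along the orbit. -/
theorem response_bound [FiniteDimensional ℝ E] (hf : ContDiff ℝ 1 f) {B F : Type*} [Fintype B]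
    [NormedAddCommGroup F] [NormedSpace ℝ F] (σ : B → ℝ) (Ψ : (B → E) →L[ℝ] F) {a : SummableSeq}
    (ha : ‖a‖ < δ) : ∃ M : ℝ, ∀ (s : ℝ),
      (∀ᶠ b in 𝓝 a, Ψ (fun i => f (u b (s + σ i)) + seriesField H b (u b (s + σ i))) = 0) →
      ∀ n, ‖Ψ fun i => H n (u a (s + σ i))‖ ≤ M * ∫ r in (0 : ℝ)..1, ‖H n (u a r)‖ := by
  obtain ⟨R, hR⟩ := (hu.periodic a ha).exists_norm_le one_pos (hu.continuous ha)
  let g : E → E := fun x => f x + seriesField H a x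
  have hg : ContDiff ℝ 1 g := hf.add ((hH.contDiff_seriesField a).of_le (by exact_mod_cast le_top))
  -- Changing one coefficient by at most `1` moves the orbit by at most `K`.
  obtain ⟨L, hL⟩ := exists_lipschitz_on_periodic hg (R + K)
  refine ⟨‖Ψ‖ * (L * K), fun s hs n => ?_⟩
  set I := ∫ r in (0 : ℝ)..1, ‖H n (u a r)‖ with hI
  -- Only the `n`-th coefficient varies. The field changes by `t • H n`, while the orbit moves by at
  -- most `K * (t * I)`. Dividing the perturbed relation by `t` therefore bounds `Ψ` on `H n` by a
  -- multiple of `I`, with a factor that depends neither on `n` nor on `s`.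
  let b : ℝ → SummableSeq := fun t => a + lp.single 1 n t
  have hbn : ∀ t, ‖a - b t‖ = |t| := fun t => by
    simp only [b, sub_add_cancel_left, norm_neg]
    rw [lp.norm_single one_pos, Real.norm_eq_abs]
  have hb : Tendsto b (𝓝[>] 0) (𝓝 a) := by
    rw [tendsto_iff_norm_sub_tendsto_zero]
    have h1 : Tendsto (fun t : ℝ => |t|) (𝓝[>] 0) (𝓝 0) := by
      have := (continuous_abs (G := ℝ)).tendsto 0
      rw [abs_zero] at this
      exact this.mono_left nhdsWithin_le_nhds
    refine h1.congr fun t => ?_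
    rw [norm_sub_rev, hbn]
  have hfield : ∀ t, seriesField H (b t) = seriesField H a + t • H n := fun t => by
    simp only [b]
    rw [hH.seriesField_add, IsPerturbationFamily.seriesField_single]
  have hbδ : ∀ᶠ t in 𝓝[>] (0 : ℝ), ‖b t‖ < δ :=
    hb.norm.eventually_lt_const ha
  have hb1 : ∀ᶠ t in 𝓝[>] (0 : ℝ), |t| < 1 := by
    have := (continuous_abs (G := ℝ)).tendsto 0
    rw [abs_zero] at this
    exact (this.mono_left nhdsWithin_le_nhds).eventually_lt_const one_pos
  have h0 : Ψ (fun i => g (u a (s + σ i))) = 0 := hs.self_of_nhds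
  have hmain : ∀ᶠ t in 𝓝[>] (0 : ℝ), ‖Ψ fun i => H n (u (b t) (s + σ i))‖ ≤ ‖Ψ‖ * (L * K) * I := by
    filter_upwards [hb.eventually hs, hbδ, hb1, self_mem_nhdsWithin] with t hst htδ ht1 ht0
    have ht0' : 0 < t := ht0
    have hclose : ∀ r, ‖u a r - u (b t) r‖ ≤ K * (t * I) := by
      intro r
      refine (hu.dist_le a (b t) ha htδ r).trans (le_of_eq (congrArg (K * ·) ?_))
      rw [hI, ← intervalIntegral.integral_const_mul]
      refine intervalIntegral.integral_congr fun r _ => ?_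
      simp only [hfield, Pi.add_apply, Pi.smul_apply, sub_add_cancel_left, norm_neg, norm_smul,
        Real.norm_of_nonneg ht0'.le]
    have hclose' : ∀ r, ‖u (b t) r‖ ≤ R + K := by
      intro r
      have h1 := hu.dist_le_norm hH ha htδ r
      rw [hbn] at h1
      have h2 := norm_sub_norm_le (u (b t) r) (u a r)
      rw [norm_sub_rev] at h2
      have h3 : K * |t| ≤ K := mul_le_of_le_one_right hu.nonneg ht1.le
      linarith [hR r]
    have h1 : Ψ (fun i => f (u (b t) (s + σ i)) + seriesField H (b t) (u (b t) (s + σ i))) =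
        Ψ (fun i => g (u (b t) (s + σ i)) - g (u a (s + σ i))) +
          t • Ψ (fun i => H n (u (b t) (s + σ i))) := by
      rw [← map_smul, ← sub_zero (Ψ fun i => f _ + _), ← h0, ← map_sub, ← map_add]
      congr 1
      funext i
      simp only [g, hfield, Pi.add_apply, Pi.sub_apply, Pi.smul_apply]
      abel
    rw [hst] at h1
    have h2 : ‖t • Ψ (fun i => H n (u (b t) (s + σ i)))‖ ≤ ‖Ψ‖ * (L * (K * (t * I))) := by
      rw [← neg_eq_of_add_eq_zero_right h1.symm, norm_neg]
      have hI0 : 0 ≤ I := intervalIntegral.integral_nonneg zero_le_one fun _ _ => norm_nonneg _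
      refine Ψ.le_opNorm_of_le ?_
      rw [pi_norm_le_iff_of_nonneg (by have := hu.nonneg; positivity)]
      intro i
      refine (hL _ _ (hclose' _) ((hR _).trans (le_add_of_nonneg_right hu.nonneg))).trans ?_
      refine mul_le_mul_of_nonneg_left ?_ L.2
      rw [norm_sub_rev]
      exact hclose _
    rw [norm_smul, Real.norm_of_nonneg ht0'.le] at h2
    have h3 : t * ‖Ψ (fun i => H n (u (b t) (s + σ i)))‖ ≤ t * (‖Ψ‖ * (L * K) * I) := by
      refine h2.trans (le_of_eq ?_)
      ring
    exact le_of_mul_le_mul_left h3 ht0'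
  have hlim : Tendsto (fun t => ‖Ψ fun i => H n (u (b t) (s + σ i))‖) (𝓝[>] 0)
      (𝓝 ‖Ψ fun i => H n (u a (s + σ i))‖) := by
    refine ((Ψ.continuous.tendsto _).comp ?_).norm
    rw [tendsto_pi_nhds]
    intro i
    refine ((hH.smooth n).continuous.tendsto _).comp ?_
    rw [tendsto_iff_norm_sub_tendsto_zero]
    refine squeeze_zero' (g := fun t => K * ‖b t - a‖) (Eventually.of_forall fun _ => norm_nonneg _) ?_ ?_
    · filter_upwards [hbδ] with t ht
      exact hu.dist_le_norm hH ht ha _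
    · have := (tendsto_iff_norm_sub_tendsto_zero.1 hb).const_mul K
      rwa [mul_zero] at this
  exact le_of_tendsto hlim hmain

end IsOrbitFamily

end Response

/-! ### Polydiagonals of several copies of the network, and concentrated bumps -/

namespace Network.NodeSpaces

open Set Filter MeasureTheory intervalIntegral
open scoped Topology

variable {C : Type u} {A : Type v} {G : Network C A} {S : G.NodeSpaces}

theorem IsAdmissible.add {f g : S.State → S.State} (hf : S.IsAdmissible f) (hg : S.IsAdmissible g) :
    S.IsAdmissible fun x => f x + g x := by
  obtain ⟨fhat, hfx, hfp⟩ := hf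
  obtain ⟨ghat, hgx, hgp⟩ := hg
  refine ⟨fun c w z => fhat c w z + ghat c w z, fun x c => ?_, fun c d β w z => ?_⟩
  · exact congrArg₂ (· + ·) (hfx x c) (hgx x c)
  · rw [map_add, hfp, hgp]

/-- The states of two state equivalent nodes agree. -/
def Agrees (S : G.NodeSpaces) {c d : C} (v : S.Space c) (w : S.Space d) : Prop :=
  ∃ h : G.StateEquiv c d, S.ident h v = w

theorem Agrees.refl {c : C} (v : S.Space c) : S.Agrees v v := ⟨StateEquiv.refl c, by simp⟩

theorem Agrees.symm {c d : C} {v : S.Space c} {w : S.Space d} (h : S.Agrees v w) :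
    S.Agrees w v := by
  obtain ⟨h, rfl⟩ := h
  exact ⟨h.symm, by simp⟩

theorem Agrees.trans {c d i : C} {v : S.Space c} {w : S.Space d} {z : S.Space i}
    (h : S.Agrees v w) (h' : S.Agrees w z) : S.Agrees v z := by
  obtain ⟨h, rfl⟩ := h
  obtain ⟨h', rfl⟩ := h'
  exact ⟨h.trans h', by simp⟩

section Polydiagonal

variable {B : Type*} [Fintype C] [Fintype B]

/-- Replacement of every node state by the one of the representative of its colour; the nodes of
several copies of the network are coloured simultaneously. -/
noncomputable def projectRep (S : G.NodeSpaces) (r : Setoid (C × B))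
    (hr : ∀ k l, r k l → G.StateEquiv k.1 l.1) :
    (B → S.State) →L[ℝ] (B → S.State) :=
  ContinuousLinearMap.pi fun b => ContinuousLinearMap.pi fun c =>
    (S.ident (hr _ _ (Quotient.mk_out (s := r) (c, b))) : S.Space _ →L[ℝ] S.Space c).comp
      ((ContinuousLinearMap.proj (Quotient.out (Quotient.mk r (c, b))).1).comp
        (ContinuousLinearMap.proj (Quotient.out (Quotient.mk r (c, b))).2))

variable {r : Setoid (C × B)} {hr : ∀ k l, r k l → G.StateEquiv k.1 l.1}

omit [Fintype C] [Fintype B] in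
theorem projectRep_apply (z : B → S.State) (b : B) (c : C) :
    S.projectRep r hr z b c = S.ident (hr _ _ (Quotient.mk_out (s := r) (c, b)))
      (z (Quotient.out (Quotient.mk r (c, b))).2 (Quotient.out (Quotient.mk r (c, b))).1) := rfl

theorem norm_projectRep_le (z : B → S.State) : ‖S.projectRep r hr z‖ ≤ ‖z‖ := by
  rw [pi_norm_le_iff_of_nonneg (norm_nonneg z)]
  intro b
  rw [pi_norm_le_iff_of_nonneg (norm_nonneg z)]
  intro c
  rw [projectRep_apply, LinearIsometryEquiv.norm_map]
  exact (norm_le_pi_norm _ _).trans (norm_le_pi_norm z _)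

omit [Fintype C] [Fintype B] in
theorem agrees_projectRep (z : B → S.State) {b b' : B} {c d : C} (h : r (c, b) (d, b')) :
    S.Agrees (S.projectRep r hr z b c) (S.projectRep r hr z b' d) := by
  have h1 : Quotient.mk r (c, b) = Quotient.mk r (d, b') := Quotient.sound h
  have key : ∀ q q' : C × B, q = q' → S.Agrees (z q.2 q.1) (z q'.2 q'.1) := by
    rintro q _ rfl
    exact Agrees.refl _
  have h2 : S.Agrees (S.projectRep r hr z b c) (z (Quotient.out (Quotient.mk r (c, b))).2
      (Quotient.out (Quotient.mk r (c, b))).1) := Agrees.symm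
    ⟨hr _ _ (Quotient.mk_out (s := r) (c, b)), rfl⟩
  have h3 : S.Agrees (z (Quotient.out (Quotient.mk r (d, b'))).2
      (Quotient.out (Quotient.mk r (d, b'))).1) (S.projectRep r hr z b' d) :=
    ⟨hr _ _ (Quotient.mk_out (s := r) (d, b')), rfl⟩
  exact (h2.trans (key _ _ (congrArg Quotient.out h1))).trans h3

omit [Fintype C] [Fintype B] in
theorem projectRep_eq_of_agrees (z : B → S.State)
    (h : ∀ b b' c d, r (c, b) (d, b') → S.Agrees (z b c) (z b' d)) : S.projectRep r hr z = z := by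
  funext b c
  obtain ⟨_, h1⟩ := h _ _ _ _ (Quotient.mk_out (s := r) (c, b))
  rw [projectRep_apply]
  exact h1

/-- The polydiagonal of a balanced colouring of several copies of a network is flow-invariant. -/
theorem agrees_of_balanced {g : S.State → S.State} (hg : S.IsAdmissible g)
    (hg1 : ContDiff ℝ 1 g) (hr : ∀ k l, r k l → G.StateEquiv k.1 l.1)
    (hbal : ∀ b b' c d, r (c, b) (d, b') → ∃ β : G.InputIso c d, ∀ e : G.InputSet c,
      r (G.tail e.1, b) (G.tail (β.toEquiv e).1, b'))
    {z : ℝ → B → S.State} {t : ℝ} (hz : ∀ b s, HasDerivAt (fun s => z s b) (t • g (z s b)) s)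
    (hper : Function.Periodic z 1) {s₀ : ℝ}
    (h0 : ∀ b b' c d, r (c, b) (d, b') → S.Agrees (z s₀ b c) (z s₀ b' d)) (s : ℝ)
    {b b' : B} {c d : C} (h : r (c, b) (d, b')) : S.Agrees (z s b c) (z s b' d) := by
  have hzd : ∀ s, HasDerivAt z (fun b => t • g (z s b)) s := fun s =>
    hasDerivAt_pi.2 fun b => hz b s
  have hzc : Continuous z := continuous_iff_continuousAt.2 fun s => (hzd s).continuousAt
  obtain ⟨R, hR⟩ := hper.exists_norm_le one_pos hzc
  obtain ⟨L, hL⟩ := exists_lipschitz_on_periodic hg1 R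
  let π := S.projectRep r hr
  have hinv : ∀ w : B → S.State, π (fun b => t • g (π w b)) = fun b => t • g (π w b) := by
    intro w
    refine projectRep_eq_of_agrees _ fun b b' c d hcd => ?_
    obtain ⟨β, hβ⟩ := hbal b b' c d hcd
    refine ⟨β.stateEquiv, ?_⟩
    rw [Pi.smul_apply, map_smul]
    refine congrArg (t • ·) (hg.ident_apply_eq β ?_ fun e => ?_)
    · exact (agrees_projectRep (hr := hr) w hcd).2
    · exact (agrees_projectRep (hr := hr) w (hβ e)).2
  have hder : ∀ s, HasDerivAt (fun s => z s - π (z s))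
      ((fun b => t • g (z s b)) - π fun b => t • g (z s b)) s := fun s =>
    (hzd s).sub (π.hasFDerivAt.comp_hasDerivAt s (hzd s))
  -- By balance `π` fixes the field at `π z`, so that field may be subtracted: the derivative of `z
  -- - π z` is `D - π D`, where `D` compares the fields at `z` and `π z`. As `π` has norm at most
  -- one, this costs a factor `2`.
  have hbound : ∀ s, ‖(fun b => t • g (z s b)) - π fun b => t • g (z s b)‖ ≤
      2 * (|t| * L) * ‖z s - π (z s)‖ := by
    intro s
    let D : B → S.State := (fun b => t • g (z s b)) - fun b => t • g (π (z s) b)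
    have h1 : ((fun b => t • g (z s b)) - π fun b => t • g (z s b)) = D - π D := by
      simp only [D, map_sub, hinv]
      abel
    have h2 : ‖D‖ ≤ |t| * L * ‖z s - π (z s)‖ := by
      rw [pi_norm_le_iff_of_nonneg (by positivity)]
      intro b
      simp only [D, Pi.sub_apply]
      rw [← smul_sub, norm_smul, Real.norm_eq_abs, mul_assoc]
      refine mul_le_mul_of_nonneg_left ?_ (abs_nonneg t)
      refine (hL _ _ ((norm_le_pi_norm _ b).trans (hR s)) ((norm_le_pi_norm _ b).trans
        ((norm_projectRep_le _).trans (hR s)))).trans ?_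
      exact mul_le_mul_of_nonneg_left (norm_le_pi_norm (z s - π (z s)) b) L.2
    rw [h1]
    refine (norm_sub_le _ _).trans ?_
    have h3 : ‖π D‖ ≤ ‖D‖ := norm_projectRep_le D
    linarith
  have h00 : z s₀ - π (z s₀) = 0 := by
    rw [sub_eq_zero]
    exact (projectRep_eq_of_agrees _ h0).symm
  have hzero := eq_zero_of_periodic_of_norm_deriv_le hder hbound one_pos
    (fun s => by simp only [hper s]) h00 s
  have h1 : z s = π (z s) := sub_eq_zero.1 hzero
  rw [h1]
  exact agrees_projectRep (hr := hr) _ h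

end Polydiagonal

section Concentration

variable [Finite A] [Fintype C]

theorem norm_symmetrizedField_le (i : C) {φ : S.InputState i → ℝ} {v : S.Space i} (hv : ‖v‖ = 1)
    (hφ : ∀ z, 0 ≤ φ z ∧ φ z ≤ 1) (x : S.State) :
    ‖S.symmetrizedField i φ v x‖ ≤ ∑ c, (Fintype.card (G.InputIso i c) : ℝ) := by
  rw [pi_norm_le_iff_of_nonneg (by positivity)]
  intro c
  have h1 : ‖S.symmetrizedField i φ v x c‖ ≤ ∑ _β : G.InputIso i c, (1 : ℝ) := by
    refine norm_sum_le_of_le _ fun β _ => ?_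
    rw [norm_smul, LinearIsometryEquiv.norm_map, hv, mul_one, Real.norm_of_nonneg (hφ _).1]
    exact (hφ _).2
  refine h1.trans ?_
  rw [Finset.sum_const, nsmul_eq_mul, mul_one]
  exact Finset.single_le_sum (f := fun c => (Fintype.card (G.InputIso i c) : ℝ))
    (fun c _ => Nat.cast_nonneg _) (Finset.mem_univ c)

/-- The characteristic property of the bump fields. -/
def IsBumpFamily (S : G.NodeSpaces) (h : ℕ → S.State → S.State) : Prop :=
  ∀ (i : C) (P : S.InputState i) (ρ : ℝ), 0 < ρ → ∃ (n : ℕ) (φ : S.InputState i → ℝ)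
      (v : S.Space i), h n = S.symmetrizedField i φ v ∧ ‖v‖ = 1 ∧ φ P = 1 ∧
      (∀ z, 0 ≤ φ z ∧ φ z ≤ 1) ∧ ∀ z, ρ ≤ dist z P → φ z = 0

/-- Bump fields around a value that is attained on null sets only are small in `L¹`. -/
theorem IsBumpFamily.exists_integral_lt {h : ℕ → S.State → S.State} (hB : S.IsBumpFamily h)
    (hc : ∀ n, Continuous (h n)) {y : ℝ → S.State} (hy : Continuous y) {i : C} {P : S.InputState i}
    (hP : ∀ (c : C) (β : G.InputIso i c), ∀ᵐ r, S.readInput β (y r) ≠ P) {ρ η : ℝ} (hρ : 0 < ρ)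
    (hη : 0 < η) : ∃ (n : ℕ) (φ : S.InputState i → ℝ) (v : S.Space i),
      h n = S.symmetrizedField i φ v ∧ ‖v‖ = 1 ∧ φ P = 1 ∧ (∀ z, 0 ≤ φ z ∧ φ z ≤ 1) ∧
      (∀ z, ρ ≤ dist z P → φ z = 0) ∧ ∫ r in (0 : ℝ)..1, ‖h n (y r)‖ < η := by
  -- With shrinking radii the fields stay bounded and eventually vanish at each time when no pulled
  -- back input state equals `P`, so dominated convergence applies.
  have hrad : ∀ m : ℕ, 0 < min ρ (1 / ((m : ℝ) + 1)) := fun m => lt_min hρ (by positivity)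
  choose n φ v hn hv hφP hφ hφ0 using fun m : ℕ => hB i P _ (hrad m)
  have hlim : Tendsto (fun m => ∫ r in (0 : ℝ)..1, ‖h (n m) (y r)‖) atTop
      (𝓝 (∫ _r in (0 : ℝ)..1, (0 : ℝ))) := by
    refine intervalIntegral.tendsto_integral_filter_of_dominated_convergence
      (fun _ => ∑ c, (Fintype.card (G.InputIso i c) : ℝ)) ?_ ?_ ?_ ?_
    · exact Eventually.of_forall fun m => ((hc (n m)).comp hy).norm.aestronglyMeasurable
    · refine Eventually.of_forall fun m => Eventually.of_forall fun r _ => ?_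
      rw [norm_norm, hn]
      exact norm_symmetrizedField_le i (hv m) (hφ m) _
    · exact intervalIntegrable_const
    · have hall : ∀ᵐ r, ∀ p : (Σ c, G.InputIso i c), S.readInput p.2 (y r) ≠ P :=
        ae_all_iff.2 fun p => hP p.1 p.2
      filter_upwards [hall] with r hr _
      have hev : ∀ᶠ m : ℕ in atTop, ∀ p : (Σ c, G.InputIso i c),
          1 / ((m : ℝ) + 1) < dist (S.readInput p.2 (y r)) P :=
        eventually_all.2 fun p =>
          tendsto_one_div_add_atTop_nhds_zero_nat.eventually_lt_const (dist_pos.2 (hr p))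
      refine tendsto_const_nhds.congr' ?_
      filter_upwards [hev] with m hm
      have : S.symmetrizedField i (φ m) (v m) (y r) = 0 := by
        funext c
        refine Finset.sum_eq_zero fun β _ => ?_
        rw [hφ0 m _ ((min_le_right _ _).trans (hm ⟨c, β⟩).le), zero_smul]
      rw [hn, this, norm_zero]
  rw [intervalIntegral.integral_zero] at hlim
  obtain ⟨m, hm⟩ := (hlim.eventually_lt_const hη).exists
  exact ⟨n m, φ m, v m, hn m, hv m, hφP m, hφ m,
    fun z hz => hφ0 m z ((min_le_left _ _).trans hz), hm⟩

variable {f : S.State → S.State} {h : ℕ → S.State → S.State} {w : ℕ → ℝ} {δ K : ℝ}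
  {u : SummableSeq → ℝ → S.State} {τ : SummableSeq → ℝ}

/-- A linear relation between the velocities at two phases that is satisfied for all perturbations
cannot detect bump fields. -/
theorem false_of_velocity_relation (hu : IsOrbitFamily f (fun n x => w n • h n x) δ K u τ)
    (hH : IsPerturbationFamily fun n x => w n • h n x) (hw : ∀ n, 0 < w n)
    (hf : ContDiff ℝ 1 f) (hB : S.IsBumpFamily h) (hc : ∀ n, Continuous (h n))
    {B F : Type*} [Fintype B] [NormedAddCommGroup F] [NormedSpace ℝ F] (σ : B → ℝ)
    (Ψ : (B → S.State) →L[ℝ] F) {a : SummableSeq} (ha : ‖a‖ < δ) {s : ℝ}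
    (hΨ : ∀ᶠ b in 𝓝 a, Ψ (fun i => f (u b (s + σ i)) +
      seriesField (fun n x => w n • h n x) b (u b (s + σ i))) = 0)
    {i : C} {P : S.InputState i}
    (hP : ∀ (c : C) (β : G.InputIso i c), ∀ᵐ r, S.readInput β (u a r) ≠ P) {ρ : ℝ} (hρ : 0 < ρ)
    (hlow : ∀ (φ : S.InputState i → ℝ) (v : S.Space i), ‖v‖ = 1 → φ P = 1 →
      (∀ z, 0 ≤ φ z ∧ φ z ≤ 1) → (∀ z, ρ ≤ dist z P → φ z = 0) →
      1 ≤ ‖Ψ fun i' => S.symmetrizedField i φ v (u a (s + σ i'))‖) : False := by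
  obtain ⟨M, hM⟩ := hu.response_bound hH hf σ Ψ ha
  -- `M` does not depend on the bump, so the bump may be chosen after it. The weight `w n` cancels,
  -- and `1 ≤ M * ∫ ‖h n‖ < 1` results.
  obtain ⟨n, φ, v, hn, hv, hφP, hφ, hφ0, hint⟩ := hB.exists_integral_lt hc (hu.continuous ha) hP hρ
    (η := 1 / (|M| + 1)) (by positivity)
  have h1 := hM s hΨ n
  have h2 : (fun i' => w n • h n (u a (s + σ i'))) = w n • fun i' => h n (u a (s + σ i')) := rfl
  rw [h2, map_smul, norm_smul, Real.norm_of_nonneg (hw n).le] at h1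
  have h3 : ∫ r in (0 : ℝ)..1, ‖w n • h n (u a r)‖ = w n * ∫ r in (0 : ℝ)..1, ‖h n (u a r)‖ := by
    rw [← intervalIntegral.integral_const_mul]
    refine intervalIntegral.integral_congr fun r _ => ?_
    simp only [norm_smul, Real.norm_of_nonneg (hw n).le]
  rw [h3, mul_left_comm] at h1
  have h4 := le_of_mul_le_mul_left h1 (hw n)
  have h5 := hlow φ v hv hφP hφ hφ0
  rw [← hn] at h5
  set I := ∫ r in (0 : ℝ)..1, ‖h n (u a r)‖ with hI
  have hI0 : 0 ≤ I := intervalIntegral.integral_nonneg zero_le_one fun _ _ => norm_nonneg _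
  rw [lt_div_iff₀ (by positivity)] at hint
  have h6 : M * I ≤ |M| * I := mul_le_mul_of_nonneg_right (le_abs_self M) hI0
  linarith

end Concentration

end Network.NodeSpaces

/-! ### The generic pattern of agreements is balanced -/

namespace Network.NodeSpaces

open Set Filter MeasureTheory intervalIntegral
open scoped Topology

variable {C : Type u} {A : Type v} {G : Network C A} {S : G.NodeSpaces} [Finite A] [Fintype C]
  {f : S.State → S.State} {h : ℕ → S.State → S.State} {w : ℕ → ℝ} {δ K : ℝ}
  {u : SummableSeq → ℝ → S.State} {τ : SummableSeq → ℝ}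

omit [Finite A] [Fintype C] in
theorem readInput_refl (i : C) (x : S.State) :
    S.readInput (InputIso.refl G i) x = (x i, fun e : G.InputSet i => x (G.tail e.1)) :=
  Prod.ext (S.ident_refl _ _) (funext fun _ => S.ident_refl _ _)

omit [Fintype C] in
theorem symmetrizedField_apply_self (i : C) (φ : S.InputState i → ℝ) (v : S.Space i) (x : S.State) :
    S.symmetrizedField i φ v x i = (∑ β : G.InputIso i i, φ (S.readInput β x)) • v := by
  rw [Finset.sum_smul]
  exact Finset.sum_congr rfl fun β _ => by rw [ident_refl]

omit [Fintype C] in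
-- The identity of `I(i)` contributes one, and the other terms are nonnegative multiples of the same
-- vector, so nothing cancels.
theorem one_le_norm_symmetrizedField (i : C) {φ : S.InputState i → ℝ} {v : S.Space i}
    (hv : ‖v‖ = 1) (hφ : ∀ z, 0 ≤ φ z ∧ φ z ≤ 1) {x : S.State}
    (hx : φ (S.readInput (InputIso.refl G i) x) = 1) : 1 ≤ ‖S.symmetrizedField i φ v x i‖ := by
  rw [symmetrizedField_apply_self, norm_smul, hv, mul_one, Real.norm_of_nonneg
    (Finset.sum_nonneg fun β _ => (hφ _).1), ← hx]
  exact Finset.single_le_sum (f := fun β : G.InputIso i i => φ (S.readInput β x))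
    (fun β _ => (hφ _).1) (Finset.mem_univ _)

omit [Finite A] in
/-- Some value of a moving node or of an input of it is attained on null sets only. -/
theorem exists_readInput_attained_on_null_sets {y : ℝ → S.State} (hy : Continuous y) {i l : C}
    (hl : l = i ∨ ∃ e : G.InputSet i, l = G.tail e.1) {σ s₀ : ℝ} {y' : S.Space l}
    (hd : HasDerivAt (fun s => y s l) y' (s₀ + σ)) (hy' : y' ≠ 0) {J : Set ℝ} (hJ : IsOpen J)
    (hs₀ : s₀ ∈ J) : ∃ s ∈ J, ∀ (c : C) (β : G.InputIso i c),
      ∀ᵐ r, S.readInput β (y r) ≠ S.readInput (InputIso.refl G i) (y (s + σ)) := by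
  have hd' : HasDerivAt (fun s => y (s + σ) l) y' s₀ := hd.comp_add_const s₀ σ
  have hyc : ∀ c, Continuous fun s => y s c := fun c => (continuous_apply c).comp hy
  -- A coincidence of input states makes some node that is state equivalent to `l` take the value of
  -- `l`. There are finitely many such curves.
  obtain ⟨s, hs, hsr⟩ := exists_value_attained_on_null_sets
    (κ := {j : C // G.StateEquiv j l}) (g := fun j r => S.ident j.2 (y r j.1))
    ((hyc l).comp (continuous_id.add continuous_const)) hd' hy' hJ hs₀
    (fun j => (S.ident j.2).continuous.comp (hyc j.1))
  refine ⟨s, hs, fun c β => ?_⟩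
  rcases hl with rfl | ⟨e, rfl⟩
  · filter_upwards [hsr ⟨c, β.stateEquiv.symm⟩] with r hr heq
    refine hr ?_
    rw [readInput_refl] at heq
    exact congrArg Prod.fst heq
  · filter_upwards [hsr ⟨G.tail (β.toEquiv e).1, (β.tail_stateEquiv e).symm⟩] with r hr heq
    refine hr ?_
    rw [readInput_refl] at heq
    exact congrFun (congrArg Prod.snd heq) e

/-- If every nearby perturbed orbit has an agreement of a node at one phase with a node at
another phase, then for some of them the inputs of these nodes agree as well. -/
theorem exists_inputIso_agrees (hG : G.IsTransitive)
    (hu : IsOrbitFamily f (fun n x => w n • h n x) δ K u τ)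
    (hH : IsPerturbationFamily fun n x => w n • h n x) (hw : ∀ n, 0 < w n)
    (hf : ContDiff ℝ 1 f) (hfa : S.IsAdmissible f) (hB : S.IsBumpFamily h)
    (hc : ∀ n, Continuous (h n)) (ha : ∀ n, S.IsAdmissible (h n)) {B : Type} [Fintype B] (σ : B → ℝ)
    {W : Set SummableSeq} (hW : IsOpen W) (hWne : W.Nonempty) (hWδ : ∀ a ∈ W, ‖a‖ < δ)
    (hne : ∀ a ∈ W, ∀ s, f (u a s) + seriesField (fun n x => w n • h n x) a (u a s) ≠ 0)
    {c d : C} {b b' : B} (hcd : ∀ a ∈ W, ∀ s, S.Agrees (u a (s + σ b) c) (u a (s + σ b') d)) :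
    ∃ a ∈ W, ∃ β : G.InputIso c d, ∀ (e : G.InputSet c) (s : ℝ),
      S.Agrees (u a (s + σ b) (G.tail e.1)) (u a (s + σ b') (G.tail (β.toEquiv e).1)) := by
  classical
  set H : ℕ → S.State → S.State := fun n x => w n • h n x with hHdef
  let g : SummableSeq → S.State → S.State := fun a x => f x + seriesField H a x
  have hgc : Continuous fun p : SummableSeq × S.State => g p.1 p.2 :=
    (hf.continuous.comp continuous_snd).add (continuous_seriesField_uncurry hH)
  have hgadm : ∀ a, S.IsAdmissible (g a) := fun a =>
    hfa.add (S.isAdmissible_tsum (fun n => (ha n).const_smul (w n)) a fun x => hH.summable a x)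
  have hg1 : ∀ a, ContDiff ℝ 1 (g a) := fun a =>
    hf.add ((hH.contDiff_seriesField a).of_le (by exact_mod_cast le_top))
  let O : Set (SummableSeq × ℝ) := W ×ˢ univ
  have hO : IsOpen O := hW.prod isOpen_univ
  have huO : ∀ r : ℝ, ContinuousOn (fun p : SummableSeq × ℝ => u p.1 (p.2 + r)) O := by
    intro r
    refine (hu.continuousOn hH).comp (f := fun p : SummableSeq × ℝ => (p.1, p.2 + r))
      (by fun_prop) ?_
    intro p hp
    exact hWδ _ hp.1
  have hgO : ∀ r : ℝ, ContinuousOn (fun p : SummableSeq × ℝ => g p.1 (u p.1 (p.2 + r))) O :=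
    fun r => hgc.comp_continuousOn (continuous_fst.continuousOn.prodMk (huO r))
  -- Conditions on perturbation and time jointly: agreements of nodes at two phases, and vanishing
  -- of node velocities. All are relatively closed, so on some smaller open set `O'` the whole
  -- pattern is constant.
  let Z : ((C × B) × (C × B)) ⊕ (C × B) → Set (SummableSeq × ℝ) := Sum.elim
    (fun kl => {p | S.Agrees (u p.1 (p.2 + σ kl.1.2) kl.1.1) (u p.1 (p.2 + σ kl.2.2) kl.2.1)})
    (fun k => {p | g p.1 (u p.1 (p.2 + σ k.2)) k.1 = 0})
  have hZ : ∀ k, IsOpen (O \ Z k) := by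
    rintro (⟨⟨i, b₁⟩, ⟨j, b₂⟩⟩ | ⟨i, b₁⟩)
    · by_cases hij : G.StateEquiv i j
      · have h1 : O \ Z (Sum.inl ((i, b₁), (j, b₂))) = O ∩ (fun p : SummableSeq × ℝ =>
            S.ident hij (u p.1 (p.2 + σ b₁) i) - u p.1 (p.2 + σ b₂) j) ⁻¹' {0}ᶜ := by
          ext p
          simp only [Set.mem_sdiff, mem_inter_iff, mem_preimage, mem_compl_iff, mem_singleton_iff,
            sub_eq_zero, Z, Sum.elim_inl, mem_ofPred_eq]
          refine and_congr_right fun _ => not_congr ⟨fun h => h.2, fun h => ⟨hij, h⟩⟩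
        rw [h1]
        refine ContinuousOn.isOpen_inter_preimage ?_ hO isOpen_compl_singleton
        exact ((S.ident hij).continuous.comp_continuousOn
          ((continuous_apply i).comp_continuousOn (huO _))).sub
          ((continuous_apply j).comp_continuousOn (huO _))
      · have h1 : O \ Z (Sum.inl ((i, b₁), (j, b₂))) = O := by
          refine sdiff_eq_left.2 (Set.disjoint_left.2 fun p _ hp => hij ?_)
          exact hp.1
        rw [h1]
        exact hO
    · have h1 : O \ Z (Sum.inr (i, b₁)) = O ∩ (fun p : SummableSeq × ℝ =>
          g p.1 (u p.1 (p.2 + σ b₁)) i) ⁻¹' {0}ᶜ := by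
        ext p
        simp only [Set.mem_sdiff, mem_inter_iff, mem_preimage, mem_compl_iff, mem_singleton_iff,
          Z, Sum.elim_inr, mem_ofPred_eq]
      rw [h1]
      exact ContinuousOn.isOpen_inter_preimage
        ((continuous_apply i).comp_continuousOn (hgO _)) hO isOpen_compl_singleton
  obtain ⟨O', hO'O, hO', ⟨⟨a, s₀⟩, hp⟩, hdec⟩ := exists_open_decided hO
    (hWne.prod univ_nonempty) Z hZ
  have haW : a ∈ W := (hO'O hp).1
  have haδ := hWδ a haW
  obtain ⟨W', hW', J₀, hJ₀, hWJ⟩ := mem_nhds_prod_iff.1 (hO'.mem_nhds hp)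
  obtain ⟨J, hJJ₀, hJ, hs₀J⟩ := mem_nhds_iff.1 hJ₀
  have hmem : ∀ a' ∈ W', ∀ s ∈ J, (a', s) ∈ O' := fun a' ha' s hs =>
    hWJ ⟨ha', hJJ₀ hs⟩
  have haW' : a ∈ W' := mem_of_mem_nhds hW'
  have hderiv : ∀ s (i : C), HasDerivAt (fun s => u a s i) (τ a • g a (u a s) i) s := fun s i =>
    (hasDerivAt_pi.1 (hu.hasDerivAt a haδ s)) i
  have hτ := hu.period_pos a haδ
  -- no node velocity vanishes
  have hinput : ∀ (i : C) (b₁ : B), (∀ p ∈ O', p ∈ Z (Sum.inr (i, b₁))) → ∀ e : G.InputSet i,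
      ∀ p ∈ O', p ∈ Z (Sum.inr (G.tail e.1, b₁)) := by
    intro i b₁ hi e
    rcases hdec (Sum.inr (G.tail e.1, b₁)) with h1 | h1
    · exact fun p hp => h1 hp
    exfalso
    have hnz : g a (u a (s₀ + σ b₁)) (G.tail e.1) ≠ 0 := fun h2 =>
      Set.disjoint_left.1 h1 hp (by simpa only [Z, Sum.elim_inr, mem_ofPred_eq] using h2)
    -- When the moving input takes a rare value, a bump at the input state of `i` would set `i` in
    -- motion, although `i` is at rest for all nearby perturbations.
    obtain ⟨s, hs, hsP⟩ := exists_readInput_attained_on_null_sets (i := i) (hu.continuous haδ)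
      (Or.inr ⟨e, rfl⟩) (hderiv (s₀ + σ b₁) (G.tail e.1)) (smul_ne_zero hτ.ne' hnz) hJ hs₀J
    refine false_of_velocity_relation hu hH hw hf hB hc σ
      ((ContinuousLinearMap.proj (R := ℝ) (φ := fun c => S.Space c) i).comp
        (ContinuousLinearMap.proj (R := ℝ) (φ := fun _ : B => S.State) b₁))
      haδ (s := s) ?_ hsP one_pos ?_
    · filter_upwards [hW'] with a' ha'
      have := hi (a', s) (hmem a' ha' s hs)
      simp only [Z, Sum.elim_inr, mem_ofPred_eq] at this
      exact this
    · intro φ v hv hφP hφ _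
      exact one_le_norm_symmetrizedField i hv hφ hφP
  have hmoving : ∀ (i : C) (b₁ : B), g a (u a (s₀ + σ b₁)) i ≠ 0 := by
    intro i b₁ hi
    have hi' : ∀ p ∈ O', p ∈ Z (Sum.inr (i, b₁)) := by
      rcases hdec (Sum.inr (i, b₁)) with h1 | h1
      · exact fun p hp => h1 hp
      · exact absurd (show (a, s₀) ∈ Z (Sum.inr (i, b₁)) by
          simpa only [Z, Sum.elim_inr, mem_ofPred_eq] using hi) (Set.disjoint_left.1 h1 hp)
    -- Rest spreads backwards along arrows, so by transitivity one resting node makes the state an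
    -- equilibrium.
    refine hne a haW (s₀ + σ b₁) (funext fun j => ?_)
    have hj : ∀ p ∈ O', p ∈ Z (Sum.inr (j, b₁)) := by
      refine Relation.ReflTransGen.head_induction_on (motive := fun j _ =>
        ∀ p ∈ O', p ∈ Z (Sum.inr (j, b₁))) (hG j i) hi' ?_
      rintro j k ⟨e, rfl, rfl⟩ _ hk
      exact hinput _ b₁ hk ⟨e, rfl⟩
    have := hj _ hp
    simp only [Z, Sum.elim_inr, mem_ofPred_eq] at this
    exact this
  -- the pattern of agreements is balanced
  have hdecA : ∀ (i j : C) (b₁ b₂ : B), S.Agrees (u a (s₀ + σ b₁) i) (u a (s₀ + σ b₂) j) →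
      ∀ a' ∈ W', ∀ s ∈ J, S.Agrees (u a' (s + σ b₁) i) (u a' (s + σ b₂) j) := by
    intro i j b₁ b₂ hij a' ha' s hs
    rcases hdec (Sum.inl ((i, b₁), (j, b₂))) with h1 | h1
    · exact h1 (hmem a' ha' s hs)
    · exact absurd hij (Set.disjoint_left.1 h1 hp)
  have hdecN : ∀ (i j : C) (b₁ b₂ : B), ¬ S.Agrees (u a (s₀ + σ b₁) i) (u a (s₀ + σ b₂) j) →
      ∀ a' ∈ W', ∀ s ∈ J, ¬ S.Agrees (u a' (s + σ b₁) i) (u a' (s + σ b₂) j) := by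
    intro i j b₁ b₂ hij a' ha' s hs hag
    rcases hdec (Sum.inl ((i, b₁), (j, b₂))) with h1 | h1
    · exact hij (h1 hp)
    · exact Set.disjoint_left.1 h1 (hmem a' ha' s hs) hag
  let r : Setoid (C × B) :=
    { r := fun k l => S.Agrees (u a (s₀ + σ k.2) k.1) (u a (s₀ + σ l.2) l.1)
      iseqv := ⟨fun _ => Agrees.refl _, fun h => h.symm, fun h h' => h.trans h'⟩ }
  have hbal : ∀ b₁ b₂ i j, r (i, b₁) (j, b₂) → ∃ β : G.InputIso i j, ∀ e : G.InputSet i,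
      r (G.tail e.1, b₁) (G.tail (β.toEquiv e).1, b₂) := by
    intro b₁ b₂ i j hij
    -- If no input isomorphism matches the inputs, the input state of `i` differs from every pulled
    -- back input state of `j`. A narrow bump there acts on `i` but not on `j`, while the agreement
    -- on a time interval forces equal velocities for all nearby perturbations.
    by_contra! hcon
    have hij' : S.Agrees (u a (s₀ + σ b₁) i) (u a (s₀ + σ b₂) j) := hij
    have hst : G.StateEquiv i j := hij'.1
    obtain ⟨s, hs, hsP⟩ := exists_readInput_attained_on_null_sets (i := i) (hu.continuous haδ)
      (Or.inl rfl) (hderiv (s₀ + σ b₁) i) (smul_ne_zero hτ.ne' (hmoving i b₁)) hJ hs₀J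
    set P := S.readInput (InputIso.refl G i) (u a (s + σ b₁)) with hPdef
    have hfar : ∀ β : G.InputIso i j, S.readInput β (u a (s + σ b₂)) ≠ P := by
      intro β heq
      obtain ⟨e, he⟩ := hcon β
      refine hdecN _ _ _ _ he a haW' s hs ?_
      rw [hPdef, readInput_refl] at heq
      refine ⟨β.tail_stateEquiv e, ?_⟩
      rw [ident_eq_iff]
      exact (congrFun (congrArg Prod.snd heq) e).symm
    obtain ⟨ρ, hρ, hρP⟩ : ∃ ρ > 0, ∀ β : G.InputIso i j,
        ρ ≤ dist (S.readInput β (u a (s + σ b₂))) P := by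
      have hfin : ∀ᶠ ρ : ℝ in 𝓝[>] 0, ∀ β : G.InputIso i j,
          ρ < dist (S.readInput β (u a (s + σ b₂))) P :=
        eventually_all.2 fun β => nhdsWithin_le_nhds (Iio_mem_nhds (dist_pos.2 (hfar β)))
      obtain ⟨ρ, h1, h2⟩ := (hfin.and self_mem_nhdsWithin).exists
      exact ⟨ρ, h2, fun β => (h1 β).le⟩
    refine false_of_velocity_relation hu hH hw hf hB hc σ
      (((S.ident hst : S.Space i →L[ℝ] S.Space j).comp
        ((ContinuousLinearMap.proj (R := ℝ) (φ := fun c => S.Space c) i).comp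
        (ContinuousLinearMap.proj (R := ℝ) (φ := fun _ : B => S.State) b₁))) -
        (ContinuousLinearMap.proj (R := ℝ) (φ := fun c => S.Space c) j).comp
        (ContinuousLinearMap.proj (R := ℝ) (φ := fun _ : B => S.State) b₂))
      haδ (s := s) ?_ hsP hρ ?_
    · filter_upwards [hW', hW.mem_nhds haW] with a' ha' ha'W
      have ha'δ := hWδ a' ha'W
      have hder1 : HasDerivAt (fun s => S.ident hst (u a' (s + σ b₁) i))
          (S.ident hst (τ a' • g a' (u a' (s + σ b₁)) i)) s := by
        have h1 := (hasDerivAt_pi.1 (hu.hasDerivAt a' ha'δ (s + σ b₁))) i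
        have h2 : HasDerivAt (fun s => u a' (s + σ b₁) i)
            (τ a' • g a' (u a' (s + σ b₁)) i) s := by
          exact h1.comp_add_const s (σ b₁)
        exact (S.ident hst : S.Space i →L[ℝ] S.Space j).hasFDerivAt.comp_hasDerivAt s h2
      have hder2 : HasDerivAt (fun s => u a' (s + σ b₂) j)
          (τ a' • g a' (u a' (s + σ b₂)) j) s := by
        have h1 := (hasDerivAt_pi.1 (hu.hasDerivAt a' ha'δ (s + σ b₂))) j
        exact h1.comp_add_const s (σ b₂)
      have hev : (fun s => S.ident hst (u a' (s + σ b₁) i)) =ᶠ[𝓝 s]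
          fun s => u a' (s + σ b₂) j := by
        filter_upwards [hJ.mem_nhds hs] with s' hs'
        exact (hdecA i j b₁ b₂ hij' a' ha' s' hs').2
      have heq := hder1.unique (hder2.congr_of_eventuallyEq hev)
      rw [map_smul] at heq
      have heq' := smul_right_injective _ (hu.period_pos a' ha'δ).ne' heq
      change S.ident hst (g a' (u a' (s + σ b₁)) i) - g a' (u a' (s + σ b₂)) j = 0
      rw [heq', sub_self]
    · intro φ v hv hφP hφ hφ0
      change 1 ≤ ‖S.ident hst (S.symmetrizedField i φ v (u a (s + σ b₁)) i) -
        S.symmetrizedField i φ v (u a (s + σ b₂)) j‖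
      have h1 : S.symmetrizedField i φ v (u a (s + σ b₂)) j = 0 :=
        Finset.sum_eq_zero fun β _ => by rw [hφ0 _ (hρP β), zero_smul]
      rw [h1, sub_zero, LinearIsometryEquiv.norm_map]
      exact one_le_norm_symmetrizedField i hv hφ hφP
  have hrcd : r (c, b) (d, b') := hcd a haW s₀
  obtain ⟨β, hβ⟩ := hbal b b' c d hrcd
  -- The pattern was read off at the single time `s₀`; invariance of its polydiagonal gives it at
  -- all times.
  refine ⟨a, haW, β, fun e s => ?_⟩
  refine agrees_of_balanced (z := fun s b => u a (s + σ b)) (t := τ a) (hgadm a) (hg1 a)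
    (r := r) (fun k l hkl => hkl.1) hbal (fun b₁ s => ?_) (fun s => ?_) (s₀ := s₀)
    (fun _ _ _ _ h => h) s (hβ e)
  · exact (hu.hasDerivAt a haδ (s + σ b₁)).comp_add_const s (σ b₁)
  · funext b₁
    change u a (s + 1 + σ b₁) = u a (s + σ b₁)
    rw [add_right_comm]
    exact hu.periodic a haδ _

end Network.NodeSpaces

/-! ### The family of orbits through a hyperbolic periodic orbit -/

section OrbitFamily

open Set Filter MeasureTheory
open scoped Topology

variable {E : Type*} [NormedAddCommGroup E] [NormedSpace ℝ E] [FiniteDimensional ℝ E]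
  {f : E → E} {x : ℝ → E} {T : ℝ} {H : ℕ → E → E}

omit [FiniteDimensional ℝ E] in
theorem seriesField_zero : seriesField H 0 = 0 := by
  funext y
  simp [seriesField]

theorem exists_isOrbitFamily (hf : ContDiff ℝ 1 f) (hx : IsHyperbolicPeriodicOrbit f x T)
    (hH : IsPerturbationFamily H) : ∃ δ > 0, ∃ K, ∃ (u : SummableSeq → ℝ → E) (τ : SummableSeq → ℝ),
      IsOrbitFamily f H δ K u τ ∧ (∀ s, u 0 s = x (T * s)) ∧ τ 0 = T := by
  obtain ⟨δ, hδ, K, hK, U, τ, hU0, hτ0, h⟩ := hyperbolic_persistence hf hx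
  have hd := hH.differentiable_seriesField
  have hb : ∀ a : SummableSeq, ‖a‖ < δ → C1BoundedBy (seriesField H a) δ := fun a ha =>
    hH.c1BoundedBy_seriesField ha.le
  refine ⟨δ, hδ, K, fun a => U (seriesField H a), fun a => τ (seriesField H a), ⟨hK.le,
    fun a ha => (h _ (hd a) (hb a ha)).1, fun a ha => (h _ (hd a) (hb a ha)).2.1,
    fun a ha => (h _ (hd a) (hb a ha)).2.2.1,
    fun a b ha hb' => ((h _ (hd a) (hb a ha)).2.2.2 _ (hd b) (hb b hb')).1,
    fun a b ha hb' => ((h _ (hd a) (hb a ha)).2.2.2 _ (hd b) (hb b hb')).2⟩, ?_, ?_⟩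
  · simpa only [seriesField_zero] using hU0
  · simpa only [seriesField_zero] using hτ0

namespace IsOrbitFamily

variable {δ K : ℝ} {u : SummableSeq → ℝ → E} {τ : SummableSeq → ℝ}

omit [FiniteDimensional ℝ E] in
theorem continuousAt [CompleteSpace E] (hu : IsOrbitFamily f H δ K u τ)
    (hH : IsPerturbationFamily H) {a : SummableSeq} (ha : ‖a‖ < δ) (s : ℝ) :
    ContinuousAt (fun p : SummableSeq × ℝ => u p.1 p.2) (a, s) :=
  (hu.continuousOn hH).continuousAt
    ((isOpen_lt continuous_fst.norm continuous_const).mem_nhds ha)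

omit [FiniteDimensional ℝ E] in
theorem continuousAt_apply [CompleteSpace E] (hu : IsOrbitFamily f H δ K u τ)
    (hH : IsPerturbationFamily H) {a : SummableSeq} (ha : ‖a‖ < δ) (s : ℝ) :
    ContinuousAt (fun b => u b s) a :=
  ContinuousAt.comp (f := fun b : SummableSeq => (b, s)) (hu.continuousAt hH ha s) (by fun_prop)

omit [FiniteDimensional ℝ E] in
theorem continuousAt_period [CompleteSpace E] (hu : IsOrbitFamily f H δ K u τ)
    (hH : IsPerturbationFamily H) {a : SummableSeq} (ha : ‖a‖ < δ) : ContinuousAt τ a := by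
  rw [ContinuousAt, tendsto_iff_norm_sub_tendsto_zero]
  refine squeeze_zero' (g := fun b => K * ‖b - a‖) (Eventually.of_forall fun _ => norm_nonneg _) ?_ ?_
  · filter_upwards [(isOpen_lt continuous_norm continuous_const).mem_nhds ha] with b hb
    exact hu.period_dist_le_norm hH hb ha
  · have : Continuous fun b : SummableSeq => K * ‖b - a‖ := by fun_prop
    simpa using this.tendsto a

omit [FiniteDimensional ℝ E] in
/-- The members of the family, in their original time scale. -/
theorem isPeriodicSolution (hu : IsOrbitFamily f H δ K u τ) {a : SummableSeq} (ha : ‖a‖ < δ) :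
    IsPeriodicSolution (fun y => f y + seriesField H a y) (fun t => u a (t / τ a)) (τ a) := by
  have hτ := hu.period_pos a ha
  refine ⟨hτ, fun t => ?_, fun t => ?_⟩
  · have h := (hu.hasDerivAt a ha (t / τ a)).scomp t ((hasDerivAt_id t).div_const (τ a))
    refine HasDerivAt.congr_deriv (f := fun t => u a (t / τ a)) h ?_
    rw [smul_smul, one_div, inv_mul_cancel₀ hτ.ne', one_smul]
  · rw [add_div, div_self hτ.ne']
    exact hu.periodic a ha _

variable (hu : IsOrbitFamily f H δ K u τ) (hδ : 0 < δ) (hH : IsPerturbationFamily H)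
  (hu0 : ∀ s, u 0 s = x (T * s)) (hτ0 : τ 0 = T)
include hu hδ hH hu0

include hτ0 in
omit [FiniteDimensional ℝ E] in
theorem eventually_isNearOrbit [CompleteSpace E] (hx : Continuous x) {η : ℝ} (hη : 0 < η) :
    ∀ᶠ a in 𝓝 0, IsNearOrbit x T (fun t => u a (t / τ a)) (τ a) η := by
  have h0 : ‖(0 : SummableSeq)‖ < δ := by rwa [norm_zero]
  have hT : T ≠ 0 := hτ0 ▸ (hu.period_pos 0 h0).ne'
  have hτc := hu.continuousAt_period hH h0
  refine Eventually.and ?_ ?_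
  · have h1 : ContinuousAt (fun a => |τ a - T|) 0 := (hτc.sub continuousAt_const).abs
    refine Tendsto.eventually_lt_const (v := |τ 0 - T|) ?_ h1
    simpa [hτ0] using hη
  · refine isCompact_Icc.eventually_forall_of_forall_eventually fun t _ => ?_
    have h1 : ContinuousAt (fun p : SummableSeq × ℝ => p.2 / τ p.1) (0, t) :=
      continuousAt_snd.div (ContinuousAt.comp (f := fun p : SummableSeq × ℝ => p.1) hτc
        continuousAt_fst) (by simpa [hτ0] using hT)
    have h2 : ContinuousAt (fun p : SummableSeq × ℝ => dist (u p.1 (p.2 / τ p.1)) (x p.2)) (0, t) :=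
      (ContinuousAt.comp (g := fun p : SummableSeq × ℝ => u p.1 p.2)
        (f := fun p : SummableSeq × ℝ => (p.1, p.2 / τ p.1))
        (hu.continuousAt hH h0 (t / τ 0)) (continuousAt_fst.prodMk h1)).dist
        (hx.continuousAt.comp continuousAt_snd)
    refine Tendsto.eventually_lt_const (v := dist (u 0 (t / τ 0)) (x t)) ?_ h2
    rwa [hu0, hτ0, mul_div_cancel₀ _ hT, dist_self]

/-- A periodic solution through an equilibrium is constant, but near `a = 0` the orbit still has
different values at two fixed phases. -/
theorem eventually_velocity_ne_zero (hf : ContDiff ℝ 1 f) (hx : IsPeriodicOrbit f x T) :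
    ∀ᶠ a in 𝓝 0, ∀ s, f (u a s) + seriesField H a (u a s) ≠ 0 := by
  have h0 : ‖(0 : SummableSeq)‖ < δ := by rwa [norm_zero]
  obtain ⟨t, ht⟩ := hx.exists_ne 0
  have hne : u 0 (t / T) ≠ u 0 0 := by
    rwa [hu0, hu0, mul_zero, mul_div_cancel₀ _ hx.pos.ne']
  have h1 := (ContinuousAt.ne_iff_eventually_ne (hu.continuousAt_apply hH h0 (t / T))
    (hu.continuousAt_apply hH h0 0)).1 hne
  filter_upwards [h1, (isOpen_lt continuous_norm continuous_const).mem_nhds h0] with a ha haδ s hs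
  have hτ := hu.period_pos a haδ
  have hg : ContDiff ℝ 1 fun y => f y + seriesField H a y :=
    hf.add ((hH.contDiff_seriesField a).of_le (by exact_mod_cast le_top))
  have h2 := eq_of_periodic_of_equilibrium (hg.const_smul (τ a)) one_pos (hu.hasDerivAt a haδ)
    (hu.periodic a haδ) (t₀ := s) (by rw [hs, smul_zero])
  exact ha ((h2 _).trans (h2 _).symm)

end IsOrbitFamily

end OrbitFamily

/-! ### From rigidity to input isomorphisms -/

namespace Network.NodeSpaces

open Set Filter MeasureTheory
open scoped Topology

variable {C : Type u} {A : Type v} {G : Network C A} {S : G.NodeSpaces} [Finite A] [Fintype C]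
  {f : S.State → S.State} {x : ℝ → S.State} {T : ℝ}

omit [Finite A] in
/-- A rigid phase relation holds for an open set of arbitrarily small perturbations from a
sufficiently rich family. -/
theorem RigidlyPhaseRelated.exists_ball {H : ℕ → S.State → S.State} {δ K : ℝ}
    {u : SummableSeq → ℝ → S.State} {τ : SummableSeq → ℝ} {c d : C} {θ : ℝ}
    (hr : S.RigidlyPhaseRelated f x T c d θ) (hu : IsOrbitFamily f H δ K u τ) (hδ : 0 < δ)
    (hH : IsPerturbationFamily H) (hHa : ∀ n, S.IsAdmissible (H n))
    (hu0 : ∀ s, u 0 s = x (T * s)) (hτ0 : τ 0 = T) (hx : Continuous x) :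
    ∃ (a₀ : SummableSeq) (ρ : ℝ) (ε₀ : ℝ), 0 < ρ ∧ 0 < ε₀ ∧ ∀ ε, 0 < ε → ε < ε₀ →
      ∀ a ∈ Metric.ball a₀ ρ, ‖ε • a‖ < δ →
        ∀ s, S.Agrees (u (ε • a) s c) (u (ε • a) (s + θ) d) := by
  have hcd : G.StateEquiv c d := hr.1.1
  -- The threshold for `ε` in the definition of rigidity depends on the direction; `Z N` consists of
  -- the directions for which `1 / (N + 1)` will do. These closed sets cover a Banach space, so by
  -- Baire one of them has interior.
  let Z : ℕ → Set SummableSeq := fun N => {a | ∀ ε : ℝ, 0 < ε → ε < 1 / ((N : ℝ) + 1) →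
    ‖ε • a‖ < δ → ∀ s, S.ident hcd (u (ε • a) s c) = u (ε • a) (s + θ) d}
  have hZ : ∀ N, IsClosed (Z N) := by
    intro N
    rw [isClosed_iff_frequently]
    intro a ha ε hε hεN haδ s
    by_contra hne
    have hsm : ContinuousAt (fun b : SummableSeq => ε • b) a := by fun_prop
    have hcs : ∀ (s : ℝ) (i : C), ContinuousAt (fun b : SummableSeq => u (ε • b) s i) a :=
      fun s i => (continuous_apply i).continuousAt.comp
        (ContinuousAt.comp (f := fun b : SummableSeq => ε • b) (hu.continuousAt_apply hH haδ s) hsm)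
    have h1 := (ContinuousAt.ne_iff_eventually_ne ((S.ident hcd).continuous.continuousAt.comp (hcs s c))
      (hcs (s + θ) d)).1 hne
    have h2 : ∀ᶠ b : SummableSeq in 𝓝 a, ‖ε • b‖ < δ := hsm.norm.eventually_lt_const haδ
    obtain ⟨b, hb, hb1, hb2⟩ := (ha.and_eventually (h1.and h2)).exists
    exact hb1 (hb ε hε hεN hb2 s)
  have hcover : ⋃ N, Z N = univ := by
    refine eq_univ_of_forall fun a => mem_iUnion.2 ?_
    obtain ⟨η, hη, ε₀, hε₀, h⟩ := hr.2 (seriesField H a)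
      ⟨isAdmissible_tsum S hHa a (hH.summable a), hH.contDiff_seriesField a⟩
      ⟨‖a‖, hH.c1BoundedBy_seriesField le_rfl⟩
    have hnear := hu.eventually_isNearOrbit hδ hH hu0 hτ0 hx hη
    have hlim : Tendsto (fun ε : ℝ => ε • a) (𝓝 0) (𝓝 0) := by
      have : Continuous fun ε : ℝ => ε • a := by fun_prop
      simpa using this.tendsto 0
    obtain ⟨ε₁, hε₁, hball⟩ := Metric.eventually_nhds_iff.1 (hlim.eventually hnear)
    obtain ⟨N, hN⟩ := exists_nat_one_div_lt (lt_min hε₀ hε₁)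
    refine ⟨N, fun ε hε hεN haδ s => ?_⟩
    have hε' := hεN.trans hN
    have hn := hball (y := ε) (by
      rw [Real.dist_eq, sub_zero, abs_of_pos hε]
      exact hε'.trans_le (min_le_right _ _))
    have hsol := hu.isPeriodicSolution haδ
    simp only [IsPerturbationFamily.seriesField_smul, Pi.smul_apply] at hsol
    obtain ⟨_, hp⟩ := h ε hε (hε'.trans_le (min_le_left _ _)) _ _ hsol hn
    have hτ := (hu.period_pos _ haδ).ne'
    have := hp (s * τ (ε • a))
    simp only [← add_mul, mul_div_cancel_right₀ _ hτ] at this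
    exact this
  obtain ⟨N, a₀, ha₀⟩ := nonempty_interior_of_iUnion_of_closed hZ hcover
  obtain ⟨ρ, hρ, hball⟩ := Metric.isOpen_iff.1 isOpen_interior a₀ ha₀
  exact ⟨a₀, ρ, 1 / ((N : ℝ) + 1), hρ, by positivity, fun ε hε hεN a ha haδ s =>
    ⟨hcd, interior_subset (hball ha) ε hε hεN haδ s⟩⟩

/-- Rigidly phase-related nodes have input isomorphisms that preserve the phase relation. -/
theorem RigidlyPhaseRelated.exists_inputIso (hG : G.IsTransitive) (hf : S.IsSmoothAdmissible f)
    (hx : IsHyperbolicPeriodicOrbit f x T) {c d : C} {θ : ℝ}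
    (hr : S.RigidlyPhaseRelated f x T c d θ) : ∃ β : G.InputIso c d, ∀ e : G.InputSet c,
      S.PhaseRelated x T (G.tail e.1) (G.tail (β.toEquiv e).1) θ := by
  have : Nonempty C := ⟨c⟩
  have hf1 : ContDiff ℝ 1 f := hf.smooth.of_le (by exact_mod_cast le_top)
  have hxc : Continuous x := continuous_iff_continuousAt.2 fun t => (hx.hasDerivAt t).continuousAt
  obtain ⟨h, hh, hha, hB⟩ := S.exists_bumpFields
  obtain ⟨w, hw, hH⟩ := exists_smul_isPerturbationFamily hh
  obtain ⟨δ, hδ, K, u, τ, hu, hu0, hτ0⟩ := exists_isOrbitFamily hf1 hx hH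
  obtain ⟨a₀, ρ, ε₀, hρ, hε₀, hball⟩ := hr.exists_ball hu hδ hH (fun n => (hha n).const_smul (w n))
    hu0 hτ0 hxc
  have h0 : ‖(0 : SummableSeq)‖ < δ := by rwa [norm_zero]
  -- The ball of good directions, multiplied by a small `ε`, provides open sets of perturbations
  -- arbitrarily near zero on which the relation of `c` and `d` holds. The phases `0` and `θ` are
  -- indexed by `Bool`.
  have hfreq : ∃ᶠ a in 𝓝 (0 : SummableSeq), ∃ β : G.InputIso c d, ∀ (e : G.InputSet c) (s : ℝ),
      S.Agrees (u a s (G.tail e.1)) (u a (s + θ) (G.tail (β.toEquiv e).1)) := by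
    rw [frequently_iff]
    intro V hV
    have hgood := (eventually_mem_set.2 hV).and
      ((hu.eventually_velocity_ne_zero hδ hH hu0 hf1 hx.toIsPeriodicOrbit).and
        ((isOpen_lt continuous_norm continuous_const).mem_nhds h0))
    obtain ⟨V', hV', hV'o, h0V'⟩ := mem_nhds_iff.1 hgood
    have hlim : Tendsto (fun ε : ℝ => ε • a₀) (𝓝[>] 0) (𝓝 0) := by
      have : Continuous fun ε : ℝ => ε • a₀ := by fun_prop
      simpa using (this.tendsto 0).mono_left (nhdsWithin_le_nhds (s := Ioi 0))
    have hpos : ∀ᶠ ε : ℝ in 𝓝[>] 0, 0 < ε := self_mem_nhdsWithin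
    have hsmall : ∀ᶠ ε : ℝ in 𝓝[>] 0, ε < ε₀ := nhdsWithin_le_nhds (Iio_mem_nhds hε₀)
    obtain ⟨ε, hεV, hε', hεε₀⟩ := ((hlim.eventually (hV'o.mem_nhds h0V')).and
      (hpos.and hsmall)).exists
    have hinv : ∀ a : SummableSeq, ε • ε⁻¹ • a = a := fun a => smul_inv_smul₀ hε'.ne' a
    have hWo : IsOpen (V' ∩ (fun a : SummableSeq => ε⁻¹ • a) ⁻¹' Metric.ball a₀ ρ) :=
      hV'o.inter (Metric.isOpen_ball.preimage (continuous_const_smul _))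
    obtain ⟨a, ha, β, hβ⟩ := exists_inputIso_agrees hG hu hH hw hf1 hf.admissible hB
      (fun n => (hh n).smooth.continuous) hha (B := Bool) (fun b => if b then θ else 0) hWo
      ⟨ε • a₀, hεV, by simpa [inv_smul_smul₀ hε'.ne'] using hρ⟩ (fun a ha => (hV' ha.1).2.2)
      (fun a ha => (hV' ha.1).2.1) (c := c) (d := d) (b := false) (b' := true) (fun a ha s => by
        have := hball ε hε' hεε₀ _ ha.2 (by rw [hinv]; exact (hV' ha.1).2.2) s
        rw [hinv] at this
        simpa using this)
    exact ⟨a, (hV' ha.1).1, β, fun e s => by simpa using hβ e s⟩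
  -- As `B(c,d)` is finite, one `β` occurs arbitrarily near zero, and its relations survive in the
  -- limit.
  obtain ⟨β, hβ⟩ : ∃ β : G.InputIso c d, ∃ᶠ a in 𝓝 (0 : SummableSeq), ∀ (e : G.InputSet c) (s : ℝ),
      S.Agrees (u a s (G.tail e.1)) (u a (s + θ) (G.tail (β.toEquiv e).1)) := by
    by_contra! hcon
    refine hfreq ((eventually_all.2 hcon).mono fun a ha => ?_)
    rintro ⟨β, hβ⟩
    obtain ⟨e, s, h⟩ := ha β
    exact h (hβ e s)
  refine ⟨β, fun e => ⟨β.tail_stateEquiv e, fun t => ?_⟩⟩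
  by_contra hne
  have hT := hx.pos.ne'
  have hcs : ∀ (s : ℝ) (i : C), ContinuousAt (fun b : SummableSeq => u b s i) 0 :=
    fun s i => (continuous_apply i).continuousAt.comp (hu.continuousAt_apply hH h0 s)
  have hne' : S.ident (β.tail_stateEquiv e) (u 0 (t / T) (G.tail e.1)) ≠
      u 0 (t / T + θ) (G.tail (β.toEquiv e).1) := by
    rwa [hu0, hu0, mul_add, mul_div_cancel₀ _ hT, mul_comm T]
  have h1 := (ContinuousAt.ne_iff_eventually_ne ((S.ident (β.tail_stateEquiv e)).continuous.continuousAt.comp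
    (hcs (t / T) (G.tail e.1))) (hcs (t / T + θ) _)).1 hne'
  obtain ⟨a, ha, ha1⟩ := (hβ.and_eventually h1).exists
  exact ha1 (ha e (t / T)).2

end Network.NodeSpaces

/-! ### The algebra of phase shifts -/

/-- A permutation of the base that preserves the cardinalities of fibres lifts to a permutation of the
total space of no larger order. -/
theorem exists_perm_lift {Q Y : Type*} [Finite Q] (κ : Q → Y) (g : Equiv.Perm Y)
    (h : ∀ y, Nat.card {a // κ a = y} = Nat.card {a // κ a = g y}) {k : ℕ} (hk : g ^ k = 1) :
    ∃ δ : Equiv.Perm Q, (∀ a, κ (δ a) = g (κ a)) ∧ δ ^ k = 1 := by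
  obtain ⟨e, he⟩ : ∃ e : Q ≃ Σ y, Fin (Nat.card {a // κ a = y}), ∀ a, (e a).1 = κ a :=
    ⟨(Equiv.sigmaFiberEquiv κ).symm.trans (Equiv.sigmaCongrRight fun y => Finite.equivFin _),
      fun a => rfl⟩
  -- Fibres are numbered, and `δ` keeps the number while `g` moves the fibre. Powers keep the
  -- numbers as well, so `g ^ k = 1` gives `δ ^ k = 1`.
  let δ : Equiv.Perm Q :=
    e.trans ((Equiv.sigmaCongr g fun y => finCongr (h y)).trans e.symm)
  have hδ : ∀ a, e (δ a) = ⟨g (e a).1, finCongr (h _) (e a).2⟩ := fun a => e.apply_symm_apply _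
  have hpow : ∀ (m : ℕ) (a : Q), (e ((δ ^ m) a)).1 = (g ^ m) (e a).1 ∧
      ((e ((δ ^ m) a)).2 : ℕ) = (e a).2 := by
    intro m
    induction m with
    | zero => exact fun a => ⟨rfl, rfl⟩
    | succ m ih =>
      intro a
      rw [pow_succ', pow_succ', Equiv.Perm.mul_apply, Equiv.Perm.mul_apply, hδ]
      exact ⟨congrArg g (ih a).1, (ih a).2⟩
  refine ⟨δ, fun a => ?_, Equiv.ext fun a => e.injective ?_⟩
  · rw [← he, hδ, ← he a]
  · have h1 := hpow k a
    rw [hk] at h1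
    have key : ∀ p q : Σ y, Fin (Nat.card {a // κ a = y}), p.1 = q.1 → (p.2 : ℕ) = q.2 → p = q := by
      rintro ⟨y, i⟩ ⟨_, j⟩ rfl hij
      exact congrArg _ (Fin.ext hij)
    exact key _ _ h1.1 h1.2

/-- Multiples of `1/N` are discrete, so `Θ` is cyclic; `1` is a multiple of the generator, which is
therefore `1/k` up to sign. -/
theorem AddSubgroup.exists_eq_div_of_one_mem {Θ : AddSubgroup ℝ} (h1 : (1 : ℝ) ∈ Θ) {N : ℕ}
    (hN : 0 < N) (h : ∀ θ ∈ Θ, ∃ n : ℤ, N * θ = n) :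
    ∃ k : ℕ, 0 < k ∧ (1 / k : ℝ) ∈ Θ ∧ ∀ θ ∈ Θ, ∃ m : ℤ, θ = m / k := by
  have hN' : (0 : ℝ) < N := by exact_mod_cast hN
  obtain ⟨b, hb⟩ := AddSubgroup.cyclic_of_isolated_zero (H := Θ) (a := 1 / N) (by positivity) <| by
    refine Set.disjoint_left.2 fun θ hθ hθ' => ?_
    obtain ⟨n, hn⟩ := h θ hθ
    have h1 : (0 : ℝ) < n := hn ▸ mul_pos hN' hθ'.1
    have h2 : (n : ℝ) < 1 := by
      rw [← hn, mul_comm]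
      exact (lt_div_iff₀ hN').1 hθ'.2
    have h3 : 0 < n := by exact_mod_cast h1
    have h4 : n < 1 := by exact_mod_cast h2
    omega
  rw [← AddSubgroup.zmultiples_eq_closure] at hb
  subst hb
  obtain ⟨n, hn⟩ := AddSubgroup.mem_zmultiples_iff.1 h1
  rw [zsmul_eq_mul] at hn
  have hn0 : n ≠ 0 := by
    rintro rfl
    simp at hn
  have hn0' : (n : ℝ) ≠ 0 := by exact_mod_cast hn0
  have hb : b = 1 / n := by
    rw [eq_div_iff hn0', mul_comm, hn]
  obtain ⟨ε, hε, hεn⟩ : ∃ ε : ℤ, ε * ε = 1 ∧ (n.natAbs : ℤ) = ε * n := by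
    rcases Int.natAbs_eq n with h | h
    · exact ⟨1, by norm_num, by omega⟩
    · exact ⟨-1, by norm_num, by omega⟩
  have hk : ((n.natAbs : ℕ) : ℝ) = ε * n := by
    rw [← Int.cast_natCast, hεn, Int.cast_mul]
  have hε' : (ε : ℝ) * ε = 1 := by exact_mod_cast hε
  have hε0 : (ε : ℝ) ≠ 0 := left_ne_zero_of_mul_eq_one hε'
  have hbk : ∀ m : ℤ, (m : ℝ) * b = (m * ε : ℤ) / ((n.natAbs : ℕ) : ℝ) := fun m => by
    rw [hk, hb]
    push_cast
    field_simp
  refine ⟨n.natAbs, Int.natAbs_pos.2 hn0, ?_, fun θ hθ => ?_⟩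
  · refine AddSubgroup.mem_zmultiples_iff.2 ⟨ε, ?_⟩
    rw [zsmul_eq_mul, hbk, hε, Int.cast_one]
  · obtain ⟨m, rfl⟩ := AddSubgroup.mem_zmultiples_iff.1 hθ
    exact ⟨m * ε, by rw [zsmul_eq_mul, hbk]⟩

namespace Network

variable {C : Type u} {A : Type v} {G : Network C A}

/-- The formal properties of a rigid phase pattern. -/
structure IsPhaseRelation (G : Network C A) (R : C → C → ℝ → Prop) : Prop where
  refl : ∀ c, R c c 0
  symm : ∀ {c d θ}, R c d θ → R d c (-θ)
  trans : ∀ {c d i θ φ}, R c d θ → R d i φ → R c i (θ + φ)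
  one : ∀ c, R c c 1
  inputIso : ∀ {c d θ}, R c d θ → ∃ β : G.InputIso c d, ∀ e : G.InputSet c,
    R (G.tail e.1) (G.tail (β.toEquiv e).1) θ
  int : ∀ {θ : ℝ}, (∀ c, R c c θ) → ∃ n : ℤ, θ = n

namespace IsPhaseRelation

variable {R : C → C → ℝ → Prop} (hR : G.IsPhaseRelation R)
include hR

/-- Synchrony. -/
def sync : Setoid C where
  r c d := R c d 0
  iseqv := ⟨hR.refl, fun h => by simpa using hR.symm h, fun h h' => by simpa using hR.trans h h'⟩

theorem isBalanced : G.IsBalanced hR.sync := fun _ _ h => hR.inputIso h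

/-- If a node has a partner for `θ`, the input isomorphism gives partners to all its inputs; by
transitivity this reaches every node. -/
theorem exists_related (hG : G.IsTransitive) {c d : C} {θ : ℝ} (h : R c d θ) (j : C) :
    ∃ i, R j i θ := by
  refine Relation.ReflTransGen.head_induction_on (motive := fun j _ => ∃ i, R j i θ) (hG j c)
    ⟨d, h⟩ ?_
  rintro _ _ ⟨a, rfl, rfl⟩ _ ⟨i, hi⟩
  obtain ⟨β, hβ⟩ := hR.inputIso hi
  exact ⟨_, hβ ⟨a, rfl⟩⟩

/-- The group of phase shifts. -/
def shifts [hC : Nonempty C] (hG : G.IsTransitive) : AddSubgroup ℝ where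
  carrier := {θ | ∀ j, ∃ i, R j i θ}
  zero_mem' j := ⟨j, hR.refl j⟩
  add_mem' h h' j := by
    obtain ⟨i, hi⟩ := h j
    obtain ⟨l, hl⟩ := h' i
    exact ⟨l, hR.trans hi hl⟩
  -- Reversing the relation at one node gives a partner for the opposite shift at one node only;
  -- `exists_related` spreads it.
  neg_mem' h j := by
    obtain ⟨c⟩ := hC
    obtain ⟨i, hi⟩ := h c
    exact hR.exists_related hG (hR.symm hi) j

theorem mk_eq_iff {c d : C} : Quotient.mk hR.sync c = Quotient.mk hR.sync d ↔ R c d 0 :=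
  Quotient.eq

/-- Partners of synchronous nodes are synchronous, so a choice of partners descends to the colours.
-/
theorem exists_colourMap {θ : ℝ} (h : ∀ j, ∃ i, R j i θ) :
    ∃ p : Quotient hR.sync → Quotient hR.sync, ∀ c d,
      p (Quotient.mk _ c) = Quotient.mk _ d ↔ R c d θ := by
  choose π hπ using h
  refine ⟨Quotient.lift (fun j => Quotient.mk _ (π j)) fun c d hcd => ?_, fun c d => ?_⟩
  · refine hR.mk_eq_iff.2 ?_
    have hcd' : R c d 0 := hcd
    have := hR.trans (hR.symm (hπ c)) (hR.trans hcd' (hπ d))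
    rwa [zero_add, neg_add_cancel] at this
  · refine hR.mk_eq_iff.trans ⟨fun h => ?_, fun h => ?_⟩
    · simpa using hR.trans (hπ c) h
    · simpa using hR.trans (hR.symm (hπ c)) h

/-- Every phase shift permutes the colours. -/
theorem exists_colourPerm [Nonempty C] (hG : G.IsTransitive) {θ : ℝ} (h : θ ∈ hR.shifts hG) :
    ∃ p : Equiv.Perm (Quotient hR.sync), ∀ c d,
      p (Quotient.mk _ c) = Quotient.mk _ d ↔ R c d θ := by
  obtain ⟨p, hp⟩ := hR.exists_colourMap h
  obtain ⟨q, hq⟩ := hR.exists_colourMap ((hR.shifts hG).neg_mem h)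
  refine ⟨⟨p, q, fun x => ?_, fun x => ?_⟩, hp⟩
  · induction x using Quotient.inductionOn with
    | _ c =>
      obtain ⟨d, hd⟩ := h c
      rw [(hp c d).2 hd, hq]
      exact hR.symm hd
  · induction x using Quotient.inductionOn with
    | _ c =>
      obtain ⟨d, hd⟩ := (hR.shifts hG).neg_mem h c
      rw [(hq c d).2 hd, hp]
      simpa using hR.symm hd

theorem colourPerm_pow {θ : ℝ} {p : Equiv.Perm (Quotient hR.sync)}
    (hp : ∀ c d, p (Quotient.mk _ c) = Quotient.mk _ d ↔ R c d θ) (m : ℕ) (c d : C) :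
    (p ^ m) (Quotient.mk _ c) = Quotient.mk _ d ↔ R c d (m * θ) := by
  induction m generalizing d with
  | zero => simpa using hR.mk_eq_iff
  | succ m ih =>
    rw [pow_succ', Equiv.Perm.mul_apply]
    obtain ⟨i, hi⟩ := Quotient.exists_rep ((p ^ m) (Quotient.mk _ c))
    have h1 := (ih i).1 hi.symm
    rw [← hi, hp]
    constructor
    · intro h
      have := hR.trans h1 h
      rwa [← add_one_mul, ← Nat.cast_succ] at this
    · intro h
      have := hR.trans (hR.symm h1) h
      rwa [Nat.cast_succ, add_one_mul, neg_add_cancel_left] at this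

theorem colourPerm_zpow {θ : ℝ} {p : Equiv.Perm (Quotient hR.sync)}
    (hp : ∀ c d, p (Quotient.mk _ c) = Quotient.mk _ d ↔ R c d θ) (m : ℤ) (c d : C) :
    (p ^ m) (Quotient.mk _ c) = Quotient.mk _ d ↔ R c d (m * θ) := by
  obtain ⟨n, rfl | rfl⟩ := m.eq_nat_or_neg
  · simpa using hR.colourPerm_pow hp n c d
  · rw [zpow_neg, zpow_natCast, Equiv.Perm.inv_eq_iff_eq, eq_comm, hR.colourPerm_pow hp]
    constructor <;> intro h <;> simpa using hR.symm h

/-- A permutation of the colours by a phase shift extends to a symmetry of the quotient network. -/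
theorem exists_symmetry [Finite A] {θ : ℝ} {p : Equiv.Perm (Quotient hR.sync)}
    (hp : ∀ c d, p (Quotient.mk _ c) = Quotient.mk _ d ↔ R c d θ) {k : ℕ} (hk : p ^ k = 1) :
    ∃ γ : (G.quotient hR.sync).symmetryGroup, γ.1.1 = p ∧ γ ^ k = 1 := by
  -- `κ` records the data that the arrow part of a symmetry has to respect. Its fibres are the
  -- arrows of one type between two colours, and an input isomorphism between the representatives of
  -- `q` and `p q` shows that `g` preserves their sizes.
  let κ : {a : A // (Quotient.mk hR.sync (G.head a)).out = G.head a} →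
      Quotient hR.sync × Quotient hR.sync × Quotient G.arrowType := fun a =>
    (Quotient.mk _ (G.head a.1), Quotient.mk _ (G.tail a.1), Quotient.mk _ a.1)
  let g : Equiv.Perm (Quotient hR.sync × Quotient hR.sync × Quotient G.arrowType) :=
    p.prodCongr (p.prodCongr (Equiv.refl _))
  have hg : ∀ m : ℕ, ∀ y, (g ^ m) y = ((p ^ m) y.1, (p ^ m) y.2.1, y.2.2) := by
    intro m
    induction m with
    | zero => exact fun y => rfl
    | succ m ih =>
      intro y
      rw [pow_succ', pow_succ', Equiv.Perm.mul_apply, ih]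
      rfl
  have hout : ∀ q, R q.out (p q).out θ := fun q => by
    rw [← hp, Quotient.out_eq, Quotient.out_eq]
  have hfib : ∀ q q' α, Nat.card {a // κ a = (q, q', α)} =
      Nat.card {e : G.InputSet q.out // Quotient.mk hR.sync (G.tail e.1) = q' ∧
        Quotient.mk G.arrowType e.1 = α} := by
    intro q q' α
    refine Nat.card_congr ⟨fun a => ⟨⟨a.1.1, ?_⟩, ?_⟩, fun e => ⟨⟨e.1.1, ?_⟩, ?_⟩, fun _ => rfl,
      fun _ => rfl⟩
    · rw [← a.1.2]
      exact congrArg Quotient.out (congrArg Prod.fst a.2)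
    · exact ⟨congrArg (fun y => y.2.1) a.2, congrArg (fun y => y.2.2) a.2⟩
    · rw [e.1.2, Quotient.out_eq]
    · refine Prod.ext ?_ (Prod.ext e.2.1 e.2.2)
      change Quotient.mk _ (G.head e.1.1) = q
      rw [e.1.2, Quotient.out_eq]
  have hcard : ∀ y, Nat.card {a // κ a = y} = Nat.card {a // κ a = g y} := by
    rintro ⟨q, q', α⟩
    change _ = Nat.card {a // κ a = (p q, p q', α)}
    rw [hfib, hfib]
    obtain ⟨β, hβ⟩ := hR.inputIso (hout q)
    refine Nat.card_congr (β.toEquiv.subtypeEquiv fun e => ?_)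
    rw [← (hp _ _).2 (hβ e), p.injective.eq_iff,
      Quotient.sound (s := G.arrowType) (β.arrowType_eq e)]
  obtain ⟨δ, hδ, hδk⟩ := exists_perm_lift κ g hcard (k := k)
    (Equiv.ext fun y => by rw [hg, hk]; rfl)
  refine ⟨⟨(p, δ), fun a => congrArg Prod.fst (hδ a), fun a => congrArg (fun y => y.2.1) (hδ a),
    fun q => ?_, fun a => Quotient.exact (s := G.arrowType) (congrArg (fun y => y.2.2) (hδ a))⟩, rfl,
    Subtype.ext (Prod.ext hk hδk)⟩
  obtain ⟨β, -⟩ := hR.inputIso (hout q)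
  exact G.nodeType.symm β.nodeType_eq

/-- The phase shifts of a transitive network are realised by a cyclic symmetry group of the quotient
by synchrony. -/
theorem exists_cyclic_symmetry [Finite C] [Nonempty C] [Finite A] (hG : G.IsTransitive) :
    ∃ (γ : (G.quotient hR.sync).symmetryGroup) (k : ℕ), 0 < k ∧ orderOf γ = k ∧
      (∀ c d θ, R c d θ → ∃ m : ℤ, θ = m / k ∧
        (γ ^ m).1.1 (Quotient.mk hR.sync c) = Quotient.mk hR.sync d) ∧
      ∀ c d, γ.1.1 (Quotient.mk hR.sync c) = Quotient.mk hR.sync d → R c d (1 / k) := by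
  -- The `N`-th power of every colour permutation is trivial, so `N * θ` relates each node to itself
  -- and is an integer.
  have hN : 0 < Nat.card (Equiv.Perm (Quotient hR.sync)) := Nat.card_pos
  obtain ⟨k, hk, hkΘ, hΘ⟩ := (hR.shifts hG).exists_eq_div_of_one_mem (fun j => ⟨j, hR.one j⟩) hN
    fun θ hθ => by
      obtain ⟨p, hp⟩ := hR.exists_colourPerm hG hθ
      refine hR.int fun c => (hR.colourPerm_pow hp _ c c).1 ?_
      rw [pow_card_eq_one']
      rfl
  have hk' : (k : ℝ) ≠ 0 := by exact_mod_cast hk.ne'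
  obtain ⟨p, hp⟩ := hR.exists_colourPerm hG hkΘ
  have hpk : p ^ k = 1 := by
    refine Equiv.ext fun q => ?_
    induction q using Quotient.inductionOn with
    | _ c =>
      refine (hR.colourPerm_pow hp k c c).2 ?_
      rw [mul_one_div_cancel hk']
      exact hR.one c
  obtain ⟨γ, rfl, hγ⟩ := hR.exists_symmetry hp hpk
  refine ⟨γ, k, hk, (orderOf_eq_iff hk).2 ⟨hγ, fun m hmk hm h => ?_⟩, fun c d θ h => ?_,
    fun c d => (hp c d).1⟩
  -- A trivial power `γ ^ m` with `0 < m < k` would make `m / k` an integer.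
  · obtain ⟨n, hn⟩ := hR.int (θ := m * (1 / k)) fun c => (hR.colourPerm_pow hp m c c).1 (by
      change (γ ^ m).1.1 _ = _
      rw [h]
      rfl)
    rw [mul_one_div, div_eq_iff hk'] at hn
    have hn' : (m : ℤ) = n * k := by exact_mod_cast hn
    have h1 : 0 < n := by
      by_contra hcon
      have : n * (k : ℤ) ≤ 0 := mul_nonpos_of_nonpos_of_nonneg (by omega) (by omega)
      omega
    have : (k : ℤ) ≤ n * k := le_mul_of_one_le_left (by omega) h1
    omega
  · obtain ⟨m, rfl⟩ := hΘ θ (hR.exists_related hG h)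
    exact ⟨m, rfl, (hR.colourPerm_zpow hp m c d).2 (by rwa [mul_one_div])⟩

end IsPhaseRelation

end Network

/-! ### Rigid phase patterns and the conclusion -/

namespace Network.NodeSpaces

variable {C : Type u} {A : Type v} {G : Network C A} {S : G.NodeSpaces} {x : ℝ → S.State} {T : ℝ}

theorem PhaseRelated.refl (c : C) : S.PhaseRelated x T c c 0 :=
  ⟨StateEquiv.refl c, fun t => by simp⟩

theorem PhaseRelated.symm {c d : C} {θ : ℝ} (h : S.PhaseRelated x T c d θ) :
    S.PhaseRelated x T d c (-θ) := by
  obtain ⟨h, hx⟩ := h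
  refine ⟨h.symm, fun t => (S.ident_eq_iff h.symm _ _).2 ?_⟩
  rw [hx, neg_mul, neg_add_cancel_right]

theorem PhaseRelated.trans {c d i : C} {θ φ : ℝ} (h : S.PhaseRelated x T c d θ)
    (h' : S.PhaseRelated x T d i φ) : S.PhaseRelated x T c i (θ + φ) := by
  obtain ⟨h, hx⟩ := h
  obtain ⟨h', hx'⟩ := h'
  refine ⟨h.trans h', fun t => ?_⟩
  rw [← S.ident_ident h h', hx, hx', add_assoc, ← add_mul]

theorem synchronous_iff {c d : C} : S.Synchronous x c d ↔ S.PhaseRelated x T c d 0 := by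
  simp only [Synchronous, PhaseRelated, zero_mul, add_zero]

theorem phaseRelated_one (hx : Function.Periodic x T) (c : C) : S.PhaseRelated x T c c 1 :=
  ⟨StateEquiv.refl c, fun t => by rw [one_mul, hx, S.ident_refl]⟩

/-- A shift common to all nodes is a period of the whole orbit; a nonzero fractional part would give
a period shorter than `T`. -/
theorem exists_int_of_phaseRelated [Fintype C] {f : S.State → S.State} (hx : IsPeriodicOrbit f x T)
    {θ : ℝ} (h : ∀ c, S.PhaseRelated x T c c θ) : ∃ n : ℤ, θ = n := by
  have hper : Function.Periodic x (θ * T) := fun t => funext fun c => by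
    obtain ⟨h, hc⟩ := h c
    rw [← hc, S.ident_refl]
  have hfract : Function.Periodic x (Int.fract θ * T) := by
    have := hper.sub_period (hx.periodic.int_mul ⌊θ⌋)
    rwa [← sub_mul] at this
  refine ⟨⌊θ⌋, ?_⟩
  by_contra hne
  have hpos : 0 < Int.fract θ := by
    rw [Int.fract_pos]
    exact hne
  exact hx.least _ (mul_pos hpos hx.pos) (mul_lt_of_lt_one_left hx.pos (Int.fract_lt_one θ)) hfract

theorem isPhaseRelation [Finite A] [Fintype C] {f : S.State → S.State} (hG : G.IsTransitive)
    (hf : S.IsSmoothAdmissible f) (hx : IsHyperbolicPeriodicOrbit f x T)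
    (hr : S.HasRigidPhasePattern f x T) : G.IsPhaseRelation (S.PhaseRelated x T) where
  refl := PhaseRelated.refl
  symm := PhaseRelated.symm
  trans := PhaseRelated.trans
  one := phaseRelated_one hx.periodic
  inputIso h := (hr _ _ _ h).exists_inputIso hG hf hx
  int := exists_int_of_phaseRelated hx.toIsPeriodicOrbit

end Network.NodeSpaces

theorem corollary13p2 {C : Type*} {A : Type*} [Fintype C] [Finite A] (G : Network C A)
    (hG : G.IsTransitive) (S : G.NodeSpaces)
    (f : S.State → S.State) (hf : S.IsSmoothAdmissible f)
    (x : ℝ → S.State) (T : ℝ) (hX : S.IsStronglyHyperbolic f x T)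
    (hrigid : S.HasRigidPhasePattern f x T) :
    ∃ s : Setoid C, G.IsBalanced s ∧
      ∃ (γ : (G.quotient s).symmetryGroup) (k : ℕ), 0 < k ∧ orderOf γ = k ∧
        (∀ c d : C, s c d ↔ S.Synchronous x c d) ∧
        (∀ (c d : C) (θ : ℝ), S.RigidlyPhaseRelated f x T c d θ →
          ∃ m : ℤ, θ = m / k ∧ (γ ^ m).1.1 (Quotient.mk s c) = Quotient.mk s d) ∧
        (∀ c d : C, γ.1.1 (Quotient.mk s c) = Quotient.mk s d →
          S.PhaseRelated x T c d (1 / k)) := by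
  have hR := Network.NodeSpaces.isPhaseRelation hG hf hX.1 hrigid
  -- The orbit is not constant, so the network has at least one node.
  obtain ⟨t, ht⟩ := hX.1.toIsPeriodicOrbit.exists_ne 0
  obtain ⟨c, -⟩ := Function.ne_iff.1 ht
  have : Nonempty C := ⟨c⟩
  obtain ⟨γ, k, hk, hγ, h1, h2⟩ := hR.exists_cyclic_symmetry hG
  exact ⟨hR.sync, hR.isBalanced, γ, k, hk, hγ, fun c d => Network.NodeSpaces.synchronous_iff.symm,
    fun c d θ h => h1 c d θ h.1, h2⟩
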